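/- A P-time event graph (P-TEG) with transitions $t_1,\dots,t_n$ consists of finitely many places $p$, each with exactly one upstream and one downstream transition, an initial marking in $\{0,1\}$ and a time window $[\tau_p^-,\tau_p^+]$, where $\tau_p^-\in\mathbb R_{\ge 0}$, $\tau_p^+\in\mathbb R_{\ge 0}\cup\{\infty\}$, $\tau_p^-\le\tau_p^+$; no two places have the same marking, upstream and downstream transition. For $\mu\in\{0,1\}$ put $A^\mu_{ij}=\tau_p^-$, $B^\mu_{ij}=\tau_p^+$ if there is a place $p$ with marking $\mu$ from $t_j$ to $t_i$, and $A^\mu_{ij}=-\infty$, $B^\mu_{ij}=\infty$ otherwise. The P-TEG is weakly consistent (WC) if for every integer $K\ge 0$ there are $x(0)\le x(1)\le\dots\le x(K)$ in $\mathbb R^n$ (ordered entrywise) such that, for all $i$, $\max_j(A^0_{ij}+x_j(k))\le x_i(k)\le\min_j(B^0_{ij}+x_j(k))$ for $0\le k\le K$ and $\max_j(A^1_{ij}+x_j(k))\le x_i(k+1)\le\min_j(B^1_{ij}+x_j(k))$ for $0\le k<K$. Let $P_{ij}=-B^1_{ji}$, let $I$ be the entrywise maximum of $A^1$ and the max-plus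 identity matrix ($0$ on the diagonal, $-\infty$ elsewhere), and let $C_{ij}=\max(A^0_{ij},-B^0_{ji})$. The periodic graph has the nodes $(i,z)$ with row $i\in\{1,\dots,n\}$ and column $z\in\mathbb Z$, and the arcs $(j,z)\to(i,z-1)$, $(j,z)\to(i,z+1)$, $(j,z)\to(i,z)$ of weight $P_{ij}$, $I_{ij}$, $C_{ij}$ respectively, wherever this weight is not $-\infty$. Paths have length (number of arcs) at least $1$, the weight of a path is the sum of the weights of its arcs, and a circuit is a path that ends where it starts. Let $S_i$ be the set of pairs $(t,w)$ such that there is a path of length at most $n$ from $(i,0)$ to $(i,t)$ and $w$ is the maximum weight of such paths. Let $R_{ij}$ be the maximum weight of the circuits of length at most $n^2$ that start in column $0$ and meet both row $i$ and row $j$ ($-\infty$ if there is none). Let $M_K$ be the block tridiagonal matrix with $K+1$ diagonal blocks $C$, blocks $P$ above and $I$ below the diagonal, and $-\infty$ elsewhere, its blocks being indexed by the columns $0,\dots,K$; let $M_K^*$ be its Kleene star, the entrywise supremum of the max-plus powers of exponent $\ge 0$. Put $h=\lfloor n^2/2\rfloor$. Theorem (WC can be verified in strongly polynomial time). 1. The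 following are equivalent for every P-TEG: (a) it is weakly consistent; (b) its periodic graph has no circuit of positive weight; (c) Algorithm 1 returns true, i.e. there are no $i,j$ with $R_{ij}\ne-\infty$, $(t,w)\in S_i$, $(t',w')\in S_j$ for which $yt+y't'=0$, $yw+y'w'>0$ has a solution in integers $y,y'\ge 0$; (d) the precedence graphs of $M_{2n}$ and $M_{2h}$ have no circuit of positive weight, and the test in (c) succeeds when $S_i$ and $R$ are replaced by the data read off the Kleene stars: the set of all $(t,w)$, $|t|\le n$, $w\neq-\infty$, with $w$ the entry of $M_{2n}^*$ from row $i$ of column $n$ to row $i$ of column $n+t$; and the matrix with the entries $\max_{0\le l\le 2h}(a_l+b_l)$, where $a_l$ and $b_l$ are the entries of $M_{2h}^*$ from row $i$ of column $h$ to row $j$ of column $l$ and back. 2. There is a program for the additive real random access machine (integer registers; arrays of extended reals addressed by lists of integer registers; unit-cost assignments, additions, negations or subtractions, and comparisons), independent of $n$ and of the P-TEG, that on the input $n,A^0,A^1,B^0,B^1$ computes all $S_i$ and $R$ and decides WC in $O(n^{10})$ steps. 3. There is such a program that decides WC in $O(n^9)$ steps and computes $M_{2n}^*$ and $M_{2h}^*$,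 each of them whenever the precedence graph of the respective matrix has no circuit of positive weight. -/

import Mathlib

open scoped NNReal ENNReal

noncomputable section

namespace WeakConsistency

/-! ## P-time event graphs -/

/-- An unweighted P-time Petri net: places, transitions, arcs, marking and time windows
`[lo p, hi p]` with `lo p` a nonnegative real and `hi p` a nonnegative real or infinite. -/
structure PTimePetriNet (Place Trans : Type*) where
  /-- arcs from places to transitions -/
  pre : Set (Place × Trans)
  /-- arcs from transitions to places -/
  post : Set (Trans × Place)
  marking : Place → ℕ
  lo : Place → ℝ≥0
  hi : Place → ℝ≥0∞
  lo_le_hi : ∀ p, (lo p : ℝ≥0∞) ≤ hi p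

/-- A P-time event graph with transitions `t_1, …, t_n` in which every place initially holds 0 or 1
tokens.  Two places with the same marking and the same upstream and downstream transitions coincide,
so that each entry of the characteristic matrices comes from at most one place. -/
structure PTEG (Place : Type*) (n : ℕ) extends PTimePetriNet Place (Fin n) where
  eventGraph : ∀ p, ∃! u : Fin n × Fin n, (u.1, p) ∈ post ∧ (p, u.2) ∈ pre
  marking_le_one : ∀ p, marking p ≤ 1
  place_unique : ∀ p q, ∀ tup tdown : Fin n, marking p = marking q →
    (tup, p) ∈ post → (p, tdown) ∈ pre → (tup, q) ∈ post → (q, tdown) ∈ pre → p = q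

/-! ## Max-plus matrices

`Rbar` is `EReal`, in which `⊥ + ⊤ = ⊥`; hence `+` of `EReal` is the max-plus product. -/

/-- Max-plus matrix product. -/
def mpMul {V : Type*} (A B : Matrix V V EReal) : Matrix V V EReal :=
  fun i j => ⨆ k, A i k + B k j

open Classical in
/-- Max-plus identity matrix. -/
def mpOne (V : Type*) : Matrix V V EReal := fun i j => if i = j then 0 else ⊥

/-- Max-plus powers. -/
def mpPow {V : Type*} (A : Matrix V V EReal) : ℕ → Matrix V V EReal
  | 0 => mpOne V
  | r + 1 => mpMul (mpPow A r) A

/-- Kleene star: the entrywise supremum of all max-plus powers. -/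
def kleeneStar {V : Type*} (A : Matrix V V EReal) : Matrix V V EReal :=
  fun i j => ⨆ r : ℕ, mpPow A r i j

/-- The precedence graph of `A` has no circuit of positive weight. -/
def NoPosCircuitMatrix {V : Type*} (A : Matrix V V EReal) : Prop :=
  ∀ r : ℕ, 1 ≤ r → ∀ i, mpPow A r i i ≤ 0

/-- `A ↦ A^♯ = -Aᵀ`. -/
def sharp {V : Type*} (A : Matrix V V EReal) : Matrix V V EReal := fun i j => -A j i

/-! ## Weighted directed graphs, paths and circuits -/

/-- A weighted directed graph; weight `⊥` means that the arc is absent. -/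
abbrev WGraph (V : Type*) := V → V → EReal

/-- A path is a sequence of at least two nodes in which consecutive nodes are joined by arcs. -/
def IsPath {V : Type*} (G : WGraph V) (ρ : List V) : Prop :=
  2 ≤ ρ.length ∧ ρ.IsChain (fun a b => G a b ≠ ⊥)

/-- The length of a path is its number of arcs. -/
def pathLength {V : Type*} (ρ : List V) : ℕ := ρ.length - 1

/-- The weight of a path is the sum of the weights of its arcs. -/
def pathWeight {V : Type*} (G : WGraph V) : List V → EReal
  | a :: b :: l => G a b + pathWeight G (b :: l)
  | _ => 0

/-- A circuit is a path whose first and last nodes agree. -/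
def IsCircuit {V : Type*} (G : WGraph V) (ρ : List V) : Prop :=
  IsPath G ρ ∧ ρ.head? = ρ.getLast?

/-- The periodic graph of `P, I, C`, on the nodes (row, column).  Its arcs are `(j,z) → (i,z-1)` of
weight `P i j`, `(j,z) → (i,z+1)` of weight `I i j`, and `(j,z) → (i,z)` of weight `C i j`. -/
def periodicGraph {n : ℕ} (P I C : Matrix (Fin n) (Fin n) EReal) : WGraph (Fin n × ℤ) :=
  fun a b =>
    if b.2 = a.2 - 1 then P b.1 a.1
    else if b.2 = a.2 + 1 then I b.1 a.1
    else if b.2 = a.2 then C b.1 a.1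
    else ⊥

/-- The block tridiagonal matrix `M_K` with `K + 1` diagonal blocks `C`, the blocks `P` above and the
blocks `I` below the diagonal. -/
def blockMatrix {n : ℕ} (P I C : Matrix (Fin n) (Fin n) EReal) (K : ℕ) :
    Matrix (Fin (K + 1) × Fin n) (Fin (K + 1) × Fin n) EReal :=
  fun a b =>
    if b.1.val = a.1.val + 1 then P a.2 b.2
    else if a.1.val = b.1.val + 1 then I a.2 b.2
    else if a.1 = b.1 then C a.2 b.2
    else ⊥

namespace PTEG

variable {Place : Type*} {n : ℕ}

/-- `A^μ`: the entry `(i, j)` is `lo p` for the place `p` with `μ` tokens from `t_j` to `t_i`, and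
`⊥` if there is no such place. -/
def matA (N : PTEG Place n) (μ : ℕ) : Matrix (Fin n) (Fin n) EReal :=
  fun i j => ⨆ (p : Place) (_ : N.marking p = μ ∧ (j, p) ∈ N.post ∧ (p, i) ∈ N.pre),
    (((N.lo p : ℝ≥0) : ℝ) : EReal)

/-- `B^μ`: the entry `(i, j)` is `hi p` for the place `p` with `μ` tokens from `t_j` to `t_i`, and
`⊤` if there is no such place. -/
def matB (N : PTEG Place n) (μ : ℕ) : Matrix (Fin n) (Fin n) EReal :=
  fun i j => ⨅ (p : Place) (_ : N.marking p = μ ∧ (j, p) ∈ N.post ∧ (p, i) ∈ N.pre),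
    ((N.hi p : ℝ≥0∞) : EReal)

/-- The finite trajectory `x 0, …, x K` of the (nondecreasing) dater function is consistent; `x k i`
is the time of the `(k+1)`st firing of `t_i`. -/
def IsConsistentUpTo (N : PTEG Place n) (K : ℕ) (x : ℕ → Fin n → ℝ) : Prop :=
  (∀ k ≤ K, ∀ i,
    (⨆ j, N.matA 0 i j + (x k j : EReal)) ≤ (x k i : EReal) ∧
    (x k i : EReal) ≤ ⨅ j, N.matB 0 i j + (x k j : EReal)) ∧
  (∀ k < K, ∀ i,
    (⨆ j, N.matA 1 i j + (x k j : EReal)) ≤ (x (k + 1) i : EReal) ∧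
    (x (k + 1) i : EReal) ≤ ⨅ j, N.matB 1 i j + (x k j : EReal)) ∧
  (∀ k < K, ∀ i, x k i ≤ x (k + 1) i)

/-- Weak consistency: there are consistent finite trajectories of every length. -/
def WeaklyConsistent (N : PTEG Place n) : Prop :=
  ∀ K : ℕ, ∃ x : ℕ → Fin n → ℝ, N.IsConsistentUpTo K x

/-- `P = (B^1)^♯`. -/
def matP (N : PTEG Place n) : Matrix (Fin n) (Fin n) EReal := sharp (N.matB 1)

/-- `I = A^1 ⊕ E`. -/
def matI (N : PTEG Place n) : Matrix (Fin n) (Fin n) EReal :=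
  fun i j => max (N.matA 1 i j) (mpOne (Fin n) i j)

/-- `C = A^0 ⊕ (B^0)^♯`. -/
def matC (N : PTEG Place n) : Matrix (Fin n) (Fin n) EReal :=
  fun i j => max (N.matA 0 i j) (sharp (N.matB 0) i j)

/-- The periodic graph of the P-TEG. -/
def graph (N : PTEG Place n) : WGraph (Fin n × ℤ) := periodicGraph N.matP N.matI N.matC

/-- The periodic graph has a circuit of positive weight. -/
def HasPosCircuit (N : PTEG Place n) : Prop :=
  ∃ ρ, IsCircuit N.graph ρ ∧ 0 < pathWeight N.graph ρ

/-! ### The data of the algorithm -/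

/-- The paths of length at most `n` from `(i, 0)` to `(i, t)`. -/
def pathsQ (N : PTEG Place n) (i : Fin n) (t : ℤ) : Set (List (Fin n × ℤ)) :=
  {ρ | IsPath N.graph ρ ∧ ρ.head? = some (i, 0) ∧ ρ.getLast? = some (i, t) ∧ pathLength ρ ≤ n}

/-- `S_i`: the pairs `(t, w)` with `w` the maximum weight of the paths of length at most `n` from
`(i, 0)` to `(i, t)`. -/
def setS (N : PTEG Place n) (i : Fin n) : Set (ℤ × ℝ) :=
  {q | IsGreatest (pathWeight N.graph '' N.pathsQ i q.1) (q.2 : EReal)}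

/-- The circuits of length at most `n²`, from a node in column 0, that meet the rows `i` and `j`. -/
def circuitsR (N : PTEG Place n) (i j : Fin n) : Set (List (Fin n × ℤ)) :=
  {ρ | IsCircuit N.graph ρ ∧ (∃ u : Fin n, ρ.head? = some (u, 0)) ∧ pathLength ρ ≤ n ^ 2 ∧
    (∃ z : ℤ, (i, z) ∈ ρ) ∧ ∃ l : ℤ, (j, l) ∈ ρ}

/-- `R i j`: the maximum weight of those circuits (finitely many), and `⊥` if there is none. -/
def matR (N : PTEG Place n) : Matrix (Fin n) (Fin n) EReal :=
  fun i j => sSup (pathWeight N.graph '' N.circuitsR i j)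

end PTEG

/-- Solvability of `y t + y' t' = 0`, `y w + y' w' > 0` in nonnegative integers `y, y'`. -/
def DiophantineSolvable (q q' : ℤ × ℝ) : Prop :=
  ∃ y y' : ℕ, (y : ℤ) * q.1 + (y' : ℤ) * q'.1 = 0 ∧ 0 < (y : ℝ) * q.2 + (y' : ℝ) * q'.2

namespace PTEG

variable {Place : Type*} {n : ℕ}

/-- The outcome of the algorithm is `true`: no pair of rows `i, j` with `R i j ≠ -∞` and no pairs in
`S_i`, `S_j` give a solvable Diophantine system. -/
def AlgorithmAccepts (N : PTEG Place n) : Prop :=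
  ∀ i j, N.matR i j ≠ ⊥ → ∀ q ∈ N.setS i, ∀ q' ∈ N.setS j, ¬ DiophantineSolvable q q'

/-- `M_K`. -/
def matM (N : PTEG Place n) (K : ℕ) :
    Matrix (Fin (K + 1) × Fin n) (Fin (K + 1) × Fin n) EReal :=
  blockMatrix N.matP N.matI N.matC K

/-- The analogue of `S_i` read off the Kleene star of `M_{2n}`: the pairs `(t, w)` with `w ≠ -∞` the
entry of the star from row `i` of the middle column `n` to row `i` of column `n + t`. -/
def starS (N : PTEG Place n) (i : Fin n) : Set (ℤ × ℝ) :=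
  {q | ∃ a : Fin (2 * n + 1), (a.val : ℤ) = n + q.1 ∧
    kleeneStar (N.matM (2 * n)) (a, i) (⟨n, by omega⟩, i) = (q.2 : EReal)}

/-- The analogue of `R` read off the Kleene star of `M_{2h}`, `h = ⌊n²/2⌋`: the maximum weight of a
closed walk from row `i` of the middle column `h` through row `j`. -/
def starR (N : PTEG Place n) : Matrix (Fin n) (Fin n) EReal :=
  fun i j => ⨆ l : Fin (2 * (n ^ 2 / 2) + 1),
    kleeneStar (N.matM (2 * (n ^ 2 / 2))) (l, j) (⟨n ^ 2 / 2, by omega⟩, i) +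
    kleeneStar (N.matM (2 * (n ^ 2 / 2))) (⟨n ^ 2 / 2, by omega⟩, i) (l, j)

/-- The test of the variant with Kleene stars: the precedence graphs of both matrices have no
positive circuit, and no Diophantine system built from the two stars is solvable. -/
def StarTestAccepts (N : PTEG Place n) : Prop :=
  NoPosCircuitMatrix (N.matM (2 * n)) ∧ NoPosCircuitMatrix (N.matM (2 * (n ^ 2 / 2))) ∧
  ∀ i j, N.starR i j ≠ ⊥ → ∀ q ∈ N.starS i, ∀ q' ∈ N.starS j, ¬ DiophantineSolvable q q'

end PTEG

/-! ## An additive real random access machine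

Integer registers, used for control and for addressing, and arrays of extended reals.  Every
instruction and every test costs one step.  The only arithmetic is addition, subtraction (negation)
and comparison: there is no multiplication, no rounding, and no real constant besides `0` and `-∞`.
A program is a finite text that does not depend on the size of the input.  On rational data each
step lengthens the numerators (over a common denominator of the data) by at most one bit, so a
polynomial bound for the number of steps is a strongly polynomial running time. -/

/-- A cell of an array: the name of the array and the integer registers that hold the indices. -/
abbrev Cell := ℕ × List ℕ

/-- A configuration of the memory. -/
structure Memory where
  int : ℕ → ℤ
  real : ℕ → List ℤ → EReal

namespace Memory

/-- Write an integer register. -/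
def setInt (σ : Memory) (x : ℕ) (v : ℤ) : Memory :=
  { σ with int := Function.update σ.int x v }

/-- Read a cell. -/
def get (σ : Memory) (r : Cell) : EReal := σ.real r.1 (r.2.map σ.int)

/-- Write a cell. -/
def set (σ : Memory) (r : Cell) (v : EReal) : Memory where
  int := σ.int
  real := Function.update σ.real r.1 (Function.update (σ.real r.1) (r.2.map σ.int) v)

end Memory

/-- Tests: comparison of two integer registers, or of two cells. -/
inductive Test
  | intLe (x y : ℕ)
  | realLe (r s : Cell)

/-- The truth value of a test. -/
def Test.Holds (σ : Memory) : Test → Prop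
  | .intLe x y => σ.int x ≤ σ.int y
  | .realLe r s => σ.get r ≤ σ.get s

/-- Programs. -/
inductive Program
  | skip
  /-- `x := c` -/
  | intConst (x : ℕ) (c : ℤ)
  /-- `x := y + z` -/
  | intAdd (x y z : ℕ)
  /-- `x := y - z` -/
  | intSub (x y z : ℕ)
  /-- `r := 0` -/
  | realZero (r : Cell)
  /-- `r := -∞` -/
  | realBot (r : Cell)
  /-- `r := s + t` -/
  | realAdd (r s t : Cell)
  /-- `r := -s` -/
  | realNeg (r s : Cell)
  | seq (c d : Program)
  | ite (b : Test) (c d : Program)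
  /-- repeat the body as long as the test holds -/
  | loop (b : Test) (c : Program)

/-- `Runs c σ T τ`: the program `c`, started in `σ`, halts after exactly `T` steps in `τ`. -/
inductive Runs : Program → Memory → ℕ → Memory → Prop
  | skip (σ) : Runs .skip σ 1 σ
  | intConst (σ x c) : Runs (.intConst x c) σ 1 (σ.setInt x c)
  | intAdd (σ x y z) : Runs (.intAdd x y z) σ 1 (σ.setInt x (σ.int y + σ.int z))
  | intSub (σ x y z) : Runs (.intSub x y z) σ 1 (σ.setInt x (σ.int y - σ.int z))
  | realZero (σ r) : Runs (.realZero r) σ 1 (σ.set r 0)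
  | realBot (σ r) : Runs (.realBot r) σ 1 (σ.set r ⊥)
  | realAdd (σ r s t) : Runs (.realAdd r s t) σ 1 (σ.set r (σ.get s + σ.get t))
  | realNeg (σ r s) : Runs (.realNeg r s) σ 1 (σ.set r (-σ.get s))
  | seq {c d σ τ υ S T} : Runs c σ S τ → Runs d τ T υ → Runs (.seq c d) σ (S + T) υ
  | iteTrue {b c d σ τ T} : b.Holds σ → Runs c σ T τ → Runs (.ite b c d) σ (T + 1) τ
  | iteFalse {b c d σ τ T} : ¬ b.Holds σ → Runs d σ T τ → Runs (.ite b c d) σ (T + 1) τ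
  | loopDone {b c σ} : ¬ b.Holds σ → Runs (.loop b c) σ 1 σ
  | loopStep {b c σ τ υ S T} : b.Holds σ → Runs c σ S τ → Runs (.loop b c) τ T υ →
      Runs (.loop b c) σ (S + T + 1) υ

/-- An `n × n` matrix as a two-dimensional array (indices from `0` to `n - 1`, zero elsewhere). -/
def matrixArray {n : ℕ} (A : Matrix (Fin n) (Fin n) EReal) : List ℤ → EReal
  | [i, j] =>
      if h : (0 ≤ i ∧ i < n) ∧ (0 ≤ j ∧ j < n) then
        A ⟨i.toNat, by omega⟩ ⟨j.toNat, by omega⟩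
      else 0
  | _ => 0

namespace PTEG

variable {Place : Type*} {n : ℕ}

/-- The input: register `0` holds `n`, the arrays `0, 1, 2, 3` hold `A^0, A^1, B^0, B^1`, and the
rest of the memory is zero. -/
def input (N : PTEG Place n) : Memory where
  int := fun x => if x = 0 then (n : ℤ) else 0
  real := fun a =>
    if a = 0 then matrixArray (N.matA 0)
    else if a = 1 then matrixArray (N.matA 1)
    else if a = 2 then matrixArray (N.matB 0)
    else if a = 3 then matrixArray (N.matB 1)
    else fun _ => 0

/-- Register `1` of the final memory is `1` if the P-TEG is weakly consistent and `0` if not. -/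
def AnswerCorrect (N : PTEG Place n) (τ : Memory) : Prop :=
  (N.WeaklyConsistent → τ.int 1 = 1) ∧ (¬ N.WeaklyConsistent → τ.int 1 = 0)

/-- Array `4` of the final memory holds the sets `S_i`: its entry `(i, t)`, for `|t| ≤ n`, is the `w`
with `(t, w) ∈ S_i`, and `-∞` if there is none.  Array `5` holds the matrix `R`. -/
def HoldsSR (N : PTEG Place n) (τ : Memory) : Prop :=
  (∀ (i : Fin n) (t : ℤ), -(n : ℤ) ≤ t → t ≤ n →
    (∀ w : ℝ, (t, w) ∈ N.setS i → τ.real 4 [(i.val : ℤ), t] = (w : EReal)) ∧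
    ((¬ ∃ w : ℝ, (t, w) ∈ N.setS i) → τ.real 4 [(i.val : ℤ), t] = ⊥)) ∧
  ∀ i j : Fin n, τ.real 5 [(i.val : ℤ), (j.val : ℤ)] = N.matR i j

/-- The array `a` of the final memory holds the Kleene star of `M_K`, provided that the precedence
graph of `M_K` has no positive circuit. -/
def HoldsStar (N : PTEG Place n) (K a : ℕ) (τ : Memory) : Prop :=
  NoPosCircuitMatrix (N.matM K) → ∀ (k l : Fin (K + 1)) (i j : Fin n),
    τ.real a [(k.val : ℤ), (i.val : ℤ), (l.val : ℤ), (j.val : ℤ)] =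
      kleeneStar (N.matM K) (k, i) (l, j)

end PTEG

end WeakConsistency

end

open WeakConsistency

universe u

namespace WeakConsistency

/-! ## Walks in the static graph -/

/-! The weight of an arc of the periodic graph depends only on the two rows and on the difference of
the columns. A path is therefore a starting column together with a static walk: a sequence of rows
with a total shift and a total weight (`SWalk`). Each of the conditions (a)-(d) is shown to be
equivalent to `NoPosWalk`: no closed static walk of shift zero has positive weight.

Weak consistency: a consistent trajectory of length K is a potential on the columns 0, ..., K.
Adding its inequalities along a closed walk, started far enough from the border, bounds the weight
by zero. Conversely, the row maxima of the Kleene star of M_K form a potential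
(`weaklyConsistent_iff`).

The algorithm: if two closed walks, at rows i and j, satisfy a solvable Diophantine system and i and
j lie on a common closed walk of shift zero, then many repetitions of the two outweigh the
connection (`NoPosWalk.not_diophantineSolvable`). For the converse, `WalkTest.noPosWalk`, fix a
strongly connected class of rows and let s be the supremum of the slopes weight/shift of its simple
cycles of positive shift. The test says that cycles of negative shift have slope at least s and that
cycles of shift zero have weight at most zero, so weight ≤ s * shift holds for every simple cycle.
The excess of weight over s * shift is additive, so by decomposition into simple cycles
(`exists_simple_cycle`) the inequality holds for every closed walk, in particular for those of shift
zero.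

The test only knows connections of length at most n², and `exists_zeroConn` shows that these
suffice. A detour from i to a simple cycle of length b and back, avoiding repetitions, has a length
L with L + (b + 1) ≤ 2n. Its shift is corrected to zero by turns of the cycle and forward loops of
total length at most L * b, and L * (b + 1) ≤ n².

Kleene stars: a walk that is short compared with the distance of its ends from the border stays
inside the columns 0, ..., K (`le_mpPow_matM`). Hence the two stars see every walk that the
algorithm needs. They may see longer ones too, but these are still static walks and do no harm.

Programs: the tables are filled with -∞ and then relaxed by nested loops around assignments `r :=
max r (s + t)`. The relaxed values do not depend on the cells being relaxed, so the order is
irrelevant and the result is a supremum (`RelaxRel`). Products with integers are replaced by a table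
of multiples: for shifts t and -k it suffices to try the multipliers k and t. The first program is a
dynamic program over the length of walks; the second is the Floyd–Warshall algorithm on matrices of
order O(n³). -/

/-- A walk of rows `a, p` ending in `b`, of total shift `t` and weight `w`; `W i j d` is the weight
of the arcs of shift `d` from row `j` to row `i`. -/
inductive SWalk {V : Type*} (W : V → V → ℤ → EReal) : V → List V → V → ℤ → ℝ → Prop
  | nil (a : V) : SWalk W a [] a 0 0
  | cons {a b c : V} {p : List V} {d t : ℤ} {g w : ℝ} :
      W b a d = (g : EReal) → SWalk W b p c t w → SWalk W a (b :: p) c (d + t) (g + w)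

/-- The properties of the arcs of the periodic graph of a P-TEG that the analysis uses. -/
structure RegularArcs {V : Type*} (W : V → V → ℤ → EReal) : Prop where
  ne_top : ∀ i j d, W i j d ≠ ⊤
  shift : ∀ i j d, W i j d ≠ ⊥ → -1 ≤ d ∧ d ≤ 1
  forward : ∀ i, W i i 1 ≠ ⊥
  opposite : ∀ i, W i i 1 + W i i (-1) ≤ 0

/-- No closed walk of shift zero has positive weight. -/
def NoPosWalk {V : Type*} (W : V → V → ℤ → EReal) : Prop :=
  ∀ a p w, SWalk W a p a 0 w → w ≤ 0

namespace SWalk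

variable {V : Type*} {W : V → V → ℤ → EReal} {a b c u : V} {p q : List V} {t t' : ℤ} {w w' : ℝ}

theorem cast (h : SWalk W a p b t w) (ht : t = t') (hw : w = w') : SWalk W a p b t' w' := by
  subst ht hw; exact h

theorem nil_inv (h : SWalk W a [] b t w) : b = a ∧ t = 0 ∧ w = 0 := by
  cases h; exact ⟨rfl, rfl, rfl⟩

theorem cons_inv (h : SWalk W a (u :: p) b t w) : ∃ d t' : _, ∃ g w' : ℝ,
    W u a d = (g : EReal) ∧ SWalk W u p b t' w' ∧ t = d + t' ∧ w = g + w' := by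
  cases h with
  | cons h1 h2 => exact ⟨_, _, _, _, h1, h2, rfl, rfl⟩

theorem single {d : ℤ} {g : ℝ} (h : W b a d = (g : EReal)) : SWalk W a [b] b d g :=
  ((SWalk.nil b).cons h).cast (add_zero _) (add_zero _)

theorem append (h : SWalk W a p b t w) (h' : SWalk W b q c t' w') :
    SWalk W a (p ++ q) c (t + t') (w + w') := by
  induction h with
  | nil a => simpa using h'
  | cons hg _ ih => exact ((ih h').cons hg).cast (by ring) (by ring)

theorem split (h : SWalk W a (p ++ q) c t w) : ∃ b t₁ w₁ t₂ w₂, SWalk W a p b t₁ w₁ ∧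
    SWalk W b q c t₂ w₂ ∧ t = t₁ + t₂ ∧ w = w₁ + w₂ := by
  induction p generalizing a t w with
  | nil => exact ⟨a, 0, 0, t, w, .nil a, h, by simp, by simp⟩
  | cons u p ih =>
    obtain ⟨d, t', g, w', hg, h', rfl, rfl⟩ := h.cons_inv
    obtain ⟨b, t₁, w₁, t₂, w₂, h₁, h₂, rfl, rfl⟩ := ih h'
    exact ⟨b, _, _, t₂, w₂, h₁.cons hg, h₂, by ring, by ring⟩

theorem end_eq (h : SWalk W a (p ++ [u]) b t w) : b = u := by
  obtain ⟨c, t₁, w₁, t₂, w₂, -, h₂, -, -⟩ := h.split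
  obtain ⟨d, t', g, w', -, h', -, -⟩ := h₂.cons_inv
  exact h'.nil_inv.1

theorem end_mem (h : SWalk W a p b t w) (hp : p ≠ []) : b ∈ p := by
  induction h with
  | nil => exact absurd rfl hp
  | @cons a b c p d t g w hg h ih =>
    by_cases hp' : p = []
    · subst hp'
      simp [h.nil_inv.1]
    · exact List.mem_cons_of_mem _ (ih hp')

theorem split_at {p₁ p₂ : List V} (h : SWalk W a (p₁ ++ u :: p₂) c t w) :
    ∃ t₁ w₁ t₂ w₂, SWalk W a (p₁ ++ [u]) u t₁ w₁ ∧ SWalk W u p₂ c t₂ w₂ ∧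
      t = t₁ + t₂ ∧ w = w₁ + w₂ := by
  rw [show p₁ ++ u :: p₂ = (p₁ ++ [u]) ++ p₂ by simp] at h
  obtain ⟨b, t₁, w₁, t₂, w₂, h₁, h₂, h3, h4⟩ := h.split
  obtain rfl := h₁.end_eq
  exact ⟨t₁, w₁, t₂, w₂, h₁, h₂, h3, h4⟩

theorem abs_shift_le (hW : RegularArcs W) (h : SWalk W a p b t w) :
    -(p.length : ℤ) ≤ t ∧ t ≤ p.length := by
  induction h with
  | nil => simp
  | @cons a b c p d t g w hg h ih =>
    have := hW.shift b a d (by simp [hg])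
    simp only [List.length_cons, Nat.cast_add, Nat.cast_one]
    omega

theorem weight_le {B : ℝ} (hB : ∀ i j d, W i j d ≤ (B : EReal)) (h : SWalk W a p b t w) :
    w ≤ p.length * B := by
  induction h with
  | nil => simp
  | @cons a b c p d t g w hg h ih =>
    have := hB b a d
    rw [hg, EReal.coe_le_coe_iff] at this
    simp only [List.length_cons, Nat.cast_add, Nat.cast_one]
    linarith

theorem iterate (h : SWalk W a p a t w) (m : ℕ) :
    ∃ q, q.length = m * p.length ∧ SWalk W a q a (m * t) (m * w) := by
  induction m with
  | zero => exact ⟨[], by simp, (SWalk.nil a).cast (by simp) (by simp)⟩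
  | succ m ih =>
    obtain ⟨q, hq, h'⟩ := ih
    refine ⟨p ++ q, by simp [hq]; ring, (h.append h').cast ?_ ?_⟩ <;> push_cast <;> ring

theorem forward_loop (hW : RegularArcs W) (a : V) : ∃ g : ℝ, SWalk W a [a] a 1 g := by
  have h := hW.forward a
  have h' := hW.ne_top a a 1
  exact ⟨(W a a 1).toReal, single (EReal.coe_toReal h' h).symm⟩

theorem rotate {p₁ p₂ : List V} (h : SWalk W a (p₁ ++ u :: p₂) a t w) :
    SWalk W u (p₂ ++ (p₁ ++ [u])) u t w := by
  obtain ⟨t₁, w₁, t₂, w₂, h₁, h₂, rfl, rfl⟩ := h.split_at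
  exact (h₂.append h₁).cast (by ring) (by ring)

/-- Loop erasure. -/
theorem exists_nodup (h : SWalk W a p b t w) :
    ∃ q t' w', SWalk W a q b t' w' ∧ (a :: q).Nodup := by
  induction h with
  | nil a => exact ⟨[], 0, 0, .nil a, by simp⟩
  | @cons a b c p d t g w hg h ih =>
    obtain ⟨q, t', w', h', hq⟩ := ih
    -- If the erased walk returns to `a`, only its part after `a` is kept.
    by_cases ha : a ∈ b :: q
    · obtain ⟨q₁, q₂, he⟩ := List.append_of_mem ha
      have h2 := h'.cons hg
      rw [he] at h2 hq
      obtain ⟨t₁, w₁, t₂, w₂, h₁, h₂, -, -⟩ := h2.split_at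
      exact ⟨q₂, _, _, h₂, hq.of_append_right⟩
    · exact ⟨b :: q, _, _, h'.cons hg, List.nodup_cons.2 ⟨ha, hq⟩⟩

/-- The part of a walk up to the first visit of a set. -/
theorem first_hit (S : List V) (h : SWalk W a p b t w) (hb : b ∈ S) (ha : a ∉ S) :
    ∃ q u t' w', SWalk W a (q ++ [u]) u t' w' ∧ u ∈ S ∧ (∀ x ∈ a :: q, x ∉ S) ∧
      (q ++ [u]).Sublist p := by
  induction h with
  | nil a => exact absurd hb ha
  | @cons a b c p d t g w hg h ih =>
    by_cases hbS : b ∈ S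
    · exact ⟨[], b, d, g, single hg, hbS, by simpa using ha, by simp⟩
    · obtain ⟨q, u, t', w', h', hu, hq, hs⟩ := ih hb hbS
      refine ⟨b :: q, u, _, _, h'.cons hg, hu, ?_, by simpa using hs⟩
      intro x hx
      rcases List.mem_cons.1 hx with rfl | hx
      · exact ha
      · exact hq x hx

/-- The part of a walk after the last visit of a set. -/
theorem last_exit (S : List V) (h : SWalk W a p b t w) (ha : a ∈ S) :
    ∃ q v t' w', SWalk W v q b t' w' ∧ v ∈ S ∧ (∀ x ∈ q, x ∉ S) ∧ q.Sublist p := by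
  induction hn : p.length using Nat.strong_induction_on generalizing a p t w with
  | _ n ih =>
    by_cases hS : ∃ x ∈ p, x ∈ S
    · obtain ⟨x, hx, hxS⟩ := hS
      obtain ⟨p₁, p₂, rfl⟩ := List.append_of_mem hx
      obtain ⟨t₁, w₁, t₂, w₂, h₁, h₂, -, -⟩ := h.split_at
      obtain ⟨q, v, t', w', h3, h4, h5, h6⟩ := ih p₂.length (by simp at hn; omega) h₂ hxS rfl
      exact ⟨q, v, t', w', h3, h4, h5,
        h6.trans ((List.sublist_cons_self x p₂).trans (List.sublist_append_right _ _))⟩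
    · push Not at hS
      exact ⟨p, a, _, _, h, ha, hS, List.Sublist.refl _⟩

/-- A closed walk whose weight exceeds `s` times its shift contains a simple one with this
property. -/
theorem exists_simple_cycle (s : ℝ) (h : SWalk W a p a t w) (hp : p ≠ []) (hs : s * t < w) :
    ∃ u q t' w', SWalk W u q u t' w' ∧ u ∈ p ∧ q ≠ [] ∧ q.Nodup ∧ s * t' < w' := by
  induction hn : p.length using Nat.strong_induction_on generalizing a p t w with
  | _ n ih =>
    by_cases hd : p.Nodup
    · exact ⟨a, p, t, w, h, h.end_mem hp, hp, hd, hs⟩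
    · rw [List.nodup_iff_forall_not_duplicate] at hd
      push Not at hd
      obtain ⟨x, hx⟩ := hd
      rw [List.duplicate_iff_sublist, List.cons_sublist_iff] at hx
      obtain ⟨r₁, r₂, rfl, h1, h2⟩ := hx
      obtain ⟨s₁, s₂, rfl⟩ := List.append_of_mem h1
      obtain ⟨s₃, s₄, rfl⟩ := List.append_of_mem (List.singleton_sublist.1 h2)
      rw [show s₁ ++ x :: s₂ ++ (s₃ ++ x :: s₄) = s₁ ++ x :: ((s₂ ++ s₃) ++ x :: s₄) by simp] at h
      obtain ⟨t₁, w₁, t₂, w₂, k₁, k₂, rfl, rfl⟩ := h.split_at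
      obtain ⟨t₃, w₃, t₄, w₄, k₃, k₄, rfl, rfl⟩ := k₂.split_at
      -- The excess of weight over `s` times shift is additive. If the inner closed walk at `x` has
      -- no positive excess, then the walk without it has one.
      by_cases hi : s * t₃ < w₃
      · obtain ⟨u, q, t', w', e1, e2, e3⟩ := ih _ (by simp at hn ⊢; omega) k₃ (by simp) hi rfl
        refine ⟨u, q, t', w', e1, ?_, e3⟩
        simp at e2 ⊢; tauto
      · have ho : s * ((t₁ + t₄ : ℤ) : ℝ) < w₁ + w₄ := by
          push_cast at hs ⊢; nlinarith
        obtain ⟨u, q, t', w', e1, e2, e3⟩ := ih _ (by simp at hn ⊢; omega)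
          (k₁.append k₄) (by simp) ho rfl
        refine ⟨u, q, t', w', e1, ?_, e3⟩
        simp at e2 ⊢; tauto

end SWalk

/-! ### Connections of shift zero and length at most n². -/

/-- Some closed walk of shift zero and length at most `N` starts in `i` and visits `j`. -/
def ZeroConn {V : Type*} (W : V → V → ℤ → EReal) (N : ℕ) (i j : V) : Prop :=
  ∃ p w, p.length ≤ N ∧ SWalk W i p i 0 w ∧ j ∈ p

/-- A detour of length `L` and shift `s` is corrected to shift zero by `k` turns of a cycle of
length at most `b` and shift `e < 0`, and by `m` forward loops of length and shift one. The point is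
the bound on the added length. -/
theorem exists_repetitions {L b : ℕ} {s e : ℤ} (hL : 2 ≤ L) (hs : s ≤ L) (hs' : -(L : ℤ) ≤ s)
    (he : e < 0) (he' : -(b : ℤ) ≤ e) :
    ∃ k m : ℕ, s + (k * e + m) = 0 ∧ k * b + m ≤ L * b := by
  have hb : 1 ≤ b := by omega
  rcases le_or_gt s 0 with h | h
  · refine ⟨0, (-s).toNat, by simp; omega, ?_⟩
    have : L * 1 ≤ L * b := Nat.mul_le_mul_left _ hb
    omega
  obtain ⟨c, rfl⟩ : ∃ c : ℕ, e = -(c : ℤ) := ⟨(-e).toNat, by omega⟩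
  obtain ⟨s, rfl⟩ : ∃ r : ℕ, s = r := ⟨s.toNat, by omega⟩
  have hc : c ≤ b := by omega
  have hs2 : s ≤ L := by omega
  rcases Nat.lt_or_ge c 2 with h2 | h2
  · obtain rfl : c = 1 := by omega
    exact ⟨s, 0, by simp, by simpa using Nat.mul_le_mul_right b hs2⟩
  -- `k` is `s / c` rounded up, so that fewer than `c ≤ b` forward loops remain and `k + 1 ≤ L` is
  -- enough.
  · set k := (s + c - 1) / c with hk
    have h3 : k * c ≤ s + c - 1 := Nat.div_mul_le_self _ _
    have h4 : s + c - 1 < (k + 1) * c := by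
      rw [add_mul, one_mul]
      exact Nat.lt_div_mul_add (by omega)
    have h5 : s ≤ k * c := by rw [add_mul] at h4; omega
    -- Otherwise `(L - 1) * 2 ≤ (L - 1) * c ≤ s - 1 ≤ L - 1`, against `2 ≤ L`.
    have h6 : k + 1 ≤ L := by
      by_contra h7
      have h8 : L * c ≤ k * c := Nat.mul_le_mul_right c (by omega)
      have h9 : L * 2 ≤ L * c := Nat.mul_le_mul_left L h2
      have : (L - 1) * c ≤ s - 1 := by rw [Nat.sub_mul]; omega
      have : (L - 1) * 2 ≤ (L - 1) * c := Nat.mul_le_mul_left _ h2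
      omega
    refine ⟨k, k * c - s, by push_cast [Nat.cast_sub h5]; ring, ?_⟩
    have : (k + 1) * b ≤ L * b := Nat.mul_le_mul_right b h6
    rw [add_mul] at this
    omega

theorem length_add_length_le_card {V : Type*} [Fintype V] {p q : List V} (hp : p.Nodup)
    (hq : q.Nodup) (h : ∀ x ∈ p, x ∉ q) : p.length + q.length ≤ Fintype.card V := by
  have : (p ++ q).Nodup := by
    rw [List.nodup_append]
    exact ⟨hp, hq, fun a ha b hb hab => h a ha (hab ▸ hb)⟩
  simpa using this.length_le_card

namespace SWalk

variable {V : Type*} {W : V → V → ℤ → EReal} {a b c u i v : V} {p q r : List V} {t t' : ℤ}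
  {w w' : ℝ}

/-- Two nodes of a simple closed walk are joined by a part of it. -/
theorem exists_arc (h : SWalk W a r a t w) (hr : r.Nodup) (hu : u ∈ r) (hv : v ∈ r) :
    ∃ q t' w', SWalk W u q v t' w' ∧ q.length + 1 ≤ r.length := by
  obtain ⟨r₁, r₂, rfl⟩ := List.append_of_mem hu
  by_cases huv : v = u
  · subst huv
    exact ⟨[], 0, 0, .nil v, by simp; omega⟩
  have hv' : v ∈ r₂ ++ r₁ := by simp at hv ⊢; tauto
  have h' := h.rotate
  obtain ⟨s₁, s₂, he⟩ := List.append_of_mem hv'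
  rw [← List.append_assoc, he, List.append_assoc, List.cons_append] at h'
  obtain ⟨t₁, w₁, t₂, w₂, h₁, -, -, -⟩ := h'.split_at
  refine ⟨_, _, _, h₁, ?_⟩
  have := congrArg List.length he
  simp at this ⊢
  omega

/-- A row from which a simple closed walk of negative shift can be reached, and back, lies with some
row of this walk on a closed walk of shift zero and length at most `n ^ 2`. -/
theorem exists_zeroConn [Fintype V] (hW : RegularArcs W) (hn : 2 ≤ Fintype.card V)
    (hr : SWalk W v r v t w) (hr0 : r ≠ []) (hrd : r.Nodup) (ht : t < 0)
    {p₁ p₂ : List V} {t₁ t₂ : ℤ} {w₁ w₂ : ℝ}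
    (h₁ : SWalk W i p₁ v t₁ w₁) (h₂ : SWalk W v p₂ i t₂ w₂) :
    ∃ j r', r'.length = r.length ∧ SWalk W j r' j t w ∧ ZeroConn W (Fintype.card V ^ 2) i j := by
  have hb := (hr.abs_shift_le hW).1
  have hbn : r.length ≤ Fintype.card V := hrd.length_le_card
  obtain ⟨g, hg⟩ := forward_loop hW i
  -- On the cycle itself no detour is needed: one turn and `-t` forward loops have length at most `2
  -- * n`, which is at most `n ^ 2` because `2 ≤ n`.
  by_cases hi : i ∈ r
  · obtain ⟨r₁, r₂, rfl⟩ := List.append_of_mem hi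
    have h' := hr.rotate
    refine ⟨i, _, by simp; omega, h', ?_⟩
    obtain ⟨q, hq, hq'⟩ := hg.iterate (-t).toNat
    refine ⟨_, _, ?_, (h'.append hq').cast (by simp; omega) rfl, by simp⟩
    have h2 : 2 * Fintype.card V ≤ Fintype.card V ^ 2 := by rw [sq]; exact Nat.mul_le_mul_right _ hn
    simp at hq hb hbn ⊢
    omega
  have hvr := hr.end_mem hr0
  -- The way to the cycle is cut at its first hit, the way back starts at the last exit, and an arc
  -- of the cycle joins them. Both outer parts are simple and disjoint from `r`, which bounds each
  -- by `n` minus the length of `r`.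
  obtain ⟨q, _, _, hq, hqd⟩ := h₁.exists_nodup
  obtain ⟨q₁, u, s₁, x₁, k₁, hu, hq₁, hs₁⟩ := hq.first_hit r hvr hi
  have hq₁d : (i :: q₁).Nodup :=
    hqd.sublist (((List.sublist_append_left q₁ [u]).trans hs₁).cons_cons i)
  have l₁ := length_add_length_le_card hq₁d hrd hq₁
  obtain ⟨q', _, _, hq', hqd'⟩ := h₂.exists_nodup
  obtain ⟨q₂, v₂, s₂, x₂, k₂, hv₂, hq₂, hs₂⟩ := hq'.last_exit r hvr
  have l₂ := length_add_length_le_card ((List.nodup_cons.1 hqd').2.sublist hs₂) hrd hq₂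
  -- The way back ends in `i`, outside of the cycle. With the step that enters the cycle this makes
  -- the detour at least two arcs long.
  have hq₂0 : q₂ ≠ [] := by
    rintro rfl
    obtain rfl := k₂.nil_inv.1
    exact hi hv₂
  have hq₂l := List.length_pos_iff.2 hq₂0
  obtain ⟨q₃, s₃, x₃, k₃, l₃⟩ := hr.exists_arc hrd hu hv₂
  have hc := (k₁.append k₃).append k₂
  obtain ⟨r₁, r₂, rfl⟩ := List.append_of_mem hu
  have h' := hr.rotate
  refine ⟨u, _, by simp; omega, h', ?_⟩
  have hsb := hc.abs_shift_le hW
  obtain ⟨k, m, hkm, hkm'⟩ := exists_repetitions (L := (q₁ ++ [u] ++ q₃ ++ q₂).length)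
    (by simp; omega) hsb.2 hsb.1 ht hb
  obtain ⟨c₁, hc₁, hc₁'⟩ := h'.iterate k
  obtain ⟨c₂, hc₂, hc₂'⟩ := hg.iterate m
  refine ⟨_, _, ?_, ((((k₁.append hc₁').append k₃).append k₂).append hc₂').cast ?_ rfl, ?_⟩
  · have e : r₂.length + (r₁.length + 1) = (r₁ ++ u :: r₂).length := by simp; omega
    generalize hbb : (r₁ ++ u :: r₂).length = b at *
    generalize hLL : (q₁ ++ [u] ++ q₃ ++ q₂).length = L at *
    generalize Fintype.card V = n at *
    have hc₁l : c₁.length = k * b := by rw [hc₁, ← e]; simp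
    have hc₂l : c₂.length = m := by simpa using hc₂
    have e2 : (q₁ ++ [u] ++ c₁ ++ q₃ ++ q₂ ++ c₂).length = L + k * b + m := by
      simp at hLL ⊢; omega
    rw [e2]
    simp at hLL l₁
    -- Together with the total length of at most `L * (b + 1)`, this is the inequality of arithmetic
    -- and geometric means.
    have hLb : L + (b + 1) ≤ 2 * n := by omega
    have h1 : (L + (b + 1)) * (L + (b + 1)) ≤ 2 * n * (2 * n) := Nat.mul_le_mul hLb hLb
    have h2 : L + k * b + m ≤ L * (b + 1) := by rw [mul_add]; omega
    zify at h1 h2 ⊢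
    nlinarith [sq_nonneg ((L : ℤ) - (b + 1))]
  · linarith
  · simp

end SWalk

/-! ### Slopes of cycles and the correctness of the test. -/

variable {V : Type*} {W : V → V → ℤ → EReal}

/-- There are finitely many pairs of rows and only three possible shifts. The bound makes the set of
slopes of simple cycles bounded above. -/
theorem RegularArcs.exists_bound [Finite V] (hW : RegularArcs W) :
    ∃ B : ℝ, 0 ≤ B ∧ ∀ i j d, W i j d ≤ (B : EReal) := by
  obtain ⟨B, hB⟩ := Set.Finite.bddAbove
    (Set.finite_range fun x : V × V × Set.Icc (-1 : ℤ) 1 => (W x.1 x.2.1 x.2.2).toReal)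
  refine ⟨max B 0, le_max_right _ _, fun i j d => ?_⟩
  by_cases h : W i j d = ⊥
  · simp [h]
  · refine (EReal.le_coe_toReal (hW.ne_top i j d)).trans (EReal.coe_le_coe_iff.2 ?_)
    exact (hB ⟨(i, j, ⟨d, hW.shift i j d h⟩), rfl⟩).trans (le_max_left _ _)

/-- The test of the algorithm in terms of static walks. -/
def WalkTest [Fintype V] (W : V → V → ℤ → EReal) : Prop :=
  ∀ i j, ZeroConn W (Fintype.card V ^ 2) i j →
    ∀ p t w, SWalk W i p i t w → p ≠ [] → p.length ≤ Fintype.card V →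
    ∀ p' t' w', SWalk W j p' j t' w' → p' ≠ [] → p'.length ≤ Fintype.card V →
      ¬ DiophantineSolvable (t, w) (t', w')

/-- Turn `m * y` times at `i`, go to `j`, turn `m * y'` times there, and return. The shift is zero,
and the gain `m * (y * w + y' * w')` exceeds the fixed cost of the connection for large `m`. -/
theorem NoPosWalk.not_diophantineSolvable (h : NoPosWalk W) {i j : V} {p p' q q' : List V}
    {s t t' : ℤ} {x x' w w' : ℝ} (hij : SWalk W i p j s x) (hji : SWalk W j p' i (-s) x')
    (hi : SWalk W i q i t w) (hj : SWalk W j q' j t' w') :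
    ¬ DiophantineSolvable (t, w) (t', w') := by
  rintro ⟨y, y', h0, hpos⟩
  simp only at h0 hpos
  obtain ⟨m, hm⟩ := exists_nat_gt (-(x + x') / (y * w + y' * w'))
  obtain ⟨c, -, hc⟩ := hi.iterate (m * y)
  obtain ⟨c', -, hc'⟩ := hj.iterate (m * y')
  have := h _ _ _ ((((hc.append hij).append hc').append hji).cast (t' := 0) (by
    push_cast
    linear_combination (m : ℤ) * h0) rfl)
  rw [div_lt_iff₀ hpos] at hm
  push_cast at this
  nlinarith

/-- With one row the bound `n ^ 2 = 1` leaves no room for a connecting walk of shift zero made of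
two opposite loops. Here `RegularArcs.opposite` takes the place of the test. -/
theorem SWalk.sum_le_of_two [Fintype V] (hW : RegularArcs W) (hV : Fintype.card V ≤ 1)
    {i j : V} {p q : List V} {w w' : ℝ}
    (h : SWalk W i p i 1 w) (h' : SWalk W j q j (-1) w')
    (hp : p.length ≤ 1) (hq : q.length ≤ 1) : w + w' ≤ 0 := by
  have hs : ∀ a b : V, a = b := fun a b => by
    have := Fintype.card_le_one_iff_subsingleton.1 hV
    exact Subsingleton.elim a b
  obtain rfl := hs i j
  match p, q, hp, hq with
  | [], _, _, _ => exact absurd h.nil_inv.2.1 (by norm_num)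
  | _ , [], _, _ => exact absurd h'.nil_inv.2.1 (by norm_num)
  | [a], [b], _, _ =>
    obtain ⟨d, s, g, x, hg, hx, hd, rfl⟩ := h.cons_inv
    obtain ⟨d', s', g', x', hg', hx', hd', rfl⟩ := h'.cons_inv
    obtain ⟨-, rfl, rfl⟩ := hx.nil_inv
    obtain ⟨-, rfl, rfl⟩ := hx'.nil_inv
    obtain rfl : d = 1 := by omega
    obtain rfl : d' = -1 := by omega
    obtain rfl := hs a i
    obtain rfl := hs b a
    have := hW.opposite b
    rw [hg, hg'] at this
    norm_cast at this
    linarith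

/-- If the test succeeds then no closed walk of shift zero has positive weight. -/
theorem WalkTest.noPosWalk [Fintype V] (hW : RegularArcs W) (hT : WalkTest W) : NoPosWalk W := by
  intro a p w₀ hp
  by_contra hw₀
  push Not at hw₀
  have hp0 : p ≠ [] := by
    rintro rfl
    exact hw₀.ne' hp.nil_inv.2.2
  obtain ⟨B, hB0, hB⟩ := hW.exists_bound
  -- `Cyc i t w`: a simple closed walk at a row that is strongly connected with `a`
  let Cyc : V → ℤ → ℝ → Prop := fun i t w => ∃ q, SWalk W i q i t w ∧ q ≠ [] ∧ q.Nodup ∧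
    (∃ p₁ t₁ w₁, SWalk W a p₁ i t₁ w₁) ∧ ∃ p₂ t₂ w₂, SWalk W i p₂ a t₂ w₂
  -- The slopes of the cycles of positive shift. Their supremum separates them from the slopes of
  -- the cycles of negative shift.
  let R : Set ℝ := {r | ∃ i t w, Cyc i t w ∧ 0 < t ∧ r = w / t}
  have hcard : ∀ q : List V, q.Nodup → q.length ≤ Fintype.card V := fun q hq => hq.length_le_card
  have hne : R.Nonempty := by
    obtain ⟨g, hg⟩ := SWalk.forward_loop hW a
    exact ⟨_, a, 1, g, ⟨[a], hg, by simp, by simp, ⟨_, _, _, .nil a⟩, ⟨_, _, _, .nil a⟩⟩,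
      by norm_num, rfl⟩
  have hbd : BddAbove R := by
    refine ⟨Fintype.card V * B, ?_⟩
    rintro r ⟨i, t, w, ⟨q, hq, -, hqd, -⟩, ht, rfl⟩
    have h1 := hq.weight_le hB
    have h2 : (q.length : ℝ) * B ≤ Fintype.card V * B :=
      mul_le_mul_of_nonneg_right (by exact_mod_cast hcard q hqd) hB0
    have ht1 : (1 : ℝ) ≤ t := by exact_mod_cast ht
    have h3 : (0 : ℝ) ≤ Fintype.card V * B := by positivity
    rw [div_le_iff₀ (by linarith)]
    nlinarith
  -- Every simple cycle of the class lies on or below the line of slope `sSup R`.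
  have hle : ∀ i t w, Cyc i t w → w ≤ sSup R * t := by
    rintro i t w ⟨q, hq, hq0, hqd, ⟨p₁, t₁, w₁, k₁⟩, ⟨p₂, t₂, w₂, k₂⟩⟩
    rcases lt_trichotomy t 0 with ht | rfl | ht
    · have htR : (t : ℝ) < 0 := by exact_mod_cast ht
      have hub : sSup R ≤ w / t := by
        refine csSup_le hne ?_
        rintro r ⟨i₀, t₀, w₀, ⟨q₀, hq₀, hq₀0, hq₀d, ⟨p₃, t₃, w₃, k₃⟩, ⟨p₄, t₄, w₄, k₄⟩⟩, ht₀, rfl⟩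
        have ht₀R : (0 : ℝ) < t₀ := by exact_mod_cast ht₀
        -- Since `t < 0 < t₀`, this says that the slope `w₀ / t₀` is at most `w / t`.
        have key : -t * w₀ + t₀ * w ≤ 0 := by
          rcases Nat.lt_or_ge (Fintype.card V) 2 with hV | hV
          · have l1 := hcard _ hqd
            have l2 := hcard _ hq₀d
            have b1 := (hq.abs_shift_le hW).1
            have b2 := (hq₀.abs_shift_le hW).2
            obtain rfl : t = -1 := by omega
            obtain rfl : t₀ = 1 := by omega
            have := SWalk.sum_le_of_two hW (by omega) hq₀ hq (by omega) (by omega)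
            push_cast
            linarith
          -- The two cycles are linked through the common row `a`. The negative cycle is replaced by
          -- a rotation of it at a row `j` that is close enough to `i₀` for the test.
          · obtain ⟨j, r', hr', hj, hz⟩ :=
              SWalk.exists_zeroConn hW hV hq hq0 hqd ht (k₄.append k₁) (k₂.append k₃)
            have := hT _ _ hz _ _ _ hq₀ hq₀0 (hcard _ hq₀d) _ _ _ hj
              (by rw [← List.length_pos_iff] at hq0 ⊢; omega) (by rw [hr']; exact hcard _ hqd)
            by_contra hcon
            push Not at hcon
            -- The multipliers `-t` and `t₀` cancel the shifts `t₀` and `t`.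
            refine this ⟨(-t).toNat, t₀.toNat, ?_, ?_⟩
            · simp only [Int.toNat_of_nonneg ht₀.le,
                Int.toNat_of_nonneg (show 0 ≤ -t by omega)]
              ring
            · have e1 : (((-t).toNat : ℤ) : ℝ) = -t := by
                rw [Int.toNat_of_nonneg (show 0 ≤ -t by omega)]; push_cast; ring
              have e2 : ((t₀.toNat : ℤ) : ℝ) = t₀ := by rw [Int.toNat_of_nonneg ht₀.le]
              rw [Int.cast_natCast] at e1 e2
              simp only [e1, e2]
              exact hcon
        rw [← neg_div_neg_eq w, div_le_div_iff₀ ht₀R (by linarith)]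
        linarith
      rwa [le_div_iff_of_neg htR] at hub
    -- A cycle of shift zero is tested against itself, with the multipliers one and zero.
    · have hz : ZeroConn W (Fintype.card V ^ 2) i i :=
        ⟨q, w, (hcard q hqd).trans (Nat.le_self_pow two_ne_zero _), hq, hq.end_mem hq0⟩
      have := hT _ _ hz _ _ _ hq hq0 (hcard _ hqd) _ _ _ hq hq0 (hcard _ hqd)
      by_contra hcon
      refine this ⟨1, 0, by simp, ?_⟩
      simpa using hcon
    · have htR : (0 : ℝ) < t := by exact_mod_cast ht
      have := le_csSup hbd ⟨i, t, w, ⟨q, hq, hq0, hqd, ⟨p₁, t₁, w₁, k₁⟩, ⟨p₂, t₂, w₂, k₂⟩⟩, ht, rfl⟩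
      rwa [div_le_iff₀ htR] at this
  -- A positive walk of shift zero lies above the line through the origin, hence so does a simple
  -- cycle through one of its rows, against `hle`.
  obtain ⟨u, q, t', w', hq, hu, hq0, hqd, hlt⟩ :=
    hp.exists_simple_cycle (sSup R) hp0 (by simpa using hw₀)
  obtain ⟨r₁, r₂, rfl⟩ := List.append_of_mem hu
  obtain ⟨t₁, w₁, t₂, w₂, h₁, h₂, -, -⟩ := hp.split_at
  exact absurd hlt (not_lt.2 (hle u t' w' ⟨q, hq, hq0, hqd, ⟨_, _, _, h₁⟩, ⟨_, _, _, h₂⟩⟩))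

/-! ## The arcs of the periodic graph -/

/-- The weight of the arcs of shift `d` from row `j` to row `i`. -/
noncomputable def arcWeight {n : ℕ} (P I C : Matrix (Fin n) (Fin n) EReal) (i j : Fin n) (d : ℤ) :
    EReal :=
  if d = -1 then P i j else if d = 1 then I i j else if d = 0 then C i j else ⊥

theorem periodicGraph_apply {n : ℕ} (P I C : Matrix (Fin n) (Fin n) EReal) (a b : Fin n × ℤ) :
    periodicGraph P I C a b = arcWeight P I C b.1 a.1 (b.2 - a.2) := by
  unfold periodicGraph arcWeight
  have e₁ : b.2 = a.2 - 1 ↔ b.2 - a.2 = -1 := by omega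
  have e₂ : b.2 = a.2 + 1 ↔ b.2 - a.2 = 1 := by omega
  have e₃ : b.2 = a.2 ↔ b.2 - a.2 = 0 := by omega
  simp only [e₁, e₂, e₃]

theorem blockMatrix_apply {n : ℕ} (P I C : Matrix (Fin n) (Fin n) EReal) (K : ℕ)
    (a b : Fin (K + 1) × Fin n) :
    blockMatrix P I C K a b = arcWeight P I C a.2 b.2 ((a.1.val : ℤ) - b.1.val) := by
  unfold blockMatrix arcWeight
  have e₁ : b.1.val = a.1.val + 1 ↔ (a.1.val : ℤ) - b.1.val = -1 := by omega
  have e₂ : a.1.val = b.1.val + 1 ↔ (a.1.val : ℤ) - b.1.val = 1 := by omega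
  have e₃ : a.1 = b.1 ↔ (a.1.val : ℤ) - b.1.val = 0 := by rw [Fin.ext_iff]; omega
  simp only [e₁, e₂, e₃]

namespace PTEG

variable {Place : Type*} {n : ℕ} (N : PTEG Place n)

/-- By `place_unique` the supremum and the infimum that define the two entries range over at most
one place, and it is the same place for both. -/
theorem matA_matB_cases (μ : ℕ) (i j : Fin n) :
    (∃ p, N.matA μ i j = (((N.lo p : ℝ≥0) : ℝ) : EReal) ∧
      N.matB μ i j = ((N.hi p : ℝ≥0∞) : EReal)) ∨ (N.matA μ i j = ⊥ ∧ N.matB μ i j = ⊤) := by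
  by_cases h : ∃ p, N.marking p = μ ∧ (j, p) ∈ N.post ∧ (p, i) ∈ N.pre
  · obtain ⟨p, h1, h2, h3⟩ := h
    have hu : ∀ q, N.marking q = μ ∧ (j, q) ∈ N.post ∧ (q, i) ∈ N.pre → q = p :=
      fun q hq => N.place_unique q p j i (hq.1.trans h1.symm) hq.2.1 hq.2.2 h2 h3
    refine .inl ⟨p, le_antisymm ?_ ?_, le_antisymm ?_ ?_⟩
    · exact iSup₂_le fun q hq => by rw [hu q hq]
    · exact le_iSup₂_of_le p ⟨h1, h2, h3⟩ le_rfl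
    · exact iInf₂_le_of_le p ⟨h1, h2, h3⟩ le_rfl
    · exact le_iInf₂ fun q hq => by rw [hu q hq]
  · push Not at h
    refine .inr ⟨?_, ?_⟩
    · unfold matA
      simp only [iSup_eq_bot]
      exact fun p hp => absurd hp.2.2 (h p hp.1 hp.2.1)
    · unfold matB
      simp only [iInf_eq_top]
      exact fun p hp => absurd hp.2.2 (h p hp.1 hp.2.1)

theorem matA_ne_top (μ : ℕ) (i j : Fin n) : N.matA μ i j ≠ ⊤ := by
  rcases N.matA_matB_cases μ i j with ⟨p, h, -⟩ | ⟨h, -⟩ <;> simp [h]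

theorem matB_nonneg (μ : ℕ) (i j : Fin n) : 0 ≤ N.matB μ i j := by
  rcases N.matA_matB_cases μ i j with ⟨p, -, h⟩ | ⟨-, h⟩ <;> simp [h, EReal.coe_ennreal_nonneg]

theorem matA_le_matB (μ : ℕ) (i j : Fin n) : N.matA μ i j ≤ N.matB μ i j := by
  rcases N.matA_matB_cases μ i j with ⟨p, h, h'⟩ | ⟨h, h'⟩
  · rw [h, h', ← EReal.coe_nnreal_eq_coe_real, EReal.coe_ennreal_le_coe_ennreal_iff]
    exact N.lo_le_hi p
  · simp [h]

theorem sharp_matB_ne_top (μ : ℕ) (i j : Fin n) : sharp (N.matB μ) i j ≠ ⊤ := by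
  have := N.matB_nonneg μ j i
  intro h
  rw [sharp, EReal.neg_eq_top_iff] at h
  simp [h] at this

/-- The weight of the arcs of shift `d` from row `j` to row `i` of the periodic graph. -/
noncomputable def wt (i j : Fin n) (d : ℤ) : EReal := arcWeight N.matP N.matI N.matC i j d

theorem graph_apply (a b : Fin n × ℤ) : N.graph a b = N.wt b.1 a.1 (b.2 - a.2) :=
  periodicGraph_apply ..

theorem matM_apply (K : ℕ) (a b : Fin (K + 1) × Fin n) :
    N.matM K a b = N.wt a.2 b.2 ((a.1.val : ℤ) - b.1.val) :=
  blockMatrix_apply ..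

theorem wt_neg_one (i j : Fin n) : N.wt i j (-1) = N.matP i j := by simp [wt, arcWeight]

theorem wt_one (i j : Fin n) : N.wt i j 1 = N.matI i j := by simp [wt, arcWeight]

theorem wt_zero (i j : Fin n) : N.wt i j 0 = N.matC i j := by simp [wt, arcWeight]

theorem wt_of_not (i j : Fin n) {d : ℤ} (hd : ¬ (-1 ≤ d ∧ d ≤ 1)) : N.wt i j d = ⊥ := by
  unfold wt arcWeight
  rw [if_neg (by omega), if_neg (by omega), if_neg (by omega)]

theorem matI_self (i : Fin n) : 0 ≤ N.matI i i := by
  simp [matI, mpOne]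

/-- The forward loops come from the identity matrix in `matI`. A forward and a backward loop in one
row weigh together `max (A¹ i i) 0 - B¹ i i`, which is at most zero because `A¹ ≤ B¹` and `0 ≤ B¹`.
-/
theorem regular_wt : RegularArcs N.wt where
  ne_top i j d := by
    have h1 := N.matA_ne_top 1 i j
    have h0 := N.matA_ne_top 0 i j
    have hP := N.sharp_matB_ne_top 1 i j
    have hC := N.sharp_matB_ne_top 0 i j
    have hE : mpOne (Fin n) i j ≠ ⊤ := by unfold mpOne; split_ifs <;> simp
    rw [← lt_top_iff_ne_top] at *
    unfold wt arcWeight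
    split_ifs
    · exact hP
    · exact max_lt h1 hE
    · exact max_lt h0 hC
    · simp
  shift i j d h := by
    by_contra hd
    exact h (N.wt_of_not i j hd)
  forward i := by
    rw [wt_one]
    intro h
    simpa [h] using N.matI_self i
  opposite i := by
    rw [wt_one, wt_neg_one, matI, matP, sharp, ← sub_eq_add_neg, EReal.sub_nonpos]
    refine max_le (N.matA_le_matB 1 i i) ?_
    simpa [mpOne] using N.matB_nonneg 1 i i

/-! ## Paths of the periodic graph and static walks -/

theorem sWalk_of_isChain (l : List (Fin n × ℤ)) (a b : Fin n × ℤ)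
    (h : (a :: l).IsChain (fun a b => N.graph a b ≠ ⊥)) (hb : (a :: l).getLast? = some b) :
    ∃ w : ℝ, pathWeight N.graph (a :: l) = w ∧
      SWalk N.wt a.1 (l.map Prod.fst) b.1 (b.2 - a.2) w := by
  induction l generalizing a with
  | nil =>
    simp at hb
    subst hb
    exact ⟨0, by simp [pathWeight], (SWalk.nil _).cast (by simp) rfl⟩
  | cons c l ih =>
    rw [List.isChain_cons_cons] at h
    rw [List.getLast?_cons_cons] at hb
    obtain ⟨w, hw, hs⟩ := ih c h.2 hb
    have hac := h.1
    rw [graph_apply] at hac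
    have e := EReal.coe_toReal (N.regular_wt.ne_top _ _ _) hac
    refine ⟨(N.wt c.1 a.1 (c.2 - a.2)).toReal + w, ?_, (hs.cons e.symm).cast (by ring) rfl⟩
    rw [pathWeight, hw, graph_apply, EReal.coe_add, e]

theorem _root_.WeakConsistency.SWalk.exists_isChain {N : PTEG Place n} {a b : Fin n}
    {p : List (Fin n)} {t : ℤ} {w : ℝ} (h : SWalk N.wt a p b t w) (z : ℤ) :
    ∃ l : List (Fin n × ℤ), l.map Prod.fst = p ∧
      ((a, z) :: l).IsChain (fun a b => N.graph a b ≠ ⊥) ∧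
      ((a, z) :: l).getLast? = some (b, z + t) ∧ pathWeight N.graph ((a, z) :: l) = w := by
  induction h generalizing z with
  | nil a => exact ⟨[], by simp, by simp, by simp, by simp [pathWeight]⟩
  | @cons a b c p d t g w hg h ih =>
    obtain ⟨l, h1, h2, h3, h4⟩ := ih (z + d)
    refine ⟨(b, z + d) :: l, by simp [h1], ?_, ?_, ?_⟩
    · rw [List.isChain_cons_cons]
      exact ⟨by simp [graph_apply, hg], h2⟩
    · rw [List.getLast?_cons_cons, h3, add_assoc]
    · rw [pathWeight, h4, graph_apply, EReal.coe_add]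
      simp [hg]

theorem image_pathsQ (i : Fin n) (t : ℤ) : pathWeight N.graph '' N.pathsQ i t =
    Real.toEReal '' {w | ∃ p, p ≠ [] ∧ p.length ≤ n ∧ SWalk N.wt i p i t w} := by
  ext x
  constructor
  · rintro ⟨ρ, ⟨⟨h2, hc⟩, hh, hl, hlen⟩, rfl⟩
    obtain ⟨a, l, rfl⟩ : ∃ a l, ρ = a :: l := by cases ρ with
      | nil => simp at h2
      | cons a l => exact ⟨a, l, rfl⟩
    simp at hh
    subst hh
    obtain ⟨w, hw, hs⟩ := N.sWalk_of_isChain l _ _ hc hl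
    refine ⟨w, ⟨_, ?_, ?_, hs.cast (by simp) rfl⟩, hw.symm⟩
    · rintro h
      simp at h
      simp [h] at h2
    · simpa [pathLength] using hlen
  · rintro ⟨w, ⟨p, hp, hpl, hs⟩, rfl⟩
    obtain ⟨l, h1, h2, h3, h4⟩ := hs.exists_isChain 0
    refine ⟨_, ⟨⟨?_, h2⟩, by simp, by simpa using h3, ?_⟩, h4⟩
    · rw [← h1, ← List.length_pos_iff, List.length_map] at hp
      simp; omega
    · rw [← h1] at hpl
      simpa [pathLength] using hpl

/-- A circuit through row `i` can be rotated to start there, and the columns are then forgotten. The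
list of rows of a static walk omits the start, but a circuit visits its start again at the end. -/
theorem image_circuitsR (i j : Fin n) : pathWeight N.graph '' N.circuitsR i j =
    Real.toEReal '' {w | ∃ p, p.length ≤ n ^ 2 ∧ SWalk N.wt i p i 0 w ∧ j ∈ p} := by
  ext x
  constructor
  · rintro ⟨ρ, ⟨⟨⟨h2, hc⟩, hcl⟩, ⟨u, hh⟩, hlen, ⟨z, hi⟩, ⟨z', hj⟩⟩, rfl⟩
    obtain ⟨a, l, rfl⟩ : ∃ a l, ρ = a :: l := by cases ρ with
      | nil => simp at h2
      | cons a l => exact ⟨a, l, rfl⟩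
    simp at hh
    subst hh
    rw [List.head?_cons] at hcl
    obtain ⟨w, hw, hs⟩ := N.sWalk_of_isChain l _ _ hc hcl.symm
    have hp0 : l.map Prod.fst ≠ [] := by
      rintro h
      simp at h
      simp [h] at h2
    have hmem : ∀ k z, (k, z) ∈ (u, (0 : ℤ)) :: l → k ∈ l.map Prod.fst := by
      intro k z hk
      rcases List.mem_cons.1 hk with hk | hk
      · obtain ⟨rfl, -⟩ := Prod.ext_iff.1 hk
        exact hs.end_mem hp0
      · exact List.mem_map.2 ⟨_, hk, rfl⟩
    have hi' := hmem i z hi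
    have hj' := hmem j z' hj
    have hlen' : (l.map Prod.fst).length ≤ n ^ 2 := by simpa [pathLength] using hlen
    generalize l.map Prod.fst = p at *
    obtain ⟨r₁, r₂, rfl⟩ := List.append_of_mem hi'
    refine ⟨w, ⟨_, ?_, hs.rotate.cast (by simp) rfl, ?_⟩, hw.symm⟩
    · simp at hlen' ⊢; omega
    · simp at hj' ⊢; tauto
  · rintro ⟨w, ⟨p, hpl, hs, hj⟩, rfl⟩
    obtain ⟨l, h1, h2, h3, h4⟩ := hs.exists_isChain 0
    refine ⟨_, ⟨⟨⟨?_, h2⟩, by simp [h3]⟩, ⟨i, by simp⟩, ?_, ⟨0, by simp⟩, ?_⟩, h4⟩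
    · have hp := List.length_pos_of_mem hj
      rw [← h1, List.length_map] at hp
      simp; omega
    · rw [← h1] at hpl
      simpa [pathLength] using hpl
    · rw [← h1, List.mem_map] at hj
      obtain ⟨⟨j', z⟩, hx, rfl⟩ := hj
      exact ⟨z, List.mem_cons_of_mem _ hx⟩

theorem matR_ne_bot_iff (i j : Fin n) : N.matR i j ≠ ⊥ ↔ ZeroConn N.wt (n ^ 2) i j := by
  unfold matR
  rw [image_circuitsR, ← bot_lt_iff_ne_bot, lt_sSup_iff]
  constructor
  · rintro ⟨-, ⟨w, ⟨p, h1, h2, h3⟩, rfl⟩, -⟩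
    exact ⟨p, w, h1, h2, h3⟩
  · rintro ⟨p, w, h1, h2, h3⟩
    exact ⟨_, ⟨w, ⟨p, h1, h2, h3⟩, rfl⟩, EReal.bot_lt_coe w⟩

theorem mem_setS_iff (i : Fin n) (t : ℤ) (w : ℝ) : (t, w) ∈ N.setS i ↔
    IsGreatest {w | ∃ p, p ≠ [] ∧ p.length ≤ n ∧ SWalk N.wt i p i t w} w := by
  unfold setS
  rw [Set.mem_ofPred_eq, image_pathsQ]
  simp only [IsGreatest, upperBounds, Set.mem_ofPred_eq, Set.mem_image, EReal.coe_eq_coe_iff,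
    exists_eq_right, forall_exists_index, and_imp]
  refine and_congr_right fun _ => ⟨fun h a p h1 h2 h3 => ?_, ?_⟩
  · exact EReal.coe_le_coe_iff.1 (h a p h1 h2 h3 rfl)
  · rintro h _ a p h1 h2 h3 rfl
    exact EReal.coe_le_coe_iff.2 (h p h1 h2 h3)

theorem hasPosCircuit_iff : N.HasPosCircuit ↔ ¬ NoPosWalk N.wt := by
  unfold NoPosWalk
  push Not
  constructor
  · rintro ⟨ρ, ⟨⟨h2, hc⟩, hcl⟩, hpos⟩
    obtain ⟨a, l, rfl⟩ : ∃ a l, ρ = a :: l := by cases ρ with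
      | nil => simp at h2
      | cons a l => exact ⟨a, l, rfl⟩
    rw [List.head?_cons] at hcl
    obtain ⟨w, hw, hs⟩ := N.sWalk_of_isChain l _ _ hc hcl.symm
    rw [hw] at hpos
    exact ⟨_, _, w, hs.cast (by simp) rfl, by exact_mod_cast hpos⟩
  · rintro ⟨a, p, w, hs, hw⟩
    obtain ⟨l, h1, h2, h3, h4⟩ := hs.exists_isChain 0
    refine ⟨_, ⟨⟨?_, h2⟩, by simp [h3]⟩, by rw [h4]; exact_mod_cast hw⟩
    rcases l with _ | ⟨b, l⟩
    · simp at h1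
      subst h1
      exact absurd hs.nil_inv.2.2 hw.ne'
    · simp

end PTEG

/-! ## Floyd–Warshall -/

variable {V : Type*}

/-- One step of the Floyd–Warshall algorithm, with the pivot `v`. -/
noncomputable def fwStep (D : Matrix V V EReal) (v : V) : Matrix V V EReal :=
  fun i j => max (D i j) (D i v + D v j)

/-- The invariant of the Floyd–Warshall algorithm for the matrix `M` after the pivots in `S`. -/
structure FWInv (M : Matrix V V EReal) (S : Set V) (D : Matrix V V EReal) : Prop where
  le : ∀ i j, M i j ≤ D i j
  sound : ∀ i j, ∃ r, 1 ≤ r ∧ D i j ≤ mpPow M r i j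
  ne_top : ∀ i j, D i j ≠ ⊤
  closed : (∀ i, D i i ≤ 0) → ∀ m ∈ S, ∀ i j, D i m + D m j ≤ D i j

theorem mpPow_one (M : Matrix V V EReal) (i j : V) : M i j ≤ mpPow M 1 i j := by
  simp only [mpPow, mpMul]
  refine le_trans ?_ (le_iSup _ i)
  simp [mpOne]

theorem add_mpPow_le (M : Matrix V V EReal) (r : ℕ) (i k j : V) :
    mpPow M r i k + M k j ≤ mpPow M (r + 1) i j :=
  le_iSup (fun k => mpPow M r i k + M k j) k

theorem iSup_add_le {ι : Sort*} {f : ι → EReal} {b c : EReal} (h : ∀ i, f i + b ≤ c) :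
    (⨆ i, f i) + b ≤ c := by
  by_cases hb : b = ⊥
  · simp [hb]
  refine EReal.add_le_of_forall_lt fun a ha b' hb' => ?_
  obtain ⟨i, hi⟩ := lt_iSup_iff.1 ha
  exact (add_le_add hi.le hb'.le).trans (h i)

theorem mpPow_add_le (M : Matrix V V EReal) (r s : ℕ) (i k j : V) :
    mpPow M r i k + mpPow M s k j ≤ mpPow M (r + s) i j := by
  induction s generalizing j with
  | zero =>
    by_cases h : k = j
    · subst h; simp [mpPow, mpOne]
    · simp [mpPow, mpOne, h]
  | succ s ih =>
    rw [add_comm]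
    refine iSup_add_le fun m => ?_
    rw [add_comm, ← add_assoc]
    exact (add_le_add_left (ih m) _).trans (add_mpPow_le M (r + s) i m j)

theorem FWInv.init {M : Matrix V V EReal} (hM : ∀ i j, M i j ≠ ⊤) : FWInv M ∅ M where
  le _ _ := le_rfl
  sound i j := ⟨1, le_rfl, mpPow_one M i j⟩
  ne_top := hM
  closed _ _ h := absurd h (Set.notMem_empty _)

/-- If the diagonal stays nonpositive, a pivot changes neither its own row nor its own column, so
closure under earlier pivots carries over. A positive diagonal entry would break this, which is why
`closed` is conditional. -/
theorem FWInv.step {M D : Matrix V V EReal} {S : Set V} (h : FWInv M S D) (v : V) :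
    FWInv M (insert v S) (fwStep D v) where
  le i j := (h.le i j).trans (le_max_left _ _)
  sound i j := by
    rcases max_choice (D i j) (D i v + D v j) with e | e
    · simp only [fwStep, e]
      exact h.sound i j
    · simp only [fwStep, e]
      obtain ⟨r, hr, h1⟩ := h.sound i v
      obtain ⟨s, hs, h2⟩ := h.sound v j
      exact ⟨r + s, by omega, (add_le_add h1 h2).trans (mpPow_add_le M r s i v j)⟩
  ne_top i j := (max_lt (h.ne_top i j).lt_top (EReal.add_lt_top (h.ne_top i v) (h.ne_top v j))).ne
  closed hd := by
    -- Entries never decrease, so a nonpositive diagonal after the step was nonpositive before it.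
    have hd' : ∀ i, D i i ≤ 0 := fun i => (le_max_left _ _).trans (hd i)
    have h1 : ∀ i, D i v + D v v ≤ D i v := fun i => add_le_of_nonpos_right (hd' v)
    have h2 : ∀ i, D v v + D v i ≤ D v i := fun i => add_le_of_nonpos_left (hd' v)
    have e1 : ∀ i, fwStep D v i v = D i v := fun i => max_eq_left (h1 i)
    have e2 : ∀ i, fwStep D v v i = D v i := fun i => max_eq_left (h2 i)
    intro m hm i j
    rcases Set.mem_insert_iff.1 hm with rfl | hm
    · rw [e1, e2]
      exact le_max_right _ _
    have hc := h.closed hd' m hm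
    have hmax : ∀ a b c d : EReal, max a b + max c d =
        max (max (a + c) (a + d)) (max (b + c) (b + d)) := by
      intro a b c d
      rcases le_total a b with h | h <;> rcases le_total c d with h' | h' <;>
      simp [h, h', add_le_add]
    unfold fwStep
    rw [hmax]
    refine max_le (max_le ?_ ?_) (max_le ?_ ?_)
    · exact (hc i j).trans (le_max_left _ _)
    · rw [← add_assoc]
      exact (add_le_add_left (hc i v) _).trans (le_max_right _ _)
    · rw [add_assoc]
      exact (add_le_add_right (hc v j) _).trans (le_max_right _ _)
    · rw [add_assoc, ← add_assoc (D v m)]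
      refine le_trans (add_le_add_right ?_ _) (le_max_right _ _)
      exact (add_le_add_left (hc v v) _).trans (h2 j)

theorem exists_fwInv [Finite V] {M : Matrix V V EReal} (hM : ∀ i j, M i j ≠ ⊤) :
    ∃ D, FWInv M Set.univ D := by
  refine Set.Finite.induction_on (motive := fun S _ => ∃ D, FWInv M S D) Set.univ Set.finite_univ
    ⟨M, .init hM⟩ ?_
  rintro v S - - ⟨D, h⟩
  exact ⟨_, h.step v⟩

/-- Once every node has been a pivot, `D` dominates `M` and is closed under composition, hence
dominates all positive powers. -/
theorem FWInv.mpPow_le {M D : Matrix V V EReal} (h : FWInv M Set.univ D)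
    (hd : ∀ i, D i i ≤ 0) (r : ℕ) (i j : V) : mpPow M (r + 1) i j ≤ D i j := by
  induction r generalizing j with
  | zero =>
    simp only [mpPow, mpMul]
    refine iSup_le fun k => ?_
    by_cases hk : i = k
    · subst hk; simpa [mpOne] using h.le i j
    · simp [mpOne, hk]
  | succ r ih =>
    refine iSup_le fun k => ?_
    exact (add_le_add (ih k) (h.le k j)).trans (h.closed hd k trivial i j)

theorem FWInv.noPosCircuit_iff {M D : Matrix V V EReal} (h : FWInv M Set.univ D)
    : NoPosCircuitMatrix M ↔ ∀ i, D i i ≤ 0 := by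
  constructor
  · intro hM i
    obtain ⟨r, hr, hi⟩ := h.sound i i
    exact hi.trans (hM r hr i)
  · intro hd r hr i
    obtain ⟨r, rfl⟩ := Nat.exists_eq_add_of_le' hr
    exact (h.mpPow_le hd r i i).trans (hd i)

theorem FWInv.kleeneStar_eq {M D : Matrix V V EReal} (h : FWInv M Set.univ D)
    (hM : NoPosCircuitMatrix M) (i j : V) :
    kleeneStar M i j = max (D i j) (mpOne V i j) := by
  have hd := h.noPosCircuit_iff.1 hM
  refine le_antisymm (iSup_le fun r => ?_) (max_le ?_ (le_iSup (fun r => mpPow M r i j) 0))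
  · cases r with
    | zero => exact le_max_right _ _
    | succ r => exact (h.mpPow_le hd r i j).trans (le_max_left _ _)
  · obtain ⟨r, -, hr⟩ := h.sound i j
    exact hr.trans (le_iSup (fun r => mpPow M r i j) r)

theorem FWInv.exists_mpPow_eq {M D : Matrix V V EReal} (h : FWInv M Set.univ D)
    (hM : NoPosCircuitMatrix M) (i j : V) :
    ∃ r, kleeneStar M i j = mpPow M r i j := by
  have e := h.kleeneStar_eq hM i j
  rcases max_choice (D i j) (mpOne V i j) with e' | e'
  · obtain ⟨r, -, hr⟩ := h.sound i j
    exact ⟨r, le_antisymm (by rwa [e, e']) (le_iSup (fun r => mpPow M r i j) r)⟩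
  · exact ⟨0, by rw [e, e']; rfl⟩

theorem FWInv.kleeneStar_ne_top {M D : Matrix V V EReal} (h : FWInv M Set.univ D)
    (hM : NoPosCircuitMatrix M) (i j : V) : kleeneStar M i j ≠ ⊤ := by
  rw [h.kleeneStar_eq hM]
  refine (max_lt (h.ne_top i j).lt_top ?_).ne
  unfold mpOne
  split_ifs <;> simp

theorem add_kleeneStar_le [Finite V] {M : Matrix V V EReal} (i k j : V) :
    M i k + kleeneStar M k j ≤ kleeneStar M i j := by
  rw [add_comm]
  refine iSup_add_le fun r => ?_
  rw [add_comm]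
  exact ((add_le_add_left (mpPow_one M i k) _).trans (mpPow_add_le M 1 r i k j)).trans
    (le_iSup (fun r => mpPow M r i j) (1 + r))

/-! ## Maximum weights of static walks -/

section bf

variable {V : Type*} {W : V → V → ℤ → EReal}

open Classical in
/-- The maximum weight of the static walks of length `l` from `i` to `m` of shift `z`. -/
noncomputable def walkMax (W : V → V → ℤ → EReal) (i : V) : ℕ → V → ℤ → EReal
  | 0 => fun m z => if m = i ∧ z = 0 then 0 else ⊥
  | l + 1 => fun m z =>
      ⨆ x : V × Set.Icc (-1 : ℤ) 1, walkMax W i l x.1 (z - x.2) + W m x.1 x.2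

theorem SWalk.le_walkMax (hW : RegularArcs W) {i m : V} {z : ℤ} {w : ℝ} (l : ℕ) {p : List V}
    (hp : p.length = l) (h : SWalk W i p m z w) : (w : EReal) ≤ walkMax W i l m z := by
  induction l generalizing p m z w with
  | zero =>
    obtain rfl := List.length_eq_zero_iff.1 hp
    obtain ⟨rfl, rfl, rfl⟩ := h.nil_inv
    simp [walkMax]
  | succ l ih =>
    obtain ⟨q, u, rfl⟩ := (List.eq_nil_or_concat' p).resolve_left (by rintro rfl; simp at hp)
    obtain ⟨b, t₁, w₁, t₂, w₂, h₁, h₂, rfl, rfl⟩ := h.split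
    obtain ⟨d, t', g, w', hg, h', rfl, rfl⟩ := h₂.cons_inv
    obtain ⟨rfl, rfl, rfl⟩ := h'.nil_inv
    have hd := hW.shift _ _ d (by rw [hg]; simp)
    have := ih (by simpa using hp) h₁
    refine le_trans ?_ (le_iSup (fun x : V × Set.Icc (-1 : ℤ) 1 =>
      walkMax W i l x.1 (t₁ + (d + 0) - x.2) + W m x.1 x.2) (b, ⟨d, hd⟩))
    simp only [add_zero, add_sub_cancel_right, hg, EReal.coe_add]
    exact add_le_add_left this _

/-- Each supremum ranges over a finite nonempty set and is attained, so that a maximal walk can be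
traced back arc by arc. -/
theorem exists_walk_of_walkMax [Finite V] (hW : RegularArcs W) {i m : V} {z : ℤ} (l : ℕ)
    (h : walkMax W i l m z ≠ ⊥) :
    ∃ p w, p.length = l ∧ SWalk W i p m z w ∧ walkMax W i l m z = ((w : ℝ) : EReal) := by
  induction l generalizing m z with
  | zero =>
    by_cases h0 : m = i ∧ z = 0
    · obtain ⟨rfl, rfl⟩ := h0
      exact ⟨[], 0, rfl, .nil _, by simp [walkMax]⟩
    · exact absurd (by simp [walkMax, h0]) h
  | succ l ih =>
    have : Nonempty (V × Set.Icc (-1 : ℤ) 1) := ⟨(i, ⟨0, by simp⟩)⟩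
    obtain ⟨⟨b, d⟩, hx⟩ := exists_eq_ciSup_of_finite
      (f := fun x : V × Set.Icc (-1 : ℤ) 1 => walkMax W i l x.1 (z - x.2) + W m x.1 x.2)
    simp only [walkMax] at h ⊢
    rw [← hx] at h ⊢
    simp only [ne_eq, EReal.add_eq_bot_iff, not_or] at h
    obtain ⟨p, w, hp, hs, hw⟩ := ih h.1
    have e := EReal.coe_toReal (hW.ne_top _ _ _) h.2
    refine ⟨p ++ [m], w + (W m b d).toReal, by simp [hp],
      (hs.append (SWalk.single e.symm)).cast (by ring) rfl, ?_⟩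
    rw [EReal.coe_add, e, hw]

theorem walkMax_eq_bot [Finite V] (hW : RegularArcs W) {i m : V} {z : ℤ} {l : ℕ}
    (h : z < -(l : ℤ) ∨ (l : ℤ) < z) : walkMax W i l m z = ⊥ := by
  by_contra hne
  obtain ⟨p, w, hp, hs, -⟩ := exists_walk_of_walkMax hW l hne
  have := hs.abs_shift_le hW
  omega

end bf

/-! ### The data of the algorithm as maxima over walks. -/

theorem DiophantineSolvable.mono {t t' : ℤ} {w w' v v' : ℝ}
    (h : DiophantineSolvable (t, w) (t', w')) (h1 : w ≤ v) (h2 : w' ≤ v') :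
    DiophantineSolvable (t, v) (t', v') := by
  obtain ⟨y, y', h0, hp⟩ := h
  refine ⟨y, y', h0, hp.trans_le ?_⟩
  simp only
  gcongr

namespace PTEG

variable {Place : Type*} {n : ℕ} (N : PTEG Place n)

/-- The maximum weight of the closed walks of shift `t` and length from `1` to `n` in row `i`. -/
noncomputable def loopMax (i : Fin n) (t : ℤ) : EReal :=
  ⨆ l : Fin n, walkMax N.wt i (l + 1) i t

theorem loopMax_isGreatest {i : Fin n} {t : ℤ} (h : N.loopMax i t ≠ ⊥) :
    ∃ w : ℝ, N.loopMax i t = w ∧ (t, w) ∈ N.setS i := by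
  have : Nonempty (Fin n) := ⟨i⟩
  obtain ⟨l, hl⟩ := exists_eq_ciSup_of_finite (f := fun l : Fin n => walkMax N.wt i (l + 1) i t)
  have hl' : walkMax N.wt i (l + 1) i t = N.loopMax i t := hl
  obtain ⟨p, w, hp, hs, hw⟩ := exists_walk_of_walkMax N.regular_wt _ (hl'.trans_ne h)
  refine ⟨w, hl'.symm.trans hw, (N.mem_setS_iff i t w).2 ⟨⟨p, ?_, by omega, hs⟩, ?_⟩⟩
  · rw [← List.length_pos_iff]; omega
  · rintro x ⟨q, hq, hqn, hx⟩
    rw [← List.length_pos_iff] at hq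
    have h1 := hx.le_walkMax N.regular_wt q.length rfl
    have h2 := le_iSup (fun l : Fin n => walkMax N.wt i (l + 1) i t) ⟨q.length - 1, by omega⟩
    simp only [Nat.sub_add_cancel hq] at h2
    have h3 := h1.trans h2
    rw [← hl, hw] at h3
    exact EReal.coe_le_coe_iff.1 h3

theorem le_loopMax {i : Fin n} {t : ℤ} {p : List (Fin n)} {w : ℝ} (h : SWalk N.wt i p i t w)
    (hp : p ≠ []) (hpn : p.length ≤ n) : (w : EReal) ≤ N.loopMax i t := by
  rw [← List.length_pos_iff] at hp
  have h1 := h.le_walkMax N.regular_wt p.length rfl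
  have h2 := le_iSup (fun l : Fin n => walkMax N.wt i (l + 1) i t) ⟨p.length - 1, by omega⟩
  simp only [Nat.sub_add_cancel hp] at h2
  exact h1.trans h2

theorem loopMax_eq_of_mem {i : Fin n} {t : ℤ} {w : ℝ} (h : (t, w) ∈ N.setS i) :
    N.loopMax i t = w := by
  have h' := (N.mem_setS_iff i t w).1 h
  obtain ⟨p, hp, hpn, hs⟩ := h'.1
  have hle := N.le_loopMax hs hp hpn
  obtain ⟨v, hv, hv'⟩ := N.loopMax_isGreatest (ne_bot_of_le_ne_bot (EReal.coe_ne_bot w) hle)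
  rw [hv, h'.unique ((N.mem_setS_iff i t v).1 hv')]

/-- A circuit is cut at a visit of row `j` into a walk of length `l` and one of length `l'` with
opposite shifts. The first part is nonempty since `j` is found among the rows after the start; the
second may be empty. -/
theorem matR_le_iff (i j : Fin n) (x : EReal) : N.matR i j ≤ x ↔
    ∀ l l' : ℕ, 1 ≤ l → l + l' ≤ n ^ 2 → ∀ z : ℤ,
      walkMax N.wt i l j z + walkMax N.wt j l' i (-z) ≤ x := by
  unfold matR
  rw [image_circuitsR, sSup_le_iff]
  constructor
  · intro h l l' hl hll z
    by_cases h1 : walkMax N.wt i l j z = ⊥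
    · simp [h1]
    by_cases h2 : walkMax N.wt j l' i (-z) = ⊥
    · simp [h2]
    obtain ⟨p, w, hp, hs, hw⟩ := exists_walk_of_walkMax N.regular_wt _ h1
    obtain ⟨p', w', hp', hs', hw'⟩ := exists_walk_of_walkMax N.regular_wt _ h2
    rw [hw, hw', ← EReal.coe_add]
    have hp0 : p ≠ [] := by rw [← List.length_pos_iff]; omega
    refine h _ ⟨_, ⟨p ++ p', by simp; omega, (hs.append hs').cast (by simp) rfl, ?_⟩, rfl⟩
    exact List.mem_append_left _ (hs.end_mem hp0)
  · rintro h _ ⟨w, ⟨p, hpl, hs, hj⟩, rfl⟩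
    obtain ⟨p₁, p₂, rfl⟩ := List.append_of_mem hj
    obtain ⟨t₁, w₁, t₂, w₂, h₁, h₂, h0, rfl⟩ := hs.split_at
    obtain rfl : t₂ = -t₁ := by omega
    rw [EReal.coe_add]
    refine (add_le_add (h₁.le_walkMax N.regular_wt _ rfl) (h₂.le_walkMax N.regular_wt _ rfl)).trans
      (h _ _ (by simp) ?_ t₁)
    simp at hpl ⊢; omega

/-- The test with the maximal weights is the test with all walks of length at most `n`, because
solvability is monotone in the weights. The other direction concatenates the two loops with a
circuit counted by `R`. -/
theorem algorithmAccepts_iff : N.AlgorithmAccepts ↔ NoPosWalk N.wt := by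
  constructor
  · intro h
    refine WalkTest.noPosWalk N.regular_wt ?_
    intro i j hij p t w hp hp0 hpn p' t' w' hp' hp'0 hp'n hD
    rw [Fintype.card_fin] at hij hpn hp'n
    have l1 := N.le_loopMax hp hp0 hpn
    have l2 := N.le_loopMax hp' hp'0 hp'n
    obtain ⟨v, hv, hvS⟩ := N.loopMax_isGreatest (ne_bot_of_le_ne_bot (EReal.coe_ne_bot w) l1)
    obtain ⟨v', hv', hvS'⟩ := N.loopMax_isGreatest (ne_bot_of_le_ne_bot (EReal.coe_ne_bot w') l2)
    rw [hv, EReal.coe_le_coe_iff] at l1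
    rw [hv', EReal.coe_le_coe_iff] at l2
    exact h i j ((N.matR_ne_bot_iff i j).2 hij) _ hvS _ hvS' (hD.mono l1 l2)
  · rintro h i j hij ⟨t, w⟩ hq ⟨t', w'⟩ hq'
    obtain ⟨p, x, -, hs, hj⟩ := (N.matR_ne_bot_iff i j).1 hij
    obtain ⟨q, -, -, hq⟩ := ((N.mem_setS_iff i t w).1 hq).1
    obtain ⟨q', -, -, hq'⟩ := ((N.mem_setS_iff j t' w').1 hq').1
    obtain ⟨p₁, p₂, rfl⟩ := List.append_of_mem hj
    obtain ⟨t₁, w₁, t₂, w₂, h₁, h₂, h0, -⟩ := hs.split_at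
    exact h.not_diophantineSolvable h₁ (h₂.cast (t' := -t₁) (by omega) rfl) hq hq'

/-! ## Static walks and the matrices `M_K` -/

/-- Rows of `M_K` are targets and columns are sources, so the entry `(a, b)` belongs to walks from
`b` to `a`. -/
theorem mpPow_matM_cases (K r : ℕ) (a b : Fin (K + 1) × Fin n) :
    mpPow (N.matM K) r a b = ⊥ ∨ ∃ p w, p.length = r ∧
      SWalk N.wt b.2 p a.2 ((a.1.val : ℤ) - b.1.val) w ∧
      mpPow (N.matM K) r a b = ((w : ℝ) : EReal) := by
  induction r generalizing b with
  | zero =>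
    by_cases h : a = b
    · subst h
      exact .inr ⟨[], 0, rfl, (SWalk.nil _).cast (by simp) rfl, by simp [mpPow, mpOne]⟩
    · exact .inl (by simp [mpPow, mpOne, h])
  | succ r ih =>
    by_cases hb : mpPow (N.matM K) (r + 1) a b = ⊥
    · exact .inl hb
    have : Nonempty (Fin (K + 1) × Fin n) := ⟨a⟩
    obtain ⟨k, hk⟩ := exists_eq_ciSup_of_finite
      (f := fun k => mpPow (N.matM K) r a k + N.matM K k b)
    simp only [mpPow, mpMul] at hb ⊢
    rw [← hk] at hb ⊢
    simp only [EReal.add_eq_bot_iff, not_or] at hb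
    obtain ⟨p, w, hp, hs, hw⟩ := (ih k).resolve_left hb.1
    have hb2 := hb.2
    rw [matM_apply] at hb2
    have e := EReal.coe_toReal (N.regular_wt.ne_top _ _ _) hb2
    refine .inr ⟨k.2 :: p, _, by simp [hp], (hs.cons e.symm).cast (by ring) rfl, ?_⟩
    rw [hw, EReal.coe_add, e, matM_apply, add_comm]

theorem matM_ne_top (K : ℕ) (a b : Fin (K + 1) × Fin n) : N.matM K a b ≠ ⊤ := by
  rw [matM_apply]
  exact N.regular_wt.ne_top _ _ _

/-- A walk from column `l` to column `k` through column `-1` has at least `l + k + 2` arcs, and one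
through column `K + 1` at least `2 * K + 2 - l - k`. The two length hypotheses exclude both, so the
walk lives in the columns of `M_K`. -/
theorem le_mpPow_matM (K : ℕ) {i j : Fin n} {p : List (Fin n)} {t : ℤ} {w : ℝ}
    (h : SWalk N.wt j p i t w) (l k : Fin (K + 1)) (hkl : (k.val : ℤ) = l.val + t)
    (h1 : p.length ≤ l.val + k.val + 1) (h2 : l.val + k.val + p.length ≤ 2 * K + 1) :
    (w : EReal) ≤ mpPow (N.matM K) p.length (k, i) (l, j) := by
  induction h generalizing l with
  | nil a =>
    obtain rfl : k = l := by ext; omega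
    simp [mpPow, mpOne]
  | @cons a b c p d t g w hg h ih =>
    have hs := h.abs_shift_le N.regular_wt
    have hd := N.regular_wt.shift _ _ d (by rw [hg]; simp)
    simp only [List.length_cons] at h1 h2 ⊢
    have hl := l.isLt
    have hk := k.isLt
    have hl' : 0 ≤ (l.val : ℤ) + d ∧ (l.val : ℤ) + d < K + 1 := by omega
    let l' : Fin (K + 1) := ⟨((l.val : ℤ) + d).toNat, by omega⟩
    have e : (l'.val : ℤ) = l.val + d := Int.toNat_of_nonneg hl'.1
    have := ih l' (by omega) (by omega) (by omega)
    refine le_trans ?_ (add_mpPow_le (N.matM K) p.length (k, c) (l', b) (l, a))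
    rw [matM_apply, EReal.coe_add, add_comm]
    simp only [e, add_sub_cancel_left, hg]
    exact add_le_add_left this _

theorem noPosCircuitMatrix_matM (h : NoPosWalk N.wt) (K : ℕ) : NoPosCircuitMatrix (N.matM K) := by
  intro r _ a
  rcases N.mpPow_matM_cases K r a a with h' | ⟨p, w, -, hs, hw⟩
  · simp [h']
  · rw [hw]
    exact_mod_cast h _ _ _ (hs.cast (by simp) rfl)

/-- Without positive circuits the star entry is an entry of some power, not merely a supremum, and
hence the weight of a walk. -/
theorem exists_walk_of_kleeneStar (K : ℕ) (h : NoPosCircuitMatrix (N.matM K))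
    {a b : Fin (K + 1) × Fin n} (hb : kleeneStar (N.matM K) a b ≠ ⊥) :
    ∃ p w, SWalk N.wt b.2 p a.2 ((a.1.val : ℤ) - b.1.val) w ∧
      kleeneStar (N.matM K) a b = ((w : ℝ) : EReal) := by
  obtain ⟨D, hD⟩ := exists_fwInv (N.matM_ne_top K)
  obtain ⟨r, hr⟩ := hD.exists_mpPow_eq h a b
  rw [hr] at hb ⊢
  obtain ⟨p, w, -, hs, hw⟩ := (N.mpPow_matM_cases K r a b).resolve_left hb
  exact ⟨p, w, hs, hw⟩

theorem le_kleeneStar_matM (K : ℕ) {i j : Fin n} {p : List (Fin n)} {t : ℤ} {w : ℝ}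
    (h : SWalk N.wt j p i t w) (l k : Fin (K + 1)) (hkl : (k.val : ℤ) = l.val + t)
    (h1 : p.length ≤ l.val + k.val + 1) (h2 : l.val + k.val + p.length ≤ 2 * K + 1) :
    (w : EReal) ≤ kleeneStar (N.matM K) (k, i) (l, j) :=
  (N.le_mpPow_matM K h l k hkl h1 h2).trans
    (le_iSup (fun r => mpPow (N.matM K) r (k, i) (l, j)) p.length)

/-- Walks of length at most `n` from the middle column `n` stay within the `2 * n + 1` columns. The
star may contain heavier, longer walks, hence only an inequality. -/
theorem exists_mem_starS (h : NoPosCircuitMatrix (N.matM (2 * n))) {i : Fin n} {p : List (Fin n)}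
    {t : ℤ} {w : ℝ} (hp : SWalk N.wt i p i t w) (hpn : p.length ≤ n) :
    ∃ v, w ≤ v ∧ (t, v) ∈ N.starS i := by
  have hs := hp.abs_shift_le N.regular_wt
  let a : Fin (2 * n + 1) := ⟨((n : ℤ) + t).toNat, by omega⟩
  have e : (a.val : ℤ) = n + t := Int.toNat_of_nonneg (by omega)
  have hle := N.le_kleeneStar_matM (2 * n) hp ⟨n, by omega⟩ a e
    (by simp only; omega) (by simp only; omega)
  obtain ⟨q, v, -, hv⟩ := N.exists_walk_of_kleeneStar (2 * n) h
    (ne_bot_of_le_ne_bot (EReal.coe_ne_bot w) hle)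
  rw [hv, EReal.coe_le_coe_iff] at hle
  exact ⟨v, hle, a, e, hv⟩

/-- A closed walk of length at most `n ^ 2` that starts in column `h` strays at most `h = n ^ 2 / 2`
columns from it, because it has to come back. Odd `n ^ 2` is covered since `n ^ 2 ≤ 2 * h + 1`. -/
theorem starR_ne_bot {i j : Fin n} (h : ZeroConn N.wt (n ^ 2) i j) : N.starR i j ≠ ⊥ := by
  obtain ⟨p, w, hpl, hs, hj⟩ := h
  obtain ⟨p₁, p₂, rfl⟩ := List.append_of_mem hj
  obtain ⟨t₁, w₁, t₂, w₂, h₁, h₂, h0, -⟩ := hs.split_at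
  have b1 := h₁.abs_shift_le N.regular_wt
  have b2 := h₂.abs_shift_le N.regular_wt
  have hlen : (p₁ ++ [j]).length + p₂.length ≤ n ^ 2 := by simp at hpl ⊢; omega
  let l : Fin (2 * (n ^ 2 / 2) + 1) := ⟨(((n ^ 2 / 2 : ℕ) : ℤ) + t₁).toNat, by omega⟩
  have e : (l.val : ℤ) = ((n ^ 2 / 2 : ℕ) : ℤ) + t₁ := Int.toNat_of_nonneg (by omega)
  have k₁ := N.le_kleeneStar_matM _ h₁ ⟨n ^ 2 / 2, by omega⟩ l e
    (by simp only; omega) (by simp only; omega)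
  have k₂ := N.le_kleeneStar_matM _ h₂ l ⟨n ^ 2 / 2, by omega⟩ (by simp only; omega)
    (by simp only; omega) (by simp only; omega)
  have := (add_le_add k₁ k₂).trans (le_iSup (fun l : Fin (2 * (n ^ 2 / 2) + 1) =>
    kleeneStar (N.matM (2 * (n ^ 2 / 2))) (l, j) (⟨n ^ 2 / 2, by omega⟩, i) +
    kleeneStar (N.matM (2 * (n ^ 2 / 2))) (⟨n ^ 2 / 2, by omega⟩, i) (l, j)) l)
  rw [← EReal.coe_add] at this
  exact ne_bot_of_le_ne_bot (EReal.coe_ne_bot _) this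

/-- The stars contain at least the walks that `WalkTest` needs, and nothing but static walks. The
length of the latter does not matter in `NoPosWalk.not_diophantineSolvable`. -/
theorem starTestAccepts_iff : N.StarTestAccepts ↔ NoPosWalk N.wt := by
  constructor
  · rintro ⟨h1, -, h⟩
    refine WalkTest.noPosWalk N.regular_wt ?_
    intro i j hij p t w hp hp0 hpn p' t' w' hp' hp'0 hp'n hD
    rw [Fintype.card_fin] at hij hpn hp'n
    obtain ⟨v, hv, hS⟩ := N.exists_mem_starS h1 hp hpn
    obtain ⟨v', hv', hS'⟩ := N.exists_mem_starS h1 hp' hp'n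
    exact h i j (N.starR_ne_bot hij) _ hS _ hS' (hD.mono hv hv')
  · intro h
    have h1 := N.noPosCircuitMatrix_matM h
    refine ⟨h1 _, h1 _, ?_⟩
    rintro i j hij ⟨t, w⟩ ⟨a, ha, hw⟩ ⟨t', w'⟩ ⟨a', ha', hw'⟩
    simp only at ha ha' hw hw'
    obtain ⟨l, hl⟩ : ∃ l, kleeneStar (N.matM (2 * (n ^ 2 / 2))) (l, j) (⟨n ^ 2 / 2, by omega⟩, i) +
        kleeneStar (N.matM (2 * (n ^ 2 / 2))) (⟨n ^ 2 / 2, by omega⟩, i) (l, j) ≠ ⊥ := by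
      by_contra hcon
      push Not at hcon
      exact hij (iSup_eq_bot.2 hcon)
    simp only [ne_eq, EReal.add_eq_bot_iff, not_or] at hl
    obtain ⟨p, x, hp, -⟩ := N.exists_walk_of_kleeneStar _ (h1 _) hl.1
    obtain ⟨p', x', hp', -⟩ := N.exists_walk_of_kleeneStar _ (h1 _) hl.2
    obtain ⟨q, v, hq, hv⟩ := N.exists_walk_of_kleeneStar _ (h1 _) (hw.trans_ne (EReal.coe_ne_bot w))
    obtain ⟨q', v', hq', hv'⟩ :=
      N.exists_walk_of_kleeneStar _ (h1 _) (hw'.trans_ne (EReal.coe_ne_bot w'))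
    rw [hw, EReal.coe_eq_coe_iff] at hv
    rw [hw', EReal.coe_eq_coe_iff] at hv'
    exact h.not_diophantineSolvable hp (hp'.cast (by simp) rfl)
      (hq.cast (by simp; omega) hv.symm) (hq'.cast (by simp; omega) hv'.symm)

end PTEG

/-! ## Consistent trajectories as potentials -/

theorem neg_add_coe_le_iff {B : EReal} (hB : 0 ≤ B) (x y : ℝ) :
    -B + (x : EReal) ≤ y ↔ (x : EReal) ≤ B + y := by
  induction B using EReal.rec with
  | bot => simp at hB
  | top => simp
  | coe b =>
    norm_cast
    constructor <;> intro h <;> linarith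

theorem max_add_coe_le_iff (a b c : EReal) (x : ℝ) :
    max a b + (x : EReal) ≤ c ↔ a + x ≤ c ∧ b + x ≤ c := by
  constructor
  · intro h
    exact ⟨(add_le_add_left (le_max_left a b) _).trans h,
      (add_le_add_left (le_max_right a b) _).trans h⟩
  · rintro ⟨h1, h2⟩
    rcases max_choice a b with e | e <;> rw [e] <;> assumption

namespace PTEG

variable {Place : Type*} {n : ℕ} (N : PTEG Place n)

/-- The trajectory is a potential of the columns `0, …, K` of the periodic graph. -/
def IsPotential (K : ℕ) (x : ℕ → Fin n → ℝ) : Prop :=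
  ∀ k l, k ≤ K → l ≤ K → ∀ i j, N.wt i j ((k : ℤ) - l) + (x l j : EReal) ≤ x k i

/-- An upper bound `x_i ≤ B_ij + x_j` is a lower bound for `x_j` with arc weight `-B_ij`, and the
monotonicity of the trajectory comes from the identity in `matI`. -/
theorem isConsistentUpTo_iff (K : ℕ) (x : ℕ → Fin n → ℝ) :
    N.IsConsistentUpTo K x ↔ N.IsPotential K x := by
  unfold IsConsistentUpTo IsPotential
  simp only [iSup_le_iff, le_iInf_iff]
  constructor
  · rintro ⟨h0, h1, h2⟩ k l hk hl i j
    by_cases hd : (k : ℤ) - l = -1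
    · obtain rfl : l = k + 1 := by omega
      rw [hd, wt_neg_one]
      exact (neg_add_coe_le_iff (N.matB_nonneg 1 j i) _ _).2 ((h1 k hl j).2 i)
    by_cases hd' : (k : ℤ) - l = 1
    · obtain rfl : k = l + 1 := by omega
      rw [hd', wt_one, matI, max_add_coe_le_iff]
      refine ⟨(h1 l hk i).1 j, ?_⟩
      by_cases hij : i = j
      · subst hij
        simpa [mpOne] using h2 l hk i
      · simp [mpOne, hij]
    by_cases hd'' : (k : ℤ) - l = 0
    · obtain rfl : k = l := by omega
      rw [hd'', wt_zero, matC, max_add_coe_le_iff]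
      exact ⟨(h0 k hk i).1 j, (neg_add_coe_le_iff (N.matB_nonneg 0 j i) _ _).2 ((h0 k hk j).2 i)⟩
    · rw [N.wt_of_not i j (by omega)]
      simp
  · intro h
    have hP : ∀ k < K, ∀ i j, N.matP i j + (x (k + 1) j : EReal) ≤ x k i := by
      intro k hk i j
      have := h k (k + 1) (by omega) hk i j
      rwa [show (k : ℤ) - ((k + 1 : ℕ) : ℤ) = -1 by push_cast; ring, wt_neg_one] at this
    have hI : ∀ k < K, ∀ i j, N.matA 1 i j + (x k j : EReal) ≤ x (k + 1) i ∧
        mpOne (Fin n) i j + (x k j : EReal) ≤ x (k + 1) i := by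
      intro k hk i j
      have := h (k + 1) k hk (by omega) i j
      rwa [show ((k + 1 : ℕ) : ℤ) - k = 1 by push_cast; ring, wt_one, matI,
        max_add_coe_le_iff] at this
    have hC : ∀ k ≤ K, ∀ i j, N.matA 0 i j + (x k j : EReal) ≤ x k i ∧
        sharp (N.matB 0) i j + (x k j : EReal) ≤ x k i := by
      intro k hk i j
      have := h k k hk hk i j
      rwa [sub_self, wt_zero, matC, max_add_coe_le_iff] at this
    refine ⟨fun k hk i => ⟨fun j => (hC k hk i j).1, fun j => ?_⟩,
      fun k hk i => ⟨fun j => (hI k hk i j).1, fun j => ?_⟩, fun k hk i => ?_⟩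
    · exact (neg_add_coe_le_iff (N.matB_nonneg 0 i j) _ _).1 (hC k hk j i).2
    · exact (neg_add_coe_le_iff (N.matB_nonneg 1 i j) _ _).1 (hP k hk j i)
    · simpa [mpOne] using (hI k hk i i).2

/-- The inequalities of the potential telescope along the walk; the length hypotheses keep the walk
in the columns where they hold. -/
theorem IsPotential.weight_le {N : PTEG Place n} {K : ℕ} {x : ℕ → Fin n → ℝ}
    (hx : N.IsPotential K x) {i j : Fin n} {p : List (Fin n)} {t : ℤ} {w : ℝ}
    (h : SWalk N.wt j p i t w) (l k : ℕ) (hkl : (k : ℤ) = l + t) (h1 : p.length ≤ l)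
    (h2 : l + p.length ≤ K) : w + x l j ≤ x k i := by
  induction h generalizing l with
  | nil a =>
    obtain rfl : k = l := by omega
    simp
  | @cons a b c p d t g w hg h ih =>
    have hd := N.regular_wt.shift _ _ d (by rw [hg]; simp)
    simp only [List.length_cons] at h1 h2
    have e : (((l : ℤ) + d).toNat : ℤ) = l + d := Int.toNat_of_nonneg (by omega)
    generalize ((l : ℤ) + d).toNat = l' at e
    have h3 := ih l' (by omega) (by omega) (by omega)
    have h4 := hx l' l (by omega) (by omega) b a
    rw [e, add_sub_cancel_left, hg, ← EReal.coe_add, EReal.coe_le_coe_iff] at h4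
    linarith

theorem exists_isPotential (h : NoPosWalk N.wt) (K : ℕ) : ∃ x, N.IsPotential K x := by
  have hM := N.noPosCircuitMatrix_matM h K
  obtain ⟨D, hD⟩ := exists_fwInv (N.matM_ne_top K)
  -- The largest weight of a walk of `M_K` that ends in `a`, the empty walk included. It is finite:
  -- no star entry is `⊤`, and the diagonal is nonnegative.
  let X : Fin (K + 1) × Fin n → EReal := fun a => ⨆ b, kleeneStar (N.matM K) a b
  have hX : ∀ a, X a ≠ ⊤ ∧ X a ≠ ⊥ := by
    intro a
    have : Nonempty (Fin (K + 1) × Fin n) := ⟨a⟩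
    constructor
    · obtain ⟨b, hb⟩ := exists_eq_ciSup_of_finite (f := fun b => kleeneStar (N.matM K) a b)
      simp only [X, ← hb]
      exact hD.kleeneStar_ne_top hM a b
    · have h0 : (0 : EReal) ≤ kleeneStar (N.matM K) a a :=
        le_trans (by simp [mpPow, mpOne]) (le_iSup (fun r => mpPow (N.matM K) r a a) 0)
      exact ne_bot_of_le_ne_bot EReal.zero_ne_bot
        (h0.trans (le_iSup (fun b => kleeneStar (N.matM K) a b) a))
  refine ⟨fun k i => if hk : k < K + 1 then (X (⟨k, hk⟩, i)).toReal else 0, ?_⟩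
  intro k l hk hl i j
  simp only [dif_pos (Nat.lt_succ_of_le hk), dif_pos (Nat.lt_succ_of_le hl),
    EReal.coe_toReal (hX _).1 (hX _).2]
  have e := N.matM_apply K (⟨k, Nat.lt_succ_of_le hk⟩, i) (⟨l, Nat.lt_succ_of_le hl⟩, j)
  simp only at e
  rw [← e, add_comm]
  refine iSup_add_le fun b => ?_
  rw [add_comm]
  exact (add_kleeneStar_le _ _ _).trans (le_iSup (fun b => kleeneStar (N.matM K) _ b) b)

theorem weaklyConsistent_iff : N.WeaklyConsistent ↔ NoPosWalk N.wt := by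
  constructor
  · intro h a p w hp
    -- From the middle of `2 * p.length + 1` columns the walk cannot leave them.
    obtain ⟨x, hx⟩ := h (2 * p.length)
    have := ((N.isConsistentUpTo_iff _ x).1 hx).weight_le hp p.length p.length (by simp) le_rfl
      (by omega)
    linarith
  · intro h K
    obtain ⟨x, hx⟩ := N.exists_isPotential h K
    exact ⟨x, (N.isConsistentUpTo_iff K x).2 hx⟩

theorem weaklyConsistent_equivalences : (N.WeaklyConsistent ↔ ¬ N.HasPosCircuit) ∧
    (N.WeaklyConsistent ↔ N.AlgorithmAccepts) ∧ (N.WeaklyConsistent ↔ N.StarTestAccepts) := by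
  rw [N.weaklyConsistent_iff, N.hasPosCircuit_iff, N.algorithmAccepts_iff, N.starTestAccepts_iff]
  simp

end PTEG

/-! ## Verification of programs -/

/-- The location of a real number in the memory: an array and the indices. -/
abbrev Loc := ℕ × List ℤ

/-- The real part of a memory. -/
abbrev Heap := ℕ → List ℤ → EReal

/-- The first registers hold the values of the list `env`. -/
def Matches (env : List ℤ) (ρ : ℕ → ℤ) : Prop := ∀ i v, env[i]? = some v → ρ i = v

/-- The program `c` keeps the registers described by `env`, changes the real part of the memory
according to the relation `R`, and halts after at most `C * (n + 1) ^ D` steps. -/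
def Spec (env : List ℤ) (n : ℕ) (c : Program) (C D : ℕ) (R : Heap → Heap → Prop) : Prop :=
  ∀ σ : Memory, Matches env σ.int → ∃ t τ, Runs c σ t τ ∧ t ≤ C * (n + 1) ^ D ∧
    Matches env τ.int ∧ R σ.real τ.real

theorem Matches.snoc {env : List ℤ} {ρ : ℕ → ℤ} (h : Matches env ρ) {d : ℕ} (hd : env.length = d)
    (v : ℤ) : Matches (env ++ [v]) (Function.update ρ d v) := by
  subst hd
  intro i u hi
  rcases lt_trichotomy i env.length with hl | rfl | hl
  · rw [List.getElem?_append_left hl] at hi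
    rw [Function.update_of_ne hl.ne, h i u hi]
  · simp at hi
    simp [hi]
  · rw [List.getElem?_eq_none (by simp; omega)] at hi
    simp at hi

theorem Matches.of_snoc {env : List ℤ} {ρ : ℕ → ℤ} {v : ℤ} (h : Matches (env ++ [v]) ρ) :
    Matches env ρ := by
  intro i u hi
  refine h i u ?_
  rw [List.getElem?_append_left (List.getElem?_eq_some_iff.1 hi).1, hi]

theorem Matches.last {env : List ℤ} {ρ : ℕ → ℤ} {v : ℤ} (h : Matches (env ++ [v]) ρ) {d : ℕ}
    (hd : env.length = d) : ρ d = v :=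
  h d v (by subst hd; simp)

/-- The values of a list of registers. -/
def lookups (env : List ℤ) : List ℕ → Option (List ℤ)
  | [] => some []
  | r :: rs => (env[r]?).bind fun v => (lookups env rs).map (v :: ·)

theorem Matches.lookups {env : List ℤ} {ρ : ℕ → ℤ} (h : Matches env ρ) {rs : List ℕ} {vs : List ℤ}
    (hr : lookups env rs = some vs) : rs.map ρ = vs := by
  induction rs generalizing vs with
  | nil => simp [WeakConsistency.lookups] at hr; simp [hr]
  | cons r rs ih =>
    simp only [WeakConsistency.lookups, Option.bind_eq_some_iff, Option.map_eq_some_iff] at hr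
    obtain ⟨v, hv, vs', hvs, rfl⟩ := hr
    simp [h r v hv, ih hvs]

theorem Spec.mono {env : List ℤ} {n : ℕ} {c : Program} {C C' D D' : ℕ} {R R' : Heap → Heap → Prop}
    (h : Spec env n c C D R) (hR : ∀ h h', R h h' → R' h h') (hC : C ≤ C' := by decide)
    (hD : D ≤ D' := by decide) : Spec env n c C' D' R' := by
  intro σ hσ
  obtain ⟨t, τ, hr, ht, hm, hR'⟩ := h σ hσ
  exact ⟨t, τ, hr, ht.trans (Nat.mul_le_mul hC (Nat.pow_le_pow_right (by omega) hD)), hm, hR _ _ hR'⟩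

theorem Spec.seq {env : List ℤ} {n : ℕ} {c d : Program} {C C' D D' : ℕ} {R R' : Heap → Heap → Prop}
    (h : Spec env n c C D R) (h' : Spec env n d C' D' R') :
    Spec env n (.seq c d) (C + C') (max D D') fun h h'' => ∃ h', R h h' ∧ R' h' h'' := by
  intro σ hσ
  obtain ⟨t, τ, hr, ht, hm, hR⟩ := h σ hσ
  obtain ⟨t', τ', hr', ht', hm', hR'⟩ := h' τ hm
  refine ⟨t + t', τ', .seq hr hr', ?_, hm', _, hR, hR'⟩
  rw [add_mul]
  refine Nat.add_le_add (ht.trans ?_) (ht'.trans ?_) <;>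
    exact Nat.mul_le_mul_left _ (Nat.pow_le_pow_right (by omega) (by simp))

theorem Spec.seq_trans {env : List ℤ} {n : ℕ} {c d : Program} {C C' D D' : ℕ}
    {R R' R'' : Heap → Heap → Prop} (h : Spec env n c C D R) (h' : Spec env n d C' D' R')
    (hR : ∀ h h' h'', R h h' → R' h' h'' → R'' h h'') :
    Spec env n (.seq c d) (C + C') (max D D') R'' :=
  (h.seq h').mono (fun _ _ ⟨_, h1, h2⟩ => hR _ _ _ h1 h2) le_rfl le_rfl

/-- The new register is the first one not described by `env`. After `c` it is dropped from the
description and may be reused, so the registers behave like a stack of local variables. -/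
theorem Spec.letOp {env : List ℤ} {n : ℕ} {b c : Program} {C D d : ℕ} {R : Heap → Heap → Prop}
    {v : ℤ} (hd : env.length = d) (hb : ∀ σ, Matches env σ.int → Runs b σ 1 (σ.setInt d v))
    (h : Spec (env ++ [v]) n c C D R) : Spec env n (.seq b c) (1 + C) D R := by
  intro σ hσ
  obtain ⟨t, τ, hr, ht, hm, hR⟩ := h (σ.setInt d v) (hσ.snoc hd v)
  refine ⟨1 + t, τ, .seq (hb σ hσ) hr, ?_, hm.of_snoc, hR⟩
  rw [add_mul, one_mul]
  exact Nat.add_le_add (Nat.one_le_pow _ _ (by omega)) ht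

theorem Spec.letAdd {env : List ℤ} {n : ℕ} {c : Program} {C D d y z : ℕ} {R : Heap → Heap → Prop}
    {u v : ℤ} (hd : env.length = d) (hy : env[y]? = some u) (hz : env[z]? = some v)
    (h : Spec (env ++ [u + v]) n c C D R) : Spec env n (.seq (.intAdd d y z) c) (1 + C) D R :=
  Spec.letOp hd (fun σ hσ => by rw [← hσ y u hy, ← hσ z v hz]; exact .intAdd σ d y z) h

theorem Spec.letSub {env : List ℤ} {n : ℕ} {c : Program} {C D d y z : ℕ} {R : Heap → Heap → Prop}
    {u v : ℤ} (hd : env.length = d) (hy : env[y]? = some u) (hz : env[z]? = some v)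
    (h : Spec (env ++ [u - v]) n c C D R) : Spec env n (.seq (.intSub d y z) c) (1 + C) D R :=
  Spec.letOp hd (fun σ hσ => by rw [← hσ y u hy, ← hσ z v hz]; exact .intSub σ d y z) h

theorem Spec.letConst {env : List ℤ} {n : ℕ} {c : Program} {C D d : ℕ} {R : Heap → Heap → Prop}
    {v : ℤ} (hd : env.length = d)
    (h : Spec (env ++ [v]) n c C D R) : Spec env n (.seq (.intConst d v) c) (1 + C) D R :=
  Spec.letOp hd (fun σ _ => .intConst σ d v) h

/-! ### Loops -/

/-- The loop over the values of register `d` from the value of `lo` to that of `hi`; register `1`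
holds zero and register `2` holds one. -/
def forLoop (d lo hi : ℕ) (c : Program) : Program :=
  .seq (.intAdd d lo 1) (.loop (.intLe d hi) (.seq c (.intAdd d d 2)))

/-- The function `v` enumerates the integers from `a` to `b`. -/
structure LoopRange {ι : Type*} (v : ι → ℤ) (a b : ℤ) : Prop where
  inj : Function.Injective v
  mem : ∀ x, a ≤ v x ∧ v x ≤ b
  surj : ∀ k, a ≤ k → k ≤ b → ∃ x, v x = k
  le : a ≤ b + 1

theorem LoopRange.fin (n : ℕ) : LoopRange (fun i : Fin n => (i.val : ℤ)) 0 ((n : ℤ) - 1) where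
  inj i j h := by ext; simpa using h
  mem i := by have := i.isLt; omega
  surj k h h' := ⟨⟨k.toNat, by omega⟩, by simp; omega⟩
  le := by omega

theorem LoopRange.finSucc (n : ℕ) : LoopRange (fun i : Fin (n + 1) => (i.val : ℤ)) 0 n where
  inj i j h := by ext; simpa using h
  mem i := by have := i.isLt; omega
  surj k h h' := ⟨⟨k.toNat, by omega⟩, by simp; omega⟩
  le := by omega

theorem LoopRange.icc {a b : ℤ} (h : a ≤ b + 1) :
    LoopRange (fun i : Set.Icc a b => (i : ℤ)) a b where
  inj := Subtype.val_injective
  mem i := i.2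
  surj k h h' := ⟨⟨k, h, h'⟩, rfl⟩
  le := h

theorem Spec.forLoop {ι : Type*} {v : ι → ℤ} {env : List ℤ} {n d lo hi : ℕ} {a b : ℤ} {κ e : ℕ}
    {c : Program} {C D : ℕ} {J : ℤ → Heap → Heap → Prop} {R : ι → Heap → Heap → Prop}
    (hr : LoopRange v a b) (hd : env.length = d) (h1 : env[1]? = some 0) (h2 : env[2]? = some 1)
    (hlo : env[lo]? = some a) (hhi : env[hi]? = some b)
    (hκ : b + 1 - a ≤ κ * ((n : ℤ) + 1) ^ e)
    (hc : ∀ x, Spec (env ++ [v x]) n c C D (R x)) (J0 : ∀ h, J a h h)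
    (hJ : ∀ x h h' h'', J (v x) h h' → R x h' h'' → J (v x + 1) h h'') :
    Spec env n (WeakConsistency.forLoop d lo hi c) (κ * (C + 2) + 2) (e + D) (J (b + 1)) := by
  -- `r` is the number of rounds still to come when the counter is `k`.
  have key : ∀ (r : ℕ) (k : ℤ) (σ : Memory) (h : Heap), k + r = b + 1 → a ≤ k →
      Matches (env ++ [k]) σ.int → J k h σ.real →
      ∃ t τ, Runs (.loop (.intLe d hi) (.seq c (.intAdd d d 2))) σ t τ ∧
        t ≤ r * (C * (n + 1) ^ D + 2) + 1 ∧ Matches (env ++ [b + 1]) τ.int ∧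
        J (b + 1) h τ.real := by
    intro r
    induction r with
    | zero =>
      intro k σ h hk hak hm hJk
      obtain rfl : k = b + 1 := by simpa using hk
      refine ⟨1, σ, .loopDone ?_, by simp, hm, hJk⟩
      simp only [Test.Holds, hm.last hd, hm.of_snoc hi b hhi]
      omega
    | succ r ih =>
      intro k σ h hk hak hm hJk
      push_cast at hk
      obtain ⟨x, rfl⟩ := hr.surj k hak (by omega)
      obtain ⟨t, τ, hrun, ht, hm', hR⟩ := hc x σ hm
      have hm'' : Matches (env ++ [v x + 1]) (τ.setInt d (τ.int d + τ.int 2)).int := by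
        rw [hm'.last hd, hm'.of_snoc 2 1 h2]
        exact hm'.of_snoc.snoc hd _
      obtain ⟨t', τ', hrun', ht', hm3, hJ'⟩ := ih (v x + 1) _ h (by omega) (by omega) hm''
        (hJ x h σ.real τ.real hJk hR)
      refine ⟨(t + 1) + t' + 1, τ', .loopStep ?_ (.seq hrun (.intAdd _ _ _ _)) hrun', ?_, hm3, hJ'⟩
      · simp only [Test.Holds, hm.last hd, hm.of_snoc hi b hhi]
        omega
      · rw [add_mul, one_mul]
        omega
  intro σ hσ
  have hm : Matches (env ++ [a]) (σ.setInt d (σ.int lo + σ.int 1)).int := by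
    rw [hσ lo a hlo, hσ 1 0 h1, add_zero]
    exact hσ.snoc hd a
  obtain ⟨t, τ, hrun, ht, hm', hJ'⟩ := key (b + 1 - a).toNat a _ σ.real
    (by have := hr.le; omega) le_rfl hm (J0 _)
  refine ⟨1 + t, τ, .seq (.intAdd _ _ _ _) hrun, ?_, hm'.of_snoc, hJ'⟩
  have hcount : (b + 1 - a).toNat ≤ κ * (n + 1) ^ e := by
    have := hr.le
    zify
    rw [Int.toNat_of_nonneg (by omega)]
    exact_mod_cast hκ
  have hp : 1 ≤ (n + 1) ^ D := Nat.one_le_pow _ _ (by omega)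
  have hp' : 1 ≤ (n + 1) ^ (e + D) := Nat.one_le_pow _ _ (by omega)
  -- A round costs two steps besides the body, for the test and the increment. The initial
  -- assignment and the last test make up the final two.
  calc 1 + t ≤ (b + 1 - a).toNat * (C * (n + 1) ^ D + 2) + 2 := by omega
    _ ≤ κ * (n + 1) ^ e * ((C + 2) * (n + 1) ^ D) + 2 * (n + 1) ^ (e + D) := by
      refine Nat.add_le_add (Nat.mul_le_mul hcount ?_) (by omega)
      rw [add_mul]
      omega
    _ = _ := by rw [pow_add]; ring

/-- A loop with an invariant of the real part of the memory. -/
theorem Spec.forInv {ι : Type*} {v : ι → ℤ} {env : List ℤ} {n d lo hi : ℕ} {a b : ℤ} {κ e : ℕ}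
    {c : Program} {C D : ℕ} {J : ℤ → Heap → Prop}
    (hr : LoopRange v a b) (hd : env.length = d) (h1 : env[1]? = some 0) (h2 : env[2]? = some 1)
    (hlo : env[lo]? = some a) (hhi : env[hi]? = some b)
    (hκ : b + 1 - a ≤ κ * ((n : ℤ) + 1) ^ e)
    (hc : ∀ x, Spec (env ++ [v x]) n c C D fun h h' => J (v x) h → J (v x + 1) h') :
    Spec env n (WeakConsistency.forLoop d lo hi c) (κ * (C + 2) + 2) (e + D) fun h h' => J a h → J (b + 1) h' :=
  Spec.forLoop (J := fun k h h' => J a h → J k h') hr hd h1 h2 hlo hhi hκ hc (fun _ h => h)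
    fun _ _ _ _ h3 h4 h5 => h4 (h3 h5)

/-! ### Frames -/

/-- The arrays that a program may write. -/
def Program.writes : Program → List ℕ
  | .realZero r => [r.1]
  | .realBot r => [r.1]
  | .realAdd r _ _ => [r.1]
  | .realNeg r _ => [r.1]
  | .seq c d => c.writes ++ d.writes
  | .ite _ c d => c.writes ++ d.writes
  | .loop _ c => c.writes
  | _ => []

theorem Memory.set_real_of_ne {σ : Memory} {r : Cell} {v : EReal} {a : ℕ} (h : a ≠ r.1) :
    (σ.set r v).real a = σ.real a := by
  simp [Memory.set, h]

theorem Runs.frame {c : Program} {σ τ : Memory} {t : ℕ} (h : Runs c σ t τ) {a : ℕ}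
    (ha : a ∉ c.writes) : τ.real a = σ.real a := by
  induction h with
  | skip | intConst | intAdd | intSub | loopDone => rfl
  | realZero | realBot | realAdd | realNeg =>
    exact Memory.set_real_of_ne (by simpa [Program.writes] using ha)
  | seq _ _ h1 h2 =>
    simp only [Program.writes, List.mem_append, not_or] at ha
    rw [h2 ha.2, h1 ha.1]
  | iteTrue _ _ h1 =>
    simp only [Program.writes, List.mem_append, not_or] at ha
    exact h1 ha.1
  | iteFalse _ _ h1 =>
    simp only [Program.writes, List.mem_append, not_or] at ha
    exact h1 ha.2
  | loopStep _ _ _ h1 h2 => rw [h2 ha, h1 ha]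

theorem Spec.frame {env : List ℤ} {n : ℕ} {c : Program} {C D : ℕ} {R : Heap → Heap → Prop}
    (h : Spec env n c C D R) :
    Spec env n c C D fun h h' => (∀ a, a ∉ c.writes → h' a = h a) ∧ R h h' := by
  intro σ hσ
  obtain ⟨t, τ, hr, ht, hm, hR⟩ := h σ hσ
  exact ⟨t, τ, hr, ht, hm, fun a ha => hr.frame ha, hR⟩

/-! ### Filling with `-∞` -/

/-- The locations in `I` are set to `-∞`. -/
def FillRel (I : Set Loc) (h h' : Heap) : Prop :=
  ∀ a l, ((a, l) ∈ I → h' a l = ⊥) ∧ ((a, l) ∉ I → h' a l = h a l)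

theorem Spec.fill {env : List ℤ} {n a : ℕ} {ra : List ℕ} {va : List ℤ}
    (ha : lookups env ra = some va) :
    Spec env n (.realBot (a, ra)) 1 0 (FillRel {(a, va)}) := by
  intro σ hσ
  refine ⟨1, _, .realBot _ _, by simp, hσ, fun b l => ⟨?_, ?_⟩⟩
  · rintro h
    obtain ⟨rfl, rfl⟩ := Prod.ext_iff.1 h
    simp [Memory.set, hσ.lookups ha]
  · intro h
    simp only [Memory.set, hσ.lookups ha]
    by_cases hb : b = a
    · subst hb
      have hl : l ≠ va := by rintro rfl; simp at h
      simp [hl]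
    · simp [hb]

theorem FillRel.union {I I' : Set Loc} {h h' h'' : Heap} (h1 : FillRel I h h')
    (h2 : FillRel I' h' h'') : FillRel (I ∪ I') h h'' := by
  intro a l
  obtain ⟨h3, h4⟩ := h1 a l
  obtain ⟨h5, h6⟩ := h2 a l
  constructor
  · intro h
    by_cases hI' : (a, l) ∈ I'
    · exact h5 hI'
    · rw [h6 hI', h3 (h.resolve_right hI')]
  · intro h
    simp only [Set.mem_union, not_or] at h
    rw [h6 h.2, h4 h.1]

theorem LoopRange.iUnion_succ {ι α : Type*} {v : ι → ℤ} {a b : ℤ} (hr : LoopRange v a b)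
    (I : ι → Set α) (x : ι) :
    ⋃ (y) (_ : v y < v x + 1), I y = (⋃ (y) (_ : v y < v x), I y) ∪ I x := by
  ext e
  simp only [Set.mem_iUnion, Set.mem_union, exists_prop, Int.lt_add_one_iff]
  constructor
  · rintro ⟨y, hy, he⟩
    rcases hy.lt_or_eq with h | h
    · exact .inl ⟨y, h, he⟩
    · exact .inr (hr.inj h ▸ he)
  · rintro (⟨y, hy, he⟩ | he)
    · exact ⟨y, hy.le, he⟩
    · exact ⟨x, le_rfl, he⟩

theorem LoopRange.iUnion_start {ι α : Type*} {v : ι → ℤ} {a b : ℤ} (hr : LoopRange v a b)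
    (I : ι → Set α) : ⋃ (y) (_ : v y < a), I y = ∅ := by
  simp only [Set.iUnion_eq_empty]
  exact fun y hy => absurd hy (not_lt.2 (hr.mem y).1)

theorem LoopRange.iUnion_end {ι α : Type*} {v : ι → ℤ} {a b : ℤ} (hr : LoopRange v a b)
    (I : ι → Set α) : ⋃ (y) (_ : v y < b + 1), I y = ⋃ y, I y :=
  Set.iUnion_congr fun y => by simp [(hr.mem y).2]

theorem Spec.fillFor {ι : Type*} {v : ι → ℤ} {env : List ℤ} {n d lo hi : ℕ} {a b : ℤ} {κ e : ℕ}
    {c : Program} {C D : ℕ} {I : ι → Set Loc}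
    (hr : LoopRange v a b) (hd : env.length = d) (h1 : env[1]? = some 0) (h2 : env[2]? = some 1)
    (hlo : env[lo]? = some a) (hhi : env[hi]? = some b)
    (hκ : b + 1 - a ≤ κ * ((n : ℤ) + 1) ^ e)
    (hc : ∀ x, Spec (env ++ [v x]) n c C D (FillRel (I x))) :
    Spec env n (WeakConsistency.forLoop d lo hi c) (κ * (C + 2) + 2) (e + D)
      (FillRel (⋃ x, I x)) := by
  rw [← hr.iUnion_end I]
  refine Spec.forLoop (J := fun k => FillRel (⋃ (y) (_ : v y < k), I y)) hr hd h1 h2 hlo hhi hκ hc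
    ?_ ?_
  · intro h
    rw [hr.iUnion_start]
    exact fun a l => ⟨fun h => absurd h (Set.notMem_empty _), fun _ => rfl⟩
  · intro x h h' h'' h3 h4
    rw [hr.iUnion_succ]
    exact h3.union h4

/-! ### Relaxation -/

/-- The heaps agree outside of `T` and of the auxiliary array `9`. -/
def AgreeOff (T : Set Loc) (h h' : Heap) : Prop := ∀ a l, (a, l) ∉ T → a ≠ 9 → h a l = h' a l

/-- The relaxation of a location: it is replaced by the maximum of its contents and of a value. -/
abbrev Relaxation := Loc × (Heap → EReal)

/-- The target lies in `T`, and the value does not depend on what `T` holds. -/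
def Admissible (T : Set Loc) (e : Relaxation) : Prop :=
  e.1 ∈ T ∧ e.1.1 ≠ 9 ∧ ∀ h h', AgreeOff T h h' → e.2 h = e.2 h'

/-- The effect of a set of relaxations with targets in `T`. -/
structure RelaxRel (T : Set Loc) (E : Set Relaxation) (h h' : Heap) : Prop where
  adm : ∀ e ∈ E, Admissible T e
  agree : AgreeOff T h h'
  le_iff : ∀ a l, (a, l) ∈ T → a ≠ 9 → ∀ w, h' a l ≤ w ↔
    h a l ≤ w ∧ ∀ e ∈ E, e.1 = (a, l) → e.2 h ≤ w

theorem RelaxRel.refl (T : Set Loc) (h : Heap) : RelaxRel T ∅ h h where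
  adm e he := absurd he (Set.notMem_empty _)
  agree _ _ _ _ := rfl
  le_iff _ _ _ _ _ := by simp

/-- Admissible values read nothing in `T`, so those of `E'` are the same before and after the
relaxations in `E`. This is why the order of relaxations is irrelevant. -/
theorem RelaxRel.union {T : Set Loc} {E E' : Set Relaxation} {h h' h'' : Heap}
    (h1 : RelaxRel T E h h') (h2 : RelaxRel T E' h' h'') : RelaxRel T (E ∪ E') h h'' where
  adm e he := he.elim (h1.adm e) (h2.adm e)
  agree a l ha h9 := (h1.agree a l ha h9).trans (h2.agree a l ha h9)
  le_iff a l ha h9 w := by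
    rw [h2.le_iff a l ha h9, h1.le_iff a l ha h9, and_assoc]
    refine and_congr_right fun _ => ?_
    simp only [Set.mem_union, or_imp, forall_and]
    refine and_congr_right fun _ => forall_congr' fun e => ?_
    refine imp_congr_right fun he => imp_congr_right fun _ => ?_
    rw [(h2.adm e he).2.2 h h' h1.agree]

theorem Spec.relaxSeq {env : List ℤ} {n : ℕ} {c d : Program} {C C' D D' : ℕ} {T : Set Loc}
    {E E' : Set Relaxation} (h : Spec env n c C D (RelaxRel T E))
    (h' : Spec env n d C' D' (RelaxRel T E')) :
    Spec env n (.seq c d) (C + C') (max D D') (RelaxRel T (E ∪ E')) :=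
  h.seq_trans h' fun _ _ _ => RelaxRel.union

theorem Spec.relaxFor {ι : Type*} {v : ι → ℤ} {env : List ℤ} {n d lo hi : ℕ} {a b : ℤ} {κ e : ℕ}
    {c : Program} {C D : ℕ} {T : Set Loc} {E : ι → Set Relaxation}
    (hr : LoopRange v a b) (hd : env.length = d) (h1 : env[1]? = some 0) (h2 : env[2]? = some 1)
    (hlo : env[lo]? = some a) (hhi : env[hi]? = some b)
    (hκ : b + 1 - a ≤ κ * ((n : ℤ) + 1) ^ e)
    (hc : ∀ x, Spec (env ++ [v x]) n c C D (RelaxRel T (E x))) :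
    Spec env n (WeakConsistency.forLoop d lo hi c) (κ * (C + 2) + 2) (e + D)
      (RelaxRel T (⋃ x, E x)) := by
  rw [← hr.iUnion_end E]
  refine Spec.forLoop (J := fun k => RelaxRel T (⋃ (y) (_ : v y < k), E y)) hr hd h1 h2 hlo hhi hκ
    hc ?_ ?_
  · intro h
    rw [hr.iUnion_start]
    exact RelaxRel.refl T h
  · intro x h h' h'' h3 h4
    rw [hr.iUnion_succ]
    exact h3.union h4

/-- Relax the cell `r` with the value that `f` writes. -/
def relaxWith (f : Cell → Program) (r : Cell) : Program :=
  .seq (f (9, [])) (.ite (.realLe r (9, [])) (f r) .skip)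

/-- `r := max r (s + t)` -/
def relaxAdd (r s t : Cell) : Program := relaxWith (fun r => .realAdd r s t) r

/-- `r := max r (-s)` -/
def relaxNeg (r s : Cell) : Program := relaxWith (fun r => .realNeg r s) r

/-- `r := max r 0` unless `s = -∞` -/
def relaxInd (r s : Cell) : Program :=
  .seq (.realBot (9, [])) (.ite (.realLe s (9, [])) .skip (relaxWith .realZero r))

theorem relaxRel_single {T : Set Loc} {a : ℕ} {l : List ℤ} {val : Heap → EReal}
    (hadm : Admissible T ((a, l), val)) {h h' : Heap}
    (hoff : ∀ b k, (b, k) ≠ (a, l) → b ≠ 9 → h' b k = h b k)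
    (hon : h' a l = max (h a l) (val h)) : RelaxRel T {((a, l), val)} h h' where
  adm e he := by rw [Set.mem_singleton_iff.1 he]; exact hadm
  agree b k hb h9 := (hoff b k (fun e => hb (e ▸ hadm.1)) h9).symm
  le_iff b k _ h9 w := by
    by_cases e : (b, k) = (a, l)
    · obtain ⟨rfl, rfl⟩ := Prod.ext_iff.1 e
      simp [hon]
    · rw [hoff b k e h9]
      simp [Ne.symm e]

theorem RelaxRel.single_congr {T : Set Loc} {a : ℕ} {l : List ℤ} {val val' : Heap → EReal}
    {h₀ h h' : Heap} (hR : RelaxRel T {((a, l), val)} h h') (hh : ∀ b, b ≠ 9 → h b = h₀ b)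
    (hadm : Admissible T ((a, l), val')) (hv : val h = val' h₀) :
    RelaxRel T {((a, l), val')} h₀ h' where
  adm e he := by rw [Set.mem_singleton_iff.1 he]; exact hadm
  agree b k hb h9 := by rw [← hh b h9]; exact hR.agree b k hb h9
  le_iff b k hb h9 w := by
    rw [hR.le_iff b k hb h9, hh b h9]
    simp [hv]

theorem Memory.set_real_apply (σ : Memory) (r : Cell) (v : EReal) (b : ℕ) (k : List ℤ) :
    (σ.set r v).real b k = if (b, k) = (r.1, r.2.map σ.int) then v else σ.real b k := by
  by_cases hb : b = r.1
  · subst hb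
    by_cases hk : k = r.2.map σ.int
    · subst hk; simp [Memory.set]
    · simp [Memory.set, hk]
  · simp [Memory.set, hb]

/-- The candidate value is written to the scratch cell, compared, and if large enough computed once
more into the target. `hval` ensures that the scratch cell does not influence it. -/
theorem Spec.relaxWith {env : List ℤ} {n a : ℕ} {ra : List ℕ} {va : List ℤ} {T : Set Loc}
    {f : Cell → Program} {val : Heap → EReal} (ha : lookups env ra = some va)
    (hadm : Admissible T ((a, va), val))
    (hval : ∀ h h', (∀ b, b ≠ 9 → h' b = h b) → val h' = val h)
    (hf : ∀ σ r, Matches env σ.int → Runs (f r) σ 1 (σ.set r (val σ.real))) :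
    Spec env n (WeakConsistency.relaxWith f (a, ra)) 3 0 (RelaxRel T {((a, va), val)}) := by
  intro σ hσ
  have h9 : a ≠ 9 := hadm.2.1
  set τ := σ.set (9, []) (val σ.real) with hτ
  have hτm : Matches env τ.int := hσ
  have hoff : ∀ b, b ≠ 9 → τ.real b = σ.real b := fun b hb => Memory.set_real_of_ne hb
  have e1 : τ.get (a, ra) = σ.real a va := by
    simp only [Memory.get, hτm.lookups ha, hoff a h9]
  have e2 : τ.get (9, []) = val σ.real := by simp [Memory.get, hτ, Memory.set]
  by_cases hle : σ.real a va ≤ val σ.real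
  · refine ⟨1 + (1 + 1), τ.set (a, ra) (val τ.real),
      .seq (hf _ _ hσ) (.iteTrue (show τ.get (a, ra) ≤ τ.get (9, []) by rwa [e1, e2]) (hf _ _ hτm)),
      by simp, hτm, ?_⟩
    have e : ((a, ra) : Cell).2.map τ.int = va := hτm.lookups ha
    refine relaxRel_single hadm (fun b k hbk hb => ?_) ?_
    · rw [Memory.set_real_apply, e, if_neg hbk, hoff b hb]
    · rw [Memory.set_real_apply, e, if_pos rfl, hval _ _ hoff, max_eq_right hle]
  · refine ⟨1 + (1 + 1), τ,
      .seq (hf _ _ hσ) (.iteFalse (show ¬ τ.get (a, ra) ≤ τ.get (9, []) by rwa [e1, e2]) (.skip _)),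
      by simp, hτm, ?_⟩
    refine relaxRel_single hadm (fun b k _ hb => by rw [hoff b hb]) ?_
    rw [hoff a h9, max_eq_left (le_of_not_ge hle)]

theorem Spec.relaxAdd {env : List ℤ} {n a b c : ℕ} {ra rb rc : List ℕ} {va vb vc : List ℤ}
    {T : Set Loc} (ha : lookups env ra = some va) (hb : lookups env rb = some vb)
    (hc : lookups env rc = some vc) (hT : (a, va) ∈ T) (hb' : (b, vb) ∉ T) (hc' : (c, vc) ∉ T)
    (ha9 : a ≠ 9 := by decide) (hb9 : b ≠ 9 := by decide) (hc9 : c ≠ 9 := by decide) :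
    Spec env n (WeakConsistency.relaxAdd (a, ra) (b, rb) (c, rc)) 3 0
      (RelaxRel T {((a, va), fun h => h b vb + h c vc)}) := by
  refine Spec.relaxWith ha ⟨hT, ha9, fun h h' hh => ?_⟩ (fun h h' hh => ?_) fun σ r hσ => ?_
  · simp only [hh b vb hb' hb9, hh c vc hc' hc9]
  · simp only [hh b hb9, hh c hc9]
  · rw [← hσ.lookups hb, ← hσ.lookups hc]
    exact .realAdd _ _ _ _

theorem Spec.relaxNeg {env : List ℤ} {n a b : ℕ} {ra rb : List ℕ} {va vb : List ℤ}
    {T : Set Loc} (ha : lookups env ra = some va) (hb : lookups env rb = some vb)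
    (hT : (a, va) ∈ T) (hb' : (b, vb) ∉ T)
    (ha9 : a ≠ 9 := by decide) (hb9 : b ≠ 9 := by decide) :
    Spec env n (WeakConsistency.relaxNeg (a, ra) (b, rb)) 3 0
      (RelaxRel T {((a, va), fun h => -h b vb)}) := by
  refine Spec.relaxWith ha ⟨hT, ha9, fun h h' hh => ?_⟩ (fun h h' hh => ?_) fun σ r hσ => ?_
  · simp only [hh b vb hb' hb9]
  · simp only [hh b hb9]
  · rw [← hσ.lookups hb]
    exact .realNeg _ _ _

open Classical in
theorem Spec.relaxInd {env : List ℤ} {n a b : ℕ} {ra rb : List ℕ} {va vb : List ℤ}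
    {T : Set Loc} (ha : lookups env ra = some va) (hb : lookups env rb = some vb)
    (hT : (a, va) ∈ T) (hb' : (b, vb) ∉ T)
    (ha9 : a ≠ 9 := by decide) (hb9 : b ≠ 9 := by decide) :
    Spec env n (WeakConsistency.relaxInd (a, ra) (b, rb)) 5 0
      (RelaxRel T {((a, va), fun h => if h b vb = ⊥ then ⊥ else 0)}) := by
  have hadm : Admissible T ((a, va), fun h : Heap => if h b vb = ⊥ then (⊥ : EReal) else 0) :=
    ⟨hT, ha9, fun h h' hh => by simp only [hh b vb hb' hb9]⟩
  intro σ hσ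
  set τ := σ.set (9, []) ⊥ with hτ
  have hτm : Matches env τ.int := hσ
  have hoff : ∀ b, b ≠ 9 → τ.real b = σ.real b := fun b hb => Memory.set_real_of_ne hb
  have e1 : τ.get (b, rb) = σ.real b vb := by simp only [Memory.get, hτm.lookups hb, hoff b hb9]
  have e2 : τ.get (9, []) = ⊥ := by simp [Memory.get, hτ, Memory.set]
  by_cases hbot : σ.real b vb = ⊥
  · refine ⟨1 + (1 + 1), τ, .seq (.realBot _ _) (.iteTrue ?_ (.skip _)), by simp, hτm, ?_⟩
    · exact (show τ.get (b, rb) ≤ τ.get (9, []) by rw [e1, e2, hbot])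
    · refine relaxRel_single hadm (fun b k _ hb => by rw [hoff b hb]) ?_
      simp [hbot, hoff a ha9]
  · obtain ⟨t, υ, hr, ht, hm, hR⟩ := Spec.relaxWith (n := n) (T := T) (f := .realZero)
      (val := fun _ => 0) ha ⟨hT, ha9, fun _ _ _ => rfl⟩ (fun _ _ _ => rfl)
      (fun σ r _ => .realZero σ r) τ hτm
    refine ⟨1 + (t + 1), υ, .seq (.realBot _ _) (.iteFalse (show ¬ τ.get (b, rb) ≤ τ.get (9, []) by
      rwa [e1, e2, le_bot_iff]) hr), by simp at ht ⊢; omega, hm, ?_⟩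
    exact hR.single_congr hoff hadm (by simp [hbot])

/-! ### Tables -/

/-- The array `a`. -/
def arr (a : ℕ) : Set Loc := {c | c.1 = a}

/-- The values for the location `(a, l)` in `E` are at most `w`. -/
def RelaxBound (E : Set Relaxation) (h : Heap) (a : ℕ) (l : List ℤ) (w : EReal) : Prop :=
  ∀ e ∈ E, e.1 = (a, l) → e.2 h ≤ w

theorem relaxBound_iUnion {ι : Sort*} {E : ι → Set Relaxation} {h : Heap} {a : ℕ} {l : List ℤ}
    {w : EReal} : RelaxBound (⋃ x, E x) h a l w ↔ ∀ x, RelaxBound (E x) h a l w := by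
  simp only [RelaxBound, Set.mem_iUnion, forall_exists_index]
  exact forall_comm

theorem relaxBound_union {E E' : Set Relaxation} {h : Heap} {a : ℕ} {l : List ℤ}
    {w : EReal} : RelaxBound (E ∪ E') h a l w ↔ RelaxBound E h a l w ∧ RelaxBound E' h a l w := by
  simp only [RelaxBound, Set.mem_union, or_imp, forall_and]

theorem relaxBound_singleton {b : ℕ} {k : List ℤ} {val : Heap → EReal} {h : Heap} {a : ℕ}
    {l : List ℤ} {w : EReal} :
    RelaxBound {((b, k), val)} h a l w ↔ (b = a ∧ k = l → val h ≤ w) := by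
  simp [RelaxBound]

theorem RelaxRel.le_iff_bound {T : Set Loc} {E : Set Relaxation} {h h' : Heap}
    (hR : RelaxRel T E h h') {a : ℕ} {l : List ℤ} (hT : (a, l) ∈ T) (ha : a ≠ 9) (w : EReal) :
    h' a l ≤ w ↔ h a l ≤ w ∧ RelaxBound E h a l w :=
  hR.le_iff a l hT ha w

/-- The locations in `I` receive the suprema of the values in `E`; only `T` changes. -/
def TableRel (I T : Set Loc) (E : Set Relaxation) (h h' : Heap) : Prop :=
  AgreeOff T h h' ∧ ∀ a l, (a, l) ∈ I → a ≠ 9 → ∀ w, h' a l ≤ w ↔ RelaxBound E h a l w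

theorem Spec.table {env : List ℤ} {n : ℕ} {c d : Program} {C C' D D' : ℕ} {I T : Set Loc}
    {E : Set Relaxation} (hI : I ⊆ T) (hc : Spec env n c C D (FillRel I))
    (hd : Spec env n d C' D' (RelaxRel T E)) :
    Spec env n (.seq c d) (C + C') (max D D') (TableRel I T E) := by
  refine hc.seq_trans hd fun h h' h'' h1 h2 => ?_
  have ha : AgreeOff T h h' := fun a l hT _ => ((h1 a l).2 (fun hi => hT (hI hi))).symm
  refine ⟨fun a l hT h9 => (ha a l hT h9).trans (h2.agree a l hT h9), fun a l hi h9 w => ?_⟩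
  rw [h2.le_iff a l (hI hi) h9, (h1 a l).1 hi]
  simp only [bot_le, true_and]
  exact forall₂_congr fun e he => by rw [(h2.adm e he).2.2 h h' ha]

theorem Spec.fillRows {env : List ℤ} {n d : ℕ} {c : Program} {C D : ℕ} {I : Fin n → Set Loc}
    (hd : env.length = d) (h1 : env[1]? = some 0) (h2 : env[2]? = some 1)
    (h4 : env[4]? = some ((n : ℤ) - 1))
    (hc : ∀ i : Fin n, Spec (env ++ [(i.val : ℤ)]) n c C D (FillRel (I i))) :
    Spec env n (WeakConsistency.forLoop d 1 4 c) (1 * (C + 2) + 2) (1 + D) (FillRel (⋃ i, I i)) :=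
  Spec.fillFor (LoopRange.fin n) hd h1 h2 h1 h4 (by simp) hc

theorem Spec.relaxRows {env : List ℤ} {n d : ℕ} {c : Program} {C D : ℕ} {T : Set Loc}
    {E : Fin n → Set Relaxation}
    (hd : env.length = d) (h1 : env[1]? = some 0) (h2 : env[2]? = some 1)
    (h4 : env[4]? = some ((n : ℤ) - 1))
    (hc : ∀ i : Fin n, Spec (env ++ [(i.val : ℤ)]) n c C D (RelaxRel T (E i))) :
    Spec env n (WeakConsistency.forLoop d 1 4 c) (1 * (C + 2) + 2) (1 + D)
      (RelaxRel T (⋃ i, E i)) :=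
  Spec.relaxFor (LoopRange.fin n) hd h1 h2 h1 h4 (by simp) hc

/-- The registers during the main part of the programs. -/
abbrev baseEnv (n : ℕ) (a b c d : ℤ) : List ℤ := [n, 0, 1, -1, (n : ℤ) - 1, -n, a, b, c, d]

/-- Array `12` becomes the table of the weights of the arcs. -/
def weightTable : Program :=
  .seq
    (forLoop 10 1 4 (forLoop 11 1 4 (forLoop 12 3 2 (.realBot (12, [10, 11, 12])))))
    (.seq
      (forLoop 10 1 4 (forLoop 11 1 4
        (.seq (relaxNeg (12, [10, 11, 3]) (3, [11, 10]))
        (.seq (relaxAdd (12, [10, 11, 2]) (1, [10, 11]) (8, []))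
        (.seq (relaxAdd (12, [10, 11, 1]) (0, [10, 11]) (8, []))
          (relaxNeg (12, [10, 11, 1]) (2, [11, 10])))))))
      (forLoop 10 1 4 (relaxAdd (12, [10, 10, 2]) (8, []) (8, []))))

/-- The array holds the weights of the arcs. -/
def IsWeights {n : ℕ} (W : Fin n → Fin n → ℤ → EReal) (A : List ℤ → EReal) : Prop :=
  ∀ (i j : Fin n) (d : ℤ), -1 ≤ d → d ≤ 1 → A [(i.val : ℤ), (j.val : ℤ), d] = W i j d

theorem matrixArray_apply {n : ℕ} (A : Matrix (Fin n) (Fin n) EReal) (i j : Fin n) :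
    matrixArray A [(i.val : ℤ), (j.val : ℤ)] = A i j := by
  simp [matrixArray]

theorem spec_weightTable {Place : Type*} {n : ℕ} (N : PTEG Place n) (a b c d : ℤ) :
    Spec (baseEnv n a b c d) n weightTable 100 3 fun h h' =>
      h 0 = matrixArray (N.matA 0) → h 1 = matrixArray (N.matA 1) →
      h 2 = matrixArray (N.matB 0) → h 3 = matrixArray (N.matB 1) → h 8 [] = 0 →
      IsWeights N.wt (h' 12) := by
  unfold weightTable
  refine Spec.mono (Spec.table (T := arr 12) ?_
    (Spec.fillRows rfl rfl rfl rfl fun i => Spec.fillRows rfl rfl rfl rfl fun j =>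
      Spec.fillFor (κ := 3) (e := 0) (LoopRange.icc (a := -1) (b := 1) (by norm_num))
        rfl rfl rfl rfl rfl (by norm_num) fun d => Spec.fill (va := [i, j, d]) rfl)
    (Spec.relaxSeq
      (Spec.relaxRows rfl rfl rfl rfl fun i => Spec.relaxRows rfl rfl rfl rfl fun j =>
        Spec.relaxSeq
        (Spec.relaxNeg (va := [i, j, -1]) (vb := [j, i]) rfl rfl rfl (by simp [arr]))
        (Spec.relaxSeq (Spec.relaxAdd (va := [i, j, 1]) (vb := [i, j]) (vc := []) rfl rfl rfl rfl
          (by simp [arr]) (by simp [arr]))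
        (Spec.relaxSeq (Spec.relaxAdd (va := [i, j, 0]) (vb := [i, j]) (vc := []) rfl rfl rfl rfl
          (by simp [arr]) (by simp [arr]))
        (Spec.relaxNeg (va := [i, j, 0]) (vb := [j, i]) rfl rfl rfl (by simp [arr])))))
      (Spec.relaxRows rfl rfl rfl rfl fun i =>
        Spec.relaxAdd (va := [i, i, 1]) (vb := []) (vc := []) rfl rfl rfl rfl
          (by simp [arr]) (by simp [arr])))) ?_
  · intro c hc
    simp only [Set.mem_iUnion, Set.mem_singleton_iff] at hc
    obtain ⟨i, j, d, rfl⟩ := hc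
    rfl
  · rintro h h' ⟨-, hT⟩ h0 h1 h2 h3 h8 i j d hd hd'
    -- A cell is identified by its upper bounds, which turns the set of relaxations into a
    -- conjunction of inequalities.
    refine eq_of_forall_ge_iff fun w => ?_
    rw [hT 12 [i, j, d] (by
      simp only [Set.mem_iUnion, Set.mem_singleton_iff]
      exact ⟨i, j, ⟨d, hd, hd'⟩, rfl⟩) (by decide)]
    simp only [relaxBound_iUnion, relaxBound_union, relaxBound_singleton]
    have e0 : ∀ i j : Fin n, h 0 [(i.val : ℤ), j.val] = N.matA 0 i j := by
      simp [h0, matrixArray_apply]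
    have e1 : ∀ i j : Fin n, h 1 [(i.val : ℤ), j.val] = N.matA 1 i j := by
      simp [h1, matrixArray_apply]
    have e2 : ∀ i j : Fin n, h 2 [(i.val : ℤ), j.val] = N.matB 0 i j := by
      simp [h2, matrixArray_apply]
    have e3 : ∀ i j : Fin n, h 3 [(i.val : ℤ), j.val] = N.matB 1 i j := by
      simp [h3, matrixArray_apply]
    simp only [e0, e1, e2, e3, h8, add_zero, true_and, List.cons.injEq, Nat.cast_inj, Fin.val_inj,
      and_true]
    obtain rfl | rfl | rfl : d = -1 ∨ d = 0 ∨ d = 1 := by omega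
    · simp [N.wt_neg_one, PTEG.matP, sharp]
    · simp [N.wt_zero, PTEG.matC, sharp, forall_and]
    · by_cases hij : i = j
      · subst hij
        simp [N.wt_one, PTEG.matI, mpOne]
      · simp [N.wt_one, PTEG.matI, mpOne, hij]

/-! ### The Diophantine test -/

theorem Spec.fillSym {env : List ℤ} {n d : ℕ} {c : Program} {C D : ℕ}
    {I : Set.Icc (-(n : ℤ)) n → Set Loc}
    (hd : env.length = d) (h1 : env[1]? = some 0) (h2 : env[2]? = some 1)
    (h5 : env[5]? = some (-(n : ℤ))) (h0 : env[0]? = some (n : ℤ))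
    (hc : ∀ t : Set.Icc (-(n : ℤ)) n, Spec (env ++ [(t : ℤ)]) n c C D (FillRel (I t))) :
    Spec env n (WeakConsistency.forLoop d 5 0 c) (2 * (C + 2) + 2) (1 + D) (FillRel (⋃ t, I t)) :=
  Spec.fillFor (LoopRange.icc (by omega)) hd h1 h2 h5 h0 (by simp; omega) hc

theorem Spec.relaxSym {env : List ℤ} {n d : ℕ} {c : Program} {C D : ℕ} {T : Set Loc}
    {E : Set.Icc (-(n : ℤ)) n → Set Relaxation}
    (hd : env.length = d) (h1 : env[1]? = some 0) (h2 : env[2]? = some 1)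
    (h5 : env[5]? = some (-(n : ℤ))) (h0 : env[0]? = some (n : ℤ))
    (hc : ∀ t : Set.Icc (-(n : ℤ)) n, Spec (env ++ [(t : ℤ)]) n c C D (RelaxRel T (E t))) :
    Spec env n (WeakConsistency.forLoop d 5 0 c) (2 * (C + 2) + 2) (1 + D)
      (RelaxRel T (⋃ t, E t)) :=
  Spec.relaxFor (LoopRange.icc (by omega)) hd h1 h2 h5 h0 (by simp; omega) hc

theorem Spec.fillNat {env : List ℤ} {n d : ℕ} {c : Program} {C D : ℕ}
    {I : Fin (n + 1) → Set Loc}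
    (hd : env.length = d) (h1 : env[1]? = some 0) (h2 : env[2]? = some 1)
    (h0 : env[0]? = some (n : ℤ))
    (hc : ∀ t : Fin (n + 1), Spec (env ++ [(t.val : ℤ)]) n c C D (FillRel (I t))) :
    Spec env n (WeakConsistency.forLoop d 1 0 c) (1 * (C + 2) + 2) (1 + D) (FillRel (⋃ t, I t)) :=
  Spec.fillFor (LoopRange.finSucc n) hd h1 h2 h1 h0 (by simp) hc

theorem Spec.relaxNat {env : List ℤ} {n d : ℕ} {c : Program} {C D : ℕ} {T : Set Loc}
    {E : Fin (n + 1) → Set Relaxation}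
    (hd : env.length = d) (h1 : env[1]? = some 0) (h2 : env[2]? = some 1)
    (h0 : env[0]? = some (n : ℤ))
    (hc : ∀ t : Fin (n + 1), Spec (env ++ [(t.val : ℤ)]) n c C D (RelaxRel T (E t))) :
    Spec env n (WeakConsistency.forLoop d 1 0 c) (1 * (C + 2) + 2) (1 + D)
      (RelaxRel T (⋃ t, E t)) :=
  Spec.relaxFor (LoopRange.finSucc n) hd h1 h2 h1 h0 (by simp) hc

/-- The array holds the numbers `S i t` for `|t| ≤ n`. -/
def IsShiftTable {n : ℕ} (S : Fin n → ℤ → EReal) (A : List ℤ → EReal) : Prop :=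
  ∀ (i : Fin n) (t : ℤ), -(n : ℤ) ≤ t → t ≤ n → A [(i.val : ℤ), t] = S i t

/-- The array holds the matrix `R`. -/
def IsMatrix {n : ℕ} (R : Matrix (Fin n) (Fin n) EReal) (A : List ℤ → EReal) : Prop :=
  ∀ i j : Fin n, A [(i.val : ℤ), (j.val : ℤ)] = R i j

open Classical in
/-- `0` where the matrix or its transpose is not `-∞`, and `-∞` elsewhere. -/
noncomputable def indicator {n : ℕ} (R : Matrix (Fin n) (Fin n) EReal) :
    Matrix (Fin n) (Fin n) EReal :=
  fun i j => if R i j = ⊥ ∧ R j i = ⊥ then ⊥ else 0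

/-- Array `13` becomes the indicator of the array `r`. -/
def indicatorTable (r : ℕ) : Program :=
  .seq (forLoop 10 1 4 (forLoop 11 1 4 (.realBot (13, [10, 11]))))
    (forLoop 10 1 4 (forLoop 11 1 4
      (.seq (relaxInd (13, [10, 11]) (r, [10, 11])) (relaxInd (13, [10, 11]) (r, [11, 10])))))

theorem spec_indicatorTable {n : ℕ} (a b c d : ℤ) {r : ℕ} (hr : r ≠ 13) (hr9 : r ≠ 9)
    (R : Matrix (Fin n) (Fin n) EReal) :
    Spec (baseEnv n a b c d) n (indicatorTable r) 100 2 fun h h' =>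
      IsMatrix R (h r) → IsMatrix (indicator R) (h' 13) := by
  unfold indicatorTable
  refine Spec.mono (Spec.table (T := arr 13) ?_
    (Spec.fillRows rfl rfl rfl rfl fun i => Spec.fillRows rfl rfl rfl rfl fun j =>
      Spec.fill (va := [i, j]) rfl)
    (Spec.relaxRows rfl rfl rfl rfl fun i => Spec.relaxRows rfl rfl rfl rfl fun j =>
      Spec.relaxSeq
        (Spec.relaxInd (va := [i, j]) (vb := [i, j]) rfl rfl rfl (by simpa [arr]) (hb9 := hr9))
        (Spec.relaxInd (va := [i, j]) (vb := [j, i]) rfl rfl rfl (by simpa [arr]) (hb9 := hr9)))) ?_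
  · intro c hc
    simp only [Set.mem_iUnion, Set.mem_singleton_iff] at hc
    obtain ⟨i, j, rfl⟩ := hc
    rfl
  · rintro h h' ⟨-, hT⟩ hR i j
    refine eq_of_forall_ge_iff fun w => ?_
    rw [hT 13 [i, j] (by
      simp only [Set.mem_iUnion, Set.mem_singleton_iff]
      exact ⟨i, j, rfl⟩) (by decide)]
    simp only [relaxBound_iUnion, relaxBound_union, relaxBound_singleton, hR _ _, true_and,
      List.cons.injEq, Nat.cast_inj, Fin.val_inj, and_true]
    by_cases h1 : R i j = ⊥ <;> by_cases h2 : R j i = ⊥ <;> simp [indicator, h1, h2, forall_and]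

/-- Array `14` becomes the table of the multiples `k • S i t` of the entries of the array `s`. -/
def multipleTable (s : ℕ) : Program :=
  .seq (.seq
      (forLoop 10 1 4 (forLoop 11 5 0 (forLoop 12 1 0 (.realBot (14, [10, 11, 12])))))
      (forLoop 10 1 4 (forLoop 11 5 0 (relaxAdd (14, [10, 11, 1]) (8, []) (8, [])))))
    (forLoop 10 2 0 (.seq (.intSub 11 10 2) (forLoop 12 1 4 (forLoop 13 5 0
      (relaxAdd (14, [12, 13, 10]) (14, [12, 13, 11]) (s, [12, 13]))))))

/-- The multiples below `m` have been entered. -/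
def IsMultipleTable {n : ℕ} (S : Fin n → ℤ → EReal) (m : ℤ) (A : List ℤ → EReal) : Prop :=
  ∀ (i : Fin n) (t : ℤ), -(n : ℤ) ≤ t → t ≤ n → ∀ k : ℕ, k ≤ n →
    ((k : ℤ) < m → A [(i.val : ℤ), t, (k : ℤ)] = k • S i t) ∧
    (m ≤ k → A [(i.val : ℤ), t, (k : ℤ)] = ⊥)

/-- The layer `k` is the layer `k - 1` plus `S`. The layer zero is constantly zero, in accordance
with `0 • ⊥ = 0`. -/
theorem spec_multipleTable {n : ℕ} (a b c d : ℤ) {s : ℕ} (hs : s ≠ 14) (hs9 : s ≠ 9)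
    (S : Fin n → ℤ → EReal) :
    Spec (baseEnv n a b c d) n (multipleTable s) 1000 3 fun h h' =>
      h 8 [] = 0 → IsShiftTable S (h s) → IsMultipleTable S (n + 1) (h' 14) := by
  unfold multipleTable
  refine Spec.mono (Spec.seq (Spec.table (T := arr 14) ?_
    (Spec.fillRows rfl rfl rfl rfl fun i => Spec.fillSym rfl rfl rfl rfl rfl fun t =>
      Spec.fillNat rfl rfl rfl rfl fun k => Spec.fill (va := [i, t, k]) rfl)
    (Spec.relaxRows rfl rfl rfl rfl fun i => Spec.relaxSym rfl rfl rfl rfl rfl fun t =>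
      Spec.relaxAdd (va := [i, t, 0]) (vb := []) (vc := []) rfl rfl rfl rfl
        (by simp [arr]) (by simp [arr])))
    (Spec.forInv (κ := 1) (e := 1) (C := 100) (D := 2)
      (J := fun m h => IsShiftTable S (h s) ∧ IsMultipleTable S m (h 14))
      (LoopRange.icc (a := 1) (b := n) (by omega)) rfl rfl rfl rfl rfl (by simp) fun m => ?body)) ?_
  case body =>
    -- Only the layer `m` counts as the target of the relaxations, so that reading the layer `m - 1`
    -- of the same array is admissible.
    refine Spec.mono (Spec.letSub (u := m) (v := 1) rfl rfl rfl
      (Spec.relaxRows rfl rfl rfl rfl fun i => Spec.relaxSym rfl rfl rfl rfl rfl fun t =>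
        Spec.relaxAdd (T := {c | c.1 = 14 ∧ c.2[2]? = some (m : ℤ)}) (va := [i, t, m])
          (vb := [i, t, m - 1]) (vc := [i, t]) rfl rfl rfl ⟨rfl, rfl⟩
          (by simp) (by simp [hs]) (hc9 := hs9))) ?_
    rintro h h' hR ⟨hS, hM⟩
    obtain ⟨m, hm1, hmn⟩ := m
    obtain ⟨m, rfl⟩ : ∃ q : ℕ, m = (q : ℤ) + 1 := ⟨(m - 1).toNat, by omega⟩
    simp only at hR hM ⊢
    refine ⟨fun i t ht ht' => ?_, fun i t ht ht' k hk => ?_⟩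
    · rw [← hR.agree s _ (by simp [hs]) hs9]
      exact hS i t ht ht'
    · by_cases hkm : k = m + 1
      · subst hkm
        refine ⟨fun _ => ?_, fun h => by push_cast at h; omega⟩
        refine eq_of_forall_ge_iff fun w => ?_
        rw [hR.le_iff_bound (by simp) (by decide), (hM i t ht ht' (m + 1) hk).2 (by simp)]
        simp only [relaxBound_iUnion, relaxBound_singleton]
        have e1 := (hM i t ht ht' m (by omega)).1 (by omega)
        have e2 := hS i t ht ht'
        constructor
        · rintro ⟨-, h3⟩
          have := h3 i ⟨t, ht, ht'⟩ (by simp)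
          simpa [e1, e2, succ_nsmul] using this
        · rintro h3
          refine ⟨bot_le, ?_⟩
          rintro i' ⟨t', h4⟩ ⟨-, h5⟩
          simp only [List.cons.injEq, Nat.cast_inj, Fin.val_inj] at h5
          obtain ⟨rfl, rfl, -⟩ := h5
          simpa [e1, e2, succ_nsmul] using h3
      · rw [← hR.agree 14 _ (by simp; omega) (by decide)]
        have := hM i t ht ht' k hk
        exact ⟨fun h => this.1 (by omega), fun h => this.2 (by omega)⟩
  · intro c hc
    simp only [Set.mem_iUnion, Set.mem_singleton_iff] at hc
    obtain ⟨i, t, k, rfl⟩ := hc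
    rfl
  · rintro h h'' ⟨h', ⟨hag, hT⟩, hJ⟩ h8 hS
    refine (hJ ⟨fun i t ht ht' => ?_, fun i t ht ht' k hk => ?_⟩).2
    · rw [← hag s _ (by simpa [arr]) hs9]
      exact hS i t ht ht'
    · have key : ∀ w, h' 14 [(i.val : ℤ), t, (k : ℤ)] ≤ w ↔ (k = 0 → 0 ≤ w) := by
        intro w
        rw [hT 14 _ (by
          simp only [Set.mem_iUnion, Set.mem_singleton_iff]
          exact ⟨i, ⟨t, ht, ht'⟩, ⟨k, by omega⟩, rfl⟩) (by decide)]
        simp only [relaxBound_iUnion, relaxBound_singleton, h8]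
        constructor
        · rintro h3 rfl
          simpa using h3 i ⟨t, ht, ht'⟩ (by simp)
        · rintro h3 i' t' ⟨-, h5⟩
          simp only [List.cons.injEq] at h5
          simpa using h3 (by omega)
      constructor
      · intro hk0
        obtain rfl : k = 0 := by omega
        exact eq_of_forall_ge_iff fun w => by rw [key]; simp
      · intro hk1
        exact le_bot_iff.1 ((key ⊥).2 (by omega))

/-- No combination of two shifts violates the test. -/
def DioBound {n : ℕ} (S : Fin n → ℤ → EReal) (R : Matrix (Fin n) (Fin n) EReal) : Prop :=
  ∀ i j, (R i j ≠ ⊥ ∨ R j i ≠ ⊥) → ∀ t k : ℕ, t ≤ n → k ≤ n →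
    k • S i t + t • S j (-k) ≤ 0

/-- The location `16` is relaxed with the values of the combinations of two shifts. -/
def combine : Program :=
  .seq (.seq
      (forLoop 10 1 4 (forLoop 11 1 4 (forLoop 12 1 0 (forLoop 13 1 0
        (.realBot (15, [10, 11, 12, 13]))))))
      (forLoop 10 1 4 (forLoop 11 1 4 (forLoop 12 1 0 (forLoop 13 1 0
        (relaxAdd (15, [10, 11, 12, 13]) (14, [10, 12, 13]) (13, [10, 11])))))))
    (forLoop 10 1 4 (forLoop 11 1 4 (forLoop 12 1 0 (forLoop 13 1 0
      (.seq (.intSub 14 1 13)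
        (relaxAdd (16, []) (15, [10, 11, 12, 13]) (14, [11, 14, 12])))))))

/-- Adding the indicator, zero or `-∞`, makes the bound void for pairs of rows that are not to be
tested. Array `15` is needed because a relaxation adds only two cells. -/
theorem spec_combine {n : ℕ} (a b c d : ℤ) (S : Fin n → ℤ → EReal)
    (R : Matrix (Fin n) (Fin n) EReal) :
    Spec (baseEnv n a b c d) n combine 1000 4 fun h h' =>
      IsMatrix (indicator R) (h 13) → IsMultipleTable S (n + 1) (h 14) →
      (h' 16 [] ≤ 0 ↔ h 16 [] ≤ 0 ∧ DioBound S R) := by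
  unfold combine
  refine Spec.mono (Spec.seq (Spec.table (T := arr 15) ?_
    (Spec.fillRows rfl rfl rfl rfl fun i => Spec.fillRows rfl rfl rfl rfl fun j =>
      Spec.fillNat rfl rfl rfl rfl fun t => Spec.fillNat rfl rfl rfl rfl fun k =>
      Spec.fill (va := [i, j, t, k]) rfl)
    (Spec.relaxRows rfl rfl rfl rfl fun i => Spec.relaxRows rfl rfl rfl rfl fun j =>
      Spec.relaxNat rfl rfl rfl rfl fun t => Spec.relaxNat rfl rfl rfl rfl fun k =>
      Spec.relaxAdd (va := [i, j, t, k]) (vb := [i, t, k]) (vc := [i, j]) rfl rfl rfl rfl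
        (by simp [arr]) (by simp [arr])))
    (Spec.relaxRows rfl rfl rfl rfl fun i => Spec.relaxRows rfl rfl rfl rfl fun j =>
      Spec.relaxNat rfl rfl rfl rfl fun t => Spec.relaxNat rfl rfl rfl rfl fun k =>
      Spec.letSub (u := 0) (v := k) rfl rfl rfl
      (Spec.relaxAdd (T := arr 16) (va := []) (vb := [i, j, t, k]) (vc := [j, 0 - k, t])
        rfl rfl rfl rfl (by simp [arr]) (by simp [arr])))) ?_
  · intro c hc
    simp only [Set.mem_iUnion, Set.mem_singleton_iff] at hc
    obtain ⟨i, j, t, k, rfl⟩ := hc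
    rfl
  · rintro h h'' ⟨h', ⟨hag, hT⟩, hR⟩ hI hM
    have e14 : ∀ l, h' 14 l = h 14 l := fun l => (hag 14 l (by simp [arr]) (by decide)).symm
    have e16 : h' 16 [] = h 16 [] := (hag 16 [] (by simp [arr]) (by decide)).symm
    have e15 : ∀ (i j : Fin n) (t k : Fin (n + 1)),
        h' 15 [(i.val : ℤ), (j.val : ℤ), (t.val : ℤ), (k.val : ℤ)] =
          k.val • S i t.val + indicator R i j := by
      intro i j t k
      refine eq_of_forall_ge_iff fun w => ?_
      rw [hT 15 _ (by
        simp only [Set.mem_iUnion, Set.mem_singleton_iff]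
        exact ⟨i, j, t, k, rfl⟩) (by decide)]
      simp only [relaxBound_iUnion, relaxBound_singleton, true_and, List.cons.injEq,
        Nat.cast_inj, Fin.val_inj, and_true]
      have e := (hM i t.val (by omega) (by omega) k.val (by omega)).1 (by omega)
      constructor
      · intro h3
        simpa [e, hI i j] using h3 i j t k ⟨rfl, rfl, rfl, rfl⟩
      · rintro h3 i' j' t' k' ⟨rfl, rfl, rfl, rfl⟩
        simpa [e, hI i' j'] using h3
    rw [hR.le_iff_bound rfl (by decide), e16]
    refine and_congr_right fun _ => ?_
    simp only [relaxBound_iUnion, relaxBound_singleton, and_self, forall_const, e15, e14, zero_sub]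
    have e : ∀ (j : Fin n) (t k : Fin (n + 1)),
        h 14 [(j.val : ℤ), -(k.val : ℤ), (t.val : ℤ)] = t.val • S j (-(k.val : ℤ)) :=
      fun j t k => (hM j _ (by omega) (by omega) t.val (by omega)).1 (by omega)
    simp only [e]
    constructor
    · intro h3 i j hij t k ht hk
      have := h3 i j ⟨t, by omega⟩ ⟨k, by omega⟩
      rw [indicator, if_neg (by tauto), add_zero] at this
      exact this
    · intro h3 i j t k
      by_cases hij : R i j = ⊥ ∧ R j i = ⊥
      · simp [indicator, hij]
      · rw [indicator, if_neg hij, add_zero]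
        exact h3 i j (by tauto) t.val k.val (by omega) (by omega)

/-- The Diophantine test for the array `s` of shifts and the array `r`. -/
def dioTest (s r : ℕ) : Program := .seq (indicatorTable r) (.seq (multipleTable s) combine)

theorem spec_dioTest {n : ℕ} (a b c d : ℤ) {s r : ℕ} (hs : s ∉ (indicatorTable r).writes)
    (hs14 : s ≠ 14) (hs9 : s ≠ 9) (hr : r ≠ 13) (hr9 : r ≠ 9)
    (S : Fin n → ℤ → EReal) (R : Matrix (Fin n) (Fin n) EReal) :
    Spec (baseEnv n a b c d) n (dioTest s r) 3000 4 fun h h' =>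
      h 8 [] = 0 → IsShiftTable S (h s) → IsMatrix R (h r) →
      (h' 16 [] ≤ 0 ↔ h 16 [] ≤ 0 ∧ DioBound S R) := by
  refine Spec.mono (Spec.seq (spec_indicatorTable a b c d hr hr9 R).frame
    (Spec.seq (spec_multipleTable a b c d hs14 hs9 S).frame (spec_combine a b c d S R))) ?_
  rintro h h3 ⟨h1, ⟨f1, k1⟩, h2, ⟨f2, k2⟩, k3⟩ h8 hS hR
  have g1 := k1 hR
  rw [← f2 13 (by simp [multipleTable, forLoop, relaxAdd, relaxWith, Program.writes])] at g1
  have e16 : h2 16 = h 16 := by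
    rw [f2 16 (by simp [multipleTable, forLoop, relaxAdd, relaxWith, Program.writes]),
      f1 16 (by simp [indicatorTable, forLoop, relaxInd, relaxWith, Program.writes])]
  rw [← e16]
  refine k3 g1 (k2 ?_ ?_)
  · rw [f1 8 (by simp [indicatorTable, forLoop, relaxInd, relaxWith, Program.writes])]
    exact h8
  · rw [f1 s hs]
    exact hS

/-! ### The Diophantine systems and the test -/

/-- No pair of rows has a solvable Diophantine system. -/
def ShiftAccepts {n : ℕ} (S : Fin n → ℤ → EReal) (R : Matrix (Fin n) (Fin n) EReal) : Prop :=
  ∀ i j, R i j ≠ ⊥ → ∀ (t : ℤ) (w : ℝ), S i t = w → ∀ (t' : ℤ) (w' : ℝ), S j t' = w' →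
    ¬ DiophantineSolvable (t, w) (t', w')

theorem DiophantineSolvable.symm {q q' : ℤ × ℝ} (h : DiophantineSolvable q q') :
    DiophantineSolvable q' q := by
  obtain ⟨y, y', h0, hp⟩ := h
  exact ⟨y', y, by rw [add_comm]; exact h0, by rw [add_comm]; exact hp⟩

theorem succ_nsmul_bot (k : ℕ) : (k + 1) • (⊥ : EReal) = ⊥ := by
  rw [succ_nsmul, EReal.add_bot]

theorem nsmul_coe (k : ℕ) (w : ℝ) : k • (w : EReal) = ((k * w : ℝ) : EReal) := by
  rw [← EReal.coe_nsmul, nsmul_eq_mul]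

theorem dioBound_iff {n : ℕ} {S : Fin n → ℤ → EReal} {R : Matrix (Fin n) (Fin n) EReal}
    (htop : ∀ i t, S i t ≠ ⊤) (hsupp : ∀ i t, S i t ≠ ⊥ → -(n : ℤ) ≤ t ∧ t ≤ n)
    (hdiag : ∀ i, S i 0 ≠ ⊥ → R i i ≠ ⊥) : DioBound S R ↔ ShiftAccepts S R := by
  have hcases : ∀ i t, S i t = ⊥ ∨ ∃ w : ℝ, S i t = w := fun i t => by
    by_cases h : S i t = ⊥
    · exact .inl h
    · exact .inr ⟨_, (EReal.coe_toReal (htop i t) h).symm⟩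
  constructor
  · intro h
    have hn : ∀ i : Fin n, 1 ≤ n := fun i => by have := i.isLt; omega
    have hfst : ∀ i j, (R i j ≠ ⊥ ∨ R j i ≠ ⊥) → ∀ w : ℝ, S i 0 = w → w ≤ 0 := by
      intro i j hij w hw
      -- Zero times any entry of `S`, even `⊥`, is zero; only the weight of shift zero remains.
      have := h i j hij 0 1 (by omega) (hn i)
      simpa [hw] using this
    have hsnd : ∀ i j, (R i j ≠ ⊥ ∨ R j i ≠ ⊥) → ∀ w : ℝ, S j 0 = w → w ≤ 0 := by
      intro i j hij w hw
      have := h i j hij 1 0 (hn i) (by omega)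
      simpa [hw] using this
    have core : ∀ i j, (R i j ≠ ⊥ ∨ R j i ≠ ⊥) → ∀ (t : ℤ) (w : ℝ), S i t = w →
        ∀ (t' : ℤ) (w' : ℝ), S j t' = w' → 0 ≤ t → ¬ DiophantineSolvable (t, w) (t', w') := by
      rintro i j hij t w hw t' w' hw' ht ⟨y, y', h0, hp⟩
      simp only at h0 hp
      have hy : (0 : ℝ) ≤ y := Nat.cast_nonneg y
      have hy' : (0 : ℝ) ≤ y' := Nat.cast_nonneg y'
      have hz : t' = 0 → (y' : ℝ) * w' ≤ 0 := by
        rintro rfl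
        exact mul_nonpos_of_nonneg_of_nonpos hy' (hsnd i j hij w' hw')
      rcases ht.eq_or_lt with rfl | ht
      · have h1 : (y : ℝ) * w ≤ 0 := mul_nonpos_of_nonneg_of_nonpos hy (hfst i j hij w hw)
        have h2 : (y' : ℤ) * t' = 0 := by simpa using h0
        rcases mul_eq_zero.1 h2 with h3 | h3
        · have : (y' : ℝ) = 0 := by exact_mod_cast h3
          rw [this] at hp
          linarith
        · linarith [hz h3]
      · rcases lt_trichotomy t' 0 with ht' | ht' | ht'
        · obtain ⟨t, rfl⟩ : ∃ k : ℕ, t = k := ⟨t.toNat, by omega⟩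
          obtain ⟨k, rfl⟩ : ∃ k : ℕ, t' = -(k : ℤ) := ⟨(-t').toNat, by omega⟩
          have b1 := hsupp i t (by simp [hw])
          have b2 := hsupp j (-k) (by simp [hw'])
          have := h i j hij t k (by omega) (by omega)
          rw [hw, hw', nsmul_coe, nsmul_coe, ← EReal.coe_add] at this
          have h1 : (k : ℝ) * w + t * w' ≤ 0 := by exact_mod_cast this
          have h2 : (y : ℝ) * t = y' * k := by
            have : (y : ℤ) * t = y' * k := by linarith
            exact_mod_cast this
          have ht0 : (0 : ℝ) < t := by exact_mod_cast ht
          -- Multiplication by `t` and `y * t = y' * k` turn the combination into a nonnegative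
          -- multiple of the tested one.
          have h3 : (t : ℝ) * (y * w + y' * w') = y' * (k * w + t * w') := by
            linear_combination w * h2
          have h4 : (y' : ℝ) * (k * w + t * w') ≤ 0 := mul_nonpos_of_nonneg_of_nonpos hy' h1
          nlinarith
        · subst ht'
          have h2 : (y : ℤ) = 0 := by
            rcases mul_eq_zero.1 (show (y : ℤ) * t = 0 by simpa using h0) with h3 | h3
            · exact h3
            · omega
          have h3 : (y : ℝ) = 0 := by exact_mod_cast h2
          rw [h3] at hp
          linarith [hz rfl]
        · have h1 : 0 ≤ (y : ℤ) * t := by positivity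
          have h2 : 0 ≤ (y' : ℤ) * t' := by positivity
          have h3 : (y : ℤ) = 0 := by
            rcases mul_eq_zero.1 (show (y : ℤ) * t = 0 by omega) with h | h <;> omega
          have h4 : (y' : ℤ) = 0 := by
            rcases mul_eq_zero.1 (show (y' : ℤ) * t' = 0 by omega) with h | h <;> omega
          have h5 : (y : ℝ) = 0 := by exact_mod_cast h3
          have h6 : (y' : ℝ) = 0 := by exact_mod_cast h4
          simp [h5, h6] at hp
    intro i j hij t w hw t' w' hw' hD
    -- `DioBound` covers first shifts that are nonnegative; otherwise the pair is swapped, which is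
    -- allowed since either of `R i j` and `R j i` suffices. Two negative shifts force both
    -- multipliers to vanish.
    rcases le_or_gt 0 t with ht | ht
    · exact core i j (.inl hij) t w hw t' w' hw' ht hD
    rcases le_or_gt 0 t' with ht' | ht'
    · exact core j i (.inr hij) t' w' hw' t w hw ht' hD.symm
    obtain ⟨y, y', h0, hp⟩ := hD
    simp only at h0 hp
    have h3 : (y : ℤ) = 0 := by nlinarith [Int.natCast_nonneg y, Int.natCast_nonneg y']
    have h4 : (y' : ℤ) = 0 := by nlinarith [Int.natCast_nonneg y, Int.natCast_nonneg y']
    have h5 : (y : ℝ) = 0 := by exact_mod_cast h3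
    have h6 : (y' : ℝ) = 0 := by exact_mod_cast h4
    simp [h5, h6] at hp
  · intro h i j hij t k ht hk
    have h' : ∀ (t : ℤ) (w : ℝ), S i t = w → ∀ (t' : ℤ) (w' : ℝ), S j t' = w' →
        ¬ DiophantineSolvable (t, w) (t', w') := by
      intro t w hw t' w' hw' hD
      rcases hij with hij | hij
      · exact h i j hij t w hw t' w' hw' hD
      · exact h j i hij t' w' hw' t w hw hD.symm
    -- With a zero multiplier the other summand vanishes even if its entry is `⊥`, so this bound is
    -- needed without reference to a partner row.
    have hz : ∀ (i : Fin n) (m : ℕ), m • S i 0 ≤ 0 := by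
      intro i m
      rcases hcases i 0 with e | ⟨w, e⟩
      · rw [e]
        rcases m with _ | m
        · simp
        · rw [succ_nsmul_bot]; exact bot_le
      · rw [e, nsmul_coe]
        have : w ≤ 0 := by
          by_contra hcon
          exact h i i (hdiag i (by simp [e])) 0 w e 0 w e ⟨1, 0, by simp, by simpa using hcon⟩
        have hm : (0 : ℝ) ≤ m := Nat.cast_nonneg m
        exact_mod_cast mul_nonpos_of_nonneg_of_nonpos hm this
    rcases t with _ | t
    · simpa using hz i k
    rcases k with _ | k
    · simpa using hz j (t + 1)
    rcases hcases i ((t + 1 : ℕ) : ℤ) with e | ⟨w, e⟩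
    · rw [e, succ_nsmul_bot]; simp
    rcases hcases j (-((k + 1 : ℕ) : ℤ)) with e' | ⟨w', e'⟩
    · rw [e', succ_nsmul_bot]; simp
    rw [e, e', nsmul_coe, nsmul_coe, ← EReal.coe_add]
    by_contra hcon
    refine h' _ w e _ w' e' ⟨k + 1, t + 1, by push_cast; ring, ?_⟩
    have : ¬ (((k + 1 : ℕ) : ℝ) * w + ((t + 1 : ℕ) : ℝ) * w' ≤ 0) := by exact_mod_cast hcon
    push Not at this
    exact this

/-! ### Auxiliary integers -/

/-- Unlike in `Spec.letOp`, the value is computed by a whole program, which may use further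
registers beyond `env` as long as the arrays are left alone. -/
theorem Spec.letProg {env : List ℤ} {n : ℕ} {b c : Program} {C₀ D₀ C D : ℕ}
    {R : Heap → Heap → Prop} {v : ℤ}
    (hb : ∀ σ, Matches env σ.int → ∃ t τ, Runs b σ t τ ∧ t ≤ C₀ * (n + 1) ^ D₀ ∧
      Matches (env ++ [v]) τ.int ∧ τ.real = σ.real)
    (h : Spec (env ++ [v]) n c C D R) : Spec env n (.seq b c) (C₀ + C) (max D₀ D) R := by
  intro σ hσ
  obtain ⟨t, τ, hr, ht, hm, hreal⟩ := hb σ hσ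
  obtain ⟨t', τ', hr', ht', hm', hR⟩ := h τ hm
  refine ⟨t + t', τ', .seq hr hr', ?_, hm'.of_snoc, hreal ▸ hR⟩
  rw [add_mul]
  refine Nat.add_le_add (ht.trans ?_) (ht'.trans ?_) <;>
    exact Nat.mul_le_mul_left _ (Nat.pow_le_pow_right (by omega) (by simp))

theorem Matches.update_last_but_one {env : List ℤ} {ρ : ℕ → ℤ} {a b : ℤ}
    (h : Matches (env ++ [a] ++ [b]) ρ) {d : ℕ} (hd : env.length = d) (v : ℤ) :
    Matches (env ++ [v] ++ [b]) (Function.update ρ d v) := by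
  subst hd
  intro i u hi
  have h' := h i
  rcases lt_trichotomy i env.length with hl | rfl | hl
  · rw [Function.update_of_ne hl.ne]
    refine h' u ?_
    rw [List.append_assoc, List.getElem?_append_left hl] at hi ⊢
    exact hi
  · simp at hi
    simp [hi]
  · rw [Function.update_of_ne hl.ne']
    refine h' u ?_
    rw [List.getElem?_append_right (by simp; omega)] at hi ⊢
    simpa using hi

/-- A loop that updates two integer registers. -/
theorem runs_countLoop {env : List ℤ} {d hi K s : ℕ} {B : ℤ} {f g : ℕ → ℤ} {body : Program}
    (hd : env.length = d) (hhi : env[hi]? = some B) (hg : ∀ k, g k ≤ B ↔ k < K)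
    (hb : ∀ k σ, Matches (env ++ [f k] ++ [g k]) σ.int → ∃ τ, Runs body σ s τ ∧
      Matches (env ++ [f (k + 1)] ++ [g (k + 1)]) τ.int ∧ τ.real = σ.real)
    (σ : Memory) (hσ : Matches (env ++ [f 0] ++ [g 0]) σ.int) :
    ∃ t τ, Runs (.loop (.intLe (d + 1) hi) body) σ t τ ∧ t ≤ K * (s + 1) + 1 ∧
      Matches (env ++ [f K]) τ.int ∧ τ.real = σ.real := by
  have key : ∀ r k σ, k + r = K → Matches (env ++ [f k] ++ [g k]) σ.int →
      ∃ t τ, Runs (.loop (.intLe (d + 1) hi) body) σ t τ ∧ t ≤ r * (s + 1) + 1 ∧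
        Matches (env ++ [f K]) τ.int ∧ τ.real = σ.real := by
    intro r
    induction r with
    | zero =>
      rintro k σ rfl hσ
      refine ⟨1, σ, .loopDone ?_, by simp, hσ.of_snoc, rfl⟩
      simp only [Test.Holds, hσ.last (d := d + 1) (by simp [hd]), hσ.of_snoc.of_snoc hi B hhi, hg]
      omega
    | succ r ih =>
      rintro k σ hk hσ
      obtain ⟨τ, hr, hm, hreal⟩ := hb k σ hσ
      obtain ⟨t, υ, hr', ht, hm', hreal'⟩ := ih (k + 1) τ (by omega) hm
      refine ⟨s + t + 1, υ, .loopStep ?_ hr hr', by rw [add_mul, one_mul]; omega, hm',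
        hreal'.trans hreal⟩
      simp only [Test.Holds, hσ.last (d := d + 1) (by simp [hd]), hσ.of_snoc.of_snoc hi B hhi, hg]
      omega
  exact key K 0 σ (by simp) hσ

/-- Register `d` receives the square of register `0`. -/
def square (d : ℕ) : Program :=
  .seq (.intConst d 0) (.seq (.intConst (d + 1) 0)
    (.loop (.intLe (d + 1) 4) (.seq (.intAdd d d 0) (.intAdd (d + 1) (d + 1) 2))))

/-- Register `d` receives the half of the register `s`. -/
def half (d s : ℕ) : Program :=
  .seq (.intConst d 0) (.seq (.intConst (d + 1) 2)
    (.loop (.intLe (d + 1) s)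
      (.seq (.intAdd d d 2) (.seq (.intAdd (d + 1) (d + 1) 2) (.intAdd (d + 1) (d + 1) 2)))))

theorem Spec.letSquare {env : List ℤ} {n d : ℕ} {c : Program} {C D : ℕ} {R : Heap → Heap → Prop}
    (hd : env.length = d) (h0 : env[0]? = some (n : ℤ)) (h2 : env[2]? = some 1)
    (h4 : env[4]? = some ((n : ℤ) - 1))
    (h : Spec (env ++ [((n ^ 2 : ℕ) : ℤ)]) n c C D R) :
    Spec env n (.seq (square d) c) (3 + C) (max 1 D) R := by
  refine Spec.letProg (fun σ hσ => ?_) h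
  have hs := (hσ.snoc hd 0).snoc (d := d + 1) (by simp [hd]) 0
  have hb : ∀ (k : ℕ) (σ : Memory), Matches (env ++ [(k : ℤ) * n] ++ [(k : ℤ)]) σ.int →
      ∃ τ, Runs (.seq (.intAdd d d 0) (.intAdd (d + 1) (d + 1) 2)) σ 2 τ ∧
        Matches (env ++ [((k + 1 : ℕ) : ℤ) * n] ++ [((k + 1 : ℕ) : ℤ)]) τ.int ∧
        τ.real = σ.real := by
    intro k σ hσ
    refine ⟨_, .seq (.intAdd _ _ _ _) (.intAdd _ _ _ _), ?_, rfl⟩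
    have e0 : σ.int 0 = n := hσ.of_snoc.of_snoc 0 _ h0
    have e2 : σ.int 2 = 1 := hσ.of_snoc.of_snoc 2 _ h2
    have ed : σ.int d = k * n := hσ.of_snoc.last hd
    have ed' : σ.int (d + 1) = k := hσ.last (by simp [hd])
    have hd2 : 2 < d := by
      rw [← hd]
      exact (List.getElem?_eq_some_iff.1 h2).1
    have h1 := hσ.update_last_but_one hd (((k + 1 : ℕ) : ℤ) * n)
    have h3 := h1.of_snoc.snoc (d := d + 1) (by simp [hd]) ((k + 1 : ℕ) : ℤ)
    simp only [Memory.setInt]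
    rw [Function.update_of_ne (show 2 ≠ d by omega), Function.update_of_ne (show d + 1 ≠ d by omega),
      e0, e2, ed, ed']
    convert h3 using 3 <;> (push_cast; ring_nf)
  -- Register `4` holds `n - 1`, so the counter `0, 1, …` passes the test exactly `n` times.
  obtain ⟨t, τ, hr, ht, hm, hreal⟩ := runs_countLoop (K := n) (s := 2) (f := fun k => (k : ℤ) * n)
    (g := fun k => (k : ℤ)) (body := .seq (.intAdd d d 0) (.intAdd (d + 1) (d + 1) 2)) hd h4
    (fun k => by omega) hb ((σ.setInt d 0).setInt (d + 1) 0) (by simpa [Memory.setInt] using hs)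
  refine ⟨1 + (1 + t), τ, .seq (.intConst _ _ _) (.seq (.intConst _ _ _) hr),
      by rw [pow_one]; omega, ?_, hreal⟩
  rw [sq]
  exact_mod_cast hm

theorem Spec.letHalf {env : List ℤ} {n N d s : ℕ} {c : Program} {C D : ℕ}
    {R : Heap → Heap → Prop} (hd : env.length = d) (h2 : env[2]? = some 1)
    (hs : env[s]? = some (N : ℤ)) (hN : N ≤ (n + 1) ^ 2)
    (h : Spec (env ++ [((N / 2 : ℕ) : ℤ)]) n c C D R) :
    Spec env n (.seq (half d s) c) (10 + C) (max 2 D) R := by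
  refine Spec.letProg (fun σ hσ => ?_) h
  have hs' := (hσ.snoc hd 0).snoc (d := d + 1) (by simp [hd]) 2
  have hb : ∀ (k : ℕ) (σ : Memory), Matches (env ++ [(k : ℤ)] ++ [2 * (k : ℤ) + 2]) σ.int →
      ∃ τ, Runs (.seq (.intAdd d d 2) (.seq (.intAdd (d + 1) (d + 1) 2)
          (.intAdd (d + 1) (d + 1) 2))) σ 3 τ ∧
        Matches (env ++ [((k + 1 : ℕ) : ℤ)] ++ [2 * ((k + 1 : ℕ) : ℤ) + 2]) τ.int ∧
        τ.real = σ.real := by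
    intro k σ hσ
    refine ⟨_, .seq (.intAdd _ _ _ _) (.seq (.intAdd _ _ _ _) (.intAdd _ _ _ _)), ?_, rfl⟩
    have e2 : σ.int 2 = 1 := hσ.of_snoc.of_snoc 2 _ h2
    have ed : σ.int d = k := hσ.of_snoc.last hd
    have ed' : σ.int (d + 1) = 2 * k + 2 := hσ.last (by simp [hd])
    have hd2 : 2 < d := by
      rw [← hd]
      exact (List.getElem?_eq_some_iff.1 h2).1
    have h1 := hσ.update_last_but_one hd (k + 1)
    have h3 := h1.of_snoc.snoc (d := d + 1) (by simp [hd]) (2 * ((k + 1 : ℕ) : ℤ) + 2)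
    simp only [Memory.setInt]
    rw [Function.update_of_ne (show 2 ≠ d + 1 by omega), Function.update_self,
      Function.update_of_ne (show 2 ≠ d by omega), Function.update_of_ne (show d + 1 ≠ d by omega),
      Function.update_idem, e2, ed, ed']
    convert h3 using 2 <;> (push_cast; ring_nf)
  -- The counter runs through `2, 4, 6, …`, and `2 * k + 2 ≤ N` holds exactly for `k < N / 2`.
  obtain ⟨t, τ, hr, ht, hm, hreal⟩ := runs_countLoop (K := N / 2) (s := 3)
    (f := fun k => (k : ℤ)) (g := fun k => 2 * (k : ℤ) + 2)
    (body := .seq (.intAdd d d 2) (.seq (.intAdd (d + 1) (d + 1) 2) (.intAdd (d + 1) (d + 1) 2)))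
    hd hs (fun k => by omega) hb ((σ.setInt d 0).setInt (d + 1) 2)
    (by simpa [Memory.setInt] using hs')
  have : 1 ≤ (n + 1) ^ 2 := Nat.one_le_pow _ _ (by omega)
  exact ⟨1 + (1 + t), τ, .seq (.intConst _ _ _) (.seq (.intConst _ _ _) hr), by omega, hm, hreal⟩

/-! ### The table of the maximum weights of walks -/

/-- The registers of the first program. -/
abbrev walkEnv (n : ℕ) : List ℤ :=
  baseEnv n ((n ^ 2 : ℕ) : ℤ) (((n ^ 2 : ℕ) : ℤ) + 1) (-(((n ^ 2 : ℕ) : ℤ) + 1)) (-((n ^ 2 : ℕ) : ℤ))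

/-- Array `18` becomes the table of the maximum weights of the walks of length at most `n ^ 2`. -/
def walkTable : Program :=
  .seq (.seq
      (forLoop 10 1 4 (forLoop 11 1 6 (forLoop 12 1 4 (forLoop 13 8 7
        (.realBot (18, [10, 11, 12, 13]))))))
      (forLoop 10 1 4 (relaxAdd (18, [10, 1, 10, 1]) (8, []) (8, []))))
    (forLoop 10 2 6 (.seq (.intSub 11 10 2)
      (forLoop 12 1 4 (forLoop 13 1 4 (forLoop 14 1 4 (forLoop 15 9 6 (forLoop 16 3 2
        (.seq (.intSub 17 15 16)
          (relaxAdd (18, [12, 10, 13, 15]) (18, [12, 11, 14, 17]) (12, [13, 14, 16]))))))))))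

/-- The maximum weights of the walks of length less than `k` have been entered. -/
def IsWalkTable {n : ℕ} (W : Fin n → Fin n → ℤ → EReal) (k : ℤ) (A : List ℤ → EReal) : Prop :=
  ∀ (i m : Fin n) (l : ℕ), l ≤ n ^ 2 → ∀ z : ℤ, -(((n ^ 2 : ℕ) : ℤ) + 1) ≤ z →
    z ≤ ((n ^ 2 : ℕ) : ℤ) + 1 →
    ((l : ℤ) < k → A [(i.val : ℤ), (l : ℤ), (m.val : ℤ), z] = walkMax W i l m z) ∧
    (k ≤ l → A [(i.val : ℤ), (l : ℤ), (m.val : ℤ), z] = ⊥)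

/-- The table has one spare column on each side of `|z| ≤ n ^ 2`, so that `z - d` is always a valid
index. The spare columns stay at `-∞`, which is correct because shifts do not exceed lengths. -/
theorem IsWalkTable.step {n : ℕ} {W : Fin n → Fin n → ℤ → EReal} (hW : RegularArcs W) {q : ℕ}
    {A A' : List ℤ → EReal} (hq : q + 1 ≤ n ^ 2) (hA : IsWalkTable W ((q : ℤ) + 1) A)
    (hoff : ∀ r : List ℤ, r[1]? ≠ some ((q : ℤ) + 1) → A' r = A r)
    (hon : ∀ (i m : Fin n) (z : ℤ), -(((n ^ 2 : ℕ) : ℤ) + 1) ≤ z → z ≤ ((n ^ 2 : ℕ) : ℤ) + 1 →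
      ∀ w, A' [(i.val : ℤ), (q : ℤ) + 1, (m.val : ℤ), z] ≤ w ↔
        A [(i.val : ℤ), (q : ℤ) + 1, (m.val : ℤ), z] ≤ w ∧
        (-((n ^ 2 : ℕ) : ℤ) ≤ z → z ≤ ((n ^ 2 : ℕ) : ℤ) → ∀ (m' : Fin n) (d : Set.Icc (-1 : ℤ) 1),
          A [(i.val : ℤ), (q : ℤ), (m'.val : ℤ), z - d] + W m m' d ≤ w)) :
    IsWalkTable W ((q : ℤ) + 1 + 1) A' := by
  intro i m l hl z hz hz'
  by_cases hlq : l = q + 1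
  · subst hlq
    refine ⟨fun _ => ?_, fun h => by push_cast at h; omega⟩
    have h0 := (hA i m (q + 1) hl z hz hz').2 (by push_cast; omega)
    push_cast at h0 ⊢
    refine eq_of_forall_ge_iff fun w => ?_
    rw [hon i m z hz hz', h0]
    simp only [bot_le, true_and]
    by_cases hzN : -((n ^ 2 : ℕ) : ℤ) ≤ z ∧ z ≤ ((n ^ 2 : ℕ) : ℤ)
    · simp only [walkMax, iSup_le_iff, Prod.forall]
      have e : ∀ (m' : Fin n) (d : Set.Icc (-1 : ℤ) 1),
          A [(i.val : ℤ), (q : ℤ), (m'.val : ℤ), z - d] = walkMax W i q m' (z - d) := fun m' d =>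
        (hA i m' q (by omega) (z - d) (by have := d.2.2; omega) (by have := d.2.1; omega)).1
          (by omega)
      simp only [e, hzN.1, hzN.2, forall_const]
    · rw [walkMax_eq_bot hW (by omega)]
      simp only [bot_le, iff_true]
      exact fun h1 h2 => absurd ⟨h1, h2⟩ hzN
  · rw [hoff _ (by simp; omega)]
    have := hA i m l hl z hz hz'
    exact ⟨fun h => this.1 (by omega), fun h => this.2 (by omega)⟩

theorem spec_walkTable {n : ℕ} {W : Fin n → Fin n → ℤ → EReal} (hW : RegularArcs W) :
    Spec (walkEnv n) n walkTable 2000 7 fun h h' => h 8 [] = 0 → IsWeights W (h 12) →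
      IsWalkTable W (((n ^ 2 : ℕ) : ℤ) + 1) (h' 18) := by
  unfold walkTable
  refine Spec.mono (Spec.seq (Spec.table (T := arr 18) ?_
    (Spec.fillRows rfl rfl rfl rfl fun i =>
      Spec.fillFor (κ := 1) (e := 2) (LoopRange.finSucc (n ^ 2)) rfl rfl rfl rfl rfl
        (by push_cast; nlinarith [Int.natCast_nonneg n]) fun l =>
      Spec.fillRows rfl rfl rfl rfl fun m =>
      Spec.fillFor (κ := 3) (e := 2)
        (LoopRange.icc (a := -(((n ^ 2 : ℕ) : ℤ) + 1)) (b := ((n ^ 2 : ℕ) : ℤ) + 1) (by omega))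
        rfl rfl rfl rfl rfl (by push_cast; nlinarith [Int.natCast_nonneg n]) fun z =>
      Spec.fill (va := [i, l, m, z]) rfl)
    (Spec.relaxRows rfl rfl rfl rfl fun i =>
      Spec.relaxAdd (va := [i, 0, i, 0]) (vb := []) (vc := []) rfl rfl rfl rfl
        (by simp [arr]) (by simp [arr])))
    (Spec.forInv (κ := 1) (e := 2) (C := 400) (D := 5)
      (J := fun k h => IsWeights W (h 12) ∧ IsWalkTable W k (h 18))
      (LoopRange.icc (a := 1) (b := ((n ^ 2 : ℕ) : ℤ)) (by omega)) rfl rfl rfl rfl rfl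
      (by push_cast; nlinarith [Int.natCast_nonneg n]) fun k => ?body)) ?_
  case body =>
    -- The targets are the entries of length `k` only; the entries of length `k - 1` in the same
    -- array may be read.
    refine Spec.mono (Spec.letSub (u := k) (v := 1) rfl rfl rfl
      (Spec.relaxRows rfl rfl rfl rfl fun i => Spec.relaxRows rfl rfl rfl rfl fun m =>
        Spec.relaxRows rfl rfl rfl rfl fun m' =>
        Spec.relaxFor (κ := 2) (e := 2)
          (LoopRange.icc (a := -((n ^ 2 : ℕ) : ℤ)) (b := ((n ^ 2 : ℕ) : ℤ)) (by omega))
          rfl rfl rfl rfl rfl (by push_cast; nlinarith [Int.natCast_nonneg n]) fun z =>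
        Spec.relaxFor (κ := 3) (e := 0) (LoopRange.icc (a := -1) (b := 1) (by norm_num))
          rfl rfl rfl rfl rfl (by norm_num) fun d =>
        Spec.letSub (u := z) (v := d) rfl rfl rfl
        (Spec.relaxAdd (T := {c | c.1 = 18 ∧ c.2[1]? = some (k : ℤ)}) (va := [i, k, m, z])
          (vb := [i, k - 1, m', z - d]) (vc := [m, m', d]) rfl rfl rfl ⟨rfl, rfl⟩
          (by simp) (by simp)))) ?_
    rintro h h' hR ⟨hS, hM⟩
    obtain ⟨k, hk1, hkn⟩ := k
    obtain ⟨q, rfl⟩ : ∃ q : ℕ, k = (q : ℤ) + 1 := ⟨(k - 1).toNat, by omega⟩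
    simp only [add_sub_cancel_right] at hR hM ⊢
    refine ⟨fun i j d hd hd' => ?_, hM.step hW (by omega) (fun c hc => ?_) ?_⟩
    · rw [← hR.agree 12 _ (by simp) (by decide)]
      exact hS i j d hd hd'
    · exact (hR.agree 18 c (by simpa using hc) (by decide)).symm
    · intro i m z hz hz' w
      rw [hR.le_iff_bound (by simp) (by decide)]
      refine and_congr_right fun _ => ?_
      simp only [relaxBound_iUnion, relaxBound_singleton, true_and, List.cons.injEq, Nat.cast_inj,
        Fin.val_inj, and_true]
      constructor
      · intro h3 hz1 hz2 m' d
        have := h3 i m m' ⟨z, hz1, hz2⟩ d ⟨rfl, rfl, rfl⟩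
        rwa [hS m m' d d.2.1 d.2.2] at this
      · rintro h3 i' m₁ m' z' d ⟨rfl, rfl, rfl⟩
        rw [hS m₁ m' d d.2.1 d.2.2]
        exact h3 z'.2.1 z'.2.2 m' d
  · intro c hc
    simp only [Set.mem_iUnion, Set.mem_singleton_iff] at hc
    obtain ⟨i, l, m, z, rfl⟩ := hc
    rfl
  · rintro h h'' ⟨h', ⟨hag, hT⟩, hJ⟩ h8 hS
    refine (hJ ⟨fun i j d hd hd' => ?_, fun i m l hl z hz hz' => ?_⟩).2
    · rw [← hag 12 _ (by simp [arr]) (by decide)]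
      exact hS i j d hd hd'
    · have key : ∀ w, h' 18 [(i.val : ℤ), (l : ℤ), (m.val : ℤ), z] ≤ w ↔
          (l = 0 → m = i → z = 0 → 0 ≤ w) := by
        intro w
        rw [hT 18 _ (by
          simp only [Set.mem_iUnion, Set.mem_singleton_iff]
          exact ⟨i, ⟨l, by omega⟩, m, ⟨z, hz, hz'⟩, rfl⟩) (by decide)]
        simp only [relaxBound_iUnion, relaxBound_singleton, h8, true_and, List.cons.injEq,
          Nat.cast_inj, Fin.val_inj, and_true, add_zero]
        constructor
        · rintro h3 rfl rfl rfl
          exact h3 m ⟨rfl, by simp, rfl, rfl⟩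
        · rintro h3 i' ⟨rfl, h5, rfl, h6⟩
          exact h3 (by omega) rfl h6.symm
      constructor
      · intro hk0
        obtain rfl : l = 0 := by omega
        refine eq_of_forall_ge_iff fun w => ?_
        rw [key]
        by_cases hc : m = i ∧ z = 0
        · simp [walkMax, hc]
        · simp only [walkMax, hc, if_false, bot_le, iff_true]
          exact fun _ h1 h2 => absurd ⟨h1, h2⟩ hc
      · intro hk1
        exact le_bot_iff.1 ((key ⊥).2 (by omega))

/-! ### The program that computes the sets `S_i` and the matrix `R` -/

/-- Array `4` becomes the table of the sets `S_i`. -/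
def loopTable : Program :=
  .seq (forLoop 10 1 4 (forLoop 11 5 0 (.realBot (4, [10, 11]))))
    (forLoop 10 1 4 (forLoop 11 5 0 (forLoop 12 2 0
      (relaxAdd (4, [10, 11]) (18, [10, 12, 10, 11]) (8, [])))))

/-- Array `5` becomes the matrix `R`. -/
def circuitTable : Program :=
  .seq (forLoop 10 1 4 (forLoop 11 1 4 (.realBot (5, [10, 11]))))
    (forLoop 10 1 4 (forLoop 11 1 4 (forLoop 12 2 6 (.seq (.intSub 13 6 12)
      (forLoop 14 1 13 (forLoop 15 9 6 (.seq (.intSub 16 1 15)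
        (relaxAdd (5, [10, 11]) (18, [10, 12, 11, 15]) (18, [11, 14, 10, 16])))))))))

theorem spec_loopTable {Place : Type*} {n : ℕ} (N : PTEG Place n) :
    Spec (walkEnv n) n loopTable 200 3 fun h h' => h 8 [] = 0 →
      IsWalkTable N.wt (((n ^ 2 : ℕ) : ℤ) + 1) (h 18) → IsShiftTable N.loopMax (h' 4) := by
  unfold loopTable
  refine Spec.mono (Spec.table (T := arr 4) ?_
    (Spec.fillRows rfl rfl rfl rfl fun i => Spec.fillSym rfl rfl rfl rfl rfl fun t =>
      Spec.fill (va := [i, t]) rfl)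
    (Spec.relaxRows rfl rfl rfl rfl fun i => Spec.relaxSym rfl rfl rfl rfl rfl fun t =>
      Spec.relaxFor (κ := 1) (e := 1) (LoopRange.icc (a := 1) (b := n) (by omega))
        rfl rfl rfl rfl rfl (by simp) fun l =>
      Spec.relaxAdd (va := [i, t]) (vb := [i, l, i, t]) (vc := []) rfl rfl rfl rfl
        (by simp [arr]) (by simp [arr]))) ?_
  · intro c hc
    simp only [Set.mem_iUnion, Set.mem_singleton_iff] at hc
    obtain ⟨i, t, rfl⟩ := hc
    rfl
  · rintro h h' ⟨-, hT⟩ h8 hF i t ht ht'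
    have hn : n ≤ n ^ 2 := Nat.le_self_pow (by decide) n
    refine eq_of_forall_ge_iff fun w => ?_
    rw [hT 4 _ (by
      simp only [Set.mem_iUnion, Set.mem_singleton_iff]
      exact ⟨i, ⟨t, ht, ht'⟩, rfl⟩) (by decide)]
    simp only [relaxBound_iUnion, relaxBound_singleton, true_and, List.cons.injEq, Nat.cast_inj,
      Fin.val_inj, and_true, h8, add_zero, PTEG.loopMax, iSup_le_iff]
    have e : ∀ l : ℕ, l ≤ n → h 18 [(i.val : ℤ), (l : ℤ), (i.val : ℤ), t] = walkMax N.wt i l i t :=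
      fun l hl => (hF i i l (hl.trans hn) t (by omega) (by omega)).1 (by omega)
    constructor
    · intro h3 l
      have := h3 i ⟨t, ht, ht'⟩ ⟨((l.val + 1 : ℕ) : ℤ), by omega, by omega⟩ ⟨rfl, rfl⟩
      rwa [e _ (by omega)] at this
    · rintro h3 i' t' ⟨l, hl, hl'⟩ ⟨rfl, rfl⟩
      obtain ⟨l, rfl⟩ : ∃ q : ℕ, l = ((q + 1 : ℕ) : ℤ) := ⟨(l - 1).toNat, by push_cast; omega⟩
      rw [e _ (by omega)]
      exact h3 ⟨l, by omega⟩

/-- Two rows, two lengths up to `n ^ 2` and a shift up to `n ^ 2` give the exponent 8, the largest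
in the first program. -/
theorem spec_circuitTable {Place : Type*} {n : ℕ} (N : PTEG Place n) :
    Spec (walkEnv n) n circuitTable 200 8 fun h h' =>
      IsWalkTable N.wt (((n ^ 2 : ℕ) : ℤ) + 1) (h 18) → IsMatrix N.matR (h' 5) := by
  unfold circuitTable
  refine Spec.mono (Spec.table (T := arr 5) ?_
    (Spec.fillRows rfl rfl rfl rfl fun i => Spec.fillRows rfl rfl rfl rfl fun j =>
      Spec.fill (va := [i, j]) rfl)
    (Spec.relaxRows rfl rfl rfl rfl fun i => Spec.relaxRows rfl rfl rfl rfl fun j =>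
      Spec.relaxFor (κ := 1) (e := 2)
        (LoopRange.icc (a := 1) (b := ((n ^ 2 : ℕ) : ℤ)) (by omega))
        rfl rfl rfl rfl rfl (by push_cast; nlinarith [Int.natCast_nonneg n]) fun l =>
      Spec.letSub (u := ((n ^ 2 : ℕ) : ℤ)) (v := l) rfl rfl rfl
      (Spec.relaxFor (κ := 1) (e := 2)
        (LoopRange.icc (a := 0) (b := ((n ^ 2 : ℕ) : ℤ) - l) (by have := l.2.2; omega))
        rfl rfl rfl rfl rfl
        (by have := l.2.1; push_cast; nlinarith [Int.natCast_nonneg n]) fun l' =>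
      Spec.relaxFor (κ := 2) (e := 2)
        (LoopRange.icc (a := -((n ^ 2 : ℕ) : ℤ)) (b := ((n ^ 2 : ℕ) : ℤ)) (by omega))
        rfl rfl rfl rfl rfl (by push_cast; nlinarith [Int.natCast_nonneg n]) fun z =>
      Spec.letSub (u := 0) (v := z) rfl rfl rfl
      (Spec.relaxAdd (va := [i, j]) (vb := [i, l, j, z]) (vc := [j, l', i, 0 - z]) rfl rfl rfl rfl
        (by simp [arr]) (by simp [arr]))))) ?_
  · intro c hc
    simp only [Set.mem_iUnion, Set.mem_singleton_iff] at hc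
    obtain ⟨i, j, rfl⟩ := hc
    rfl
  · rintro h h' ⟨-, hT⟩ hF i j
    refine eq_of_forall_ge_iff fun w => ?_
    rw [hT 5 _ (by
      simp only [Set.mem_iUnion, Set.mem_singleton_iff]
      exact ⟨i, j, rfl⟩) (by decide), N.matR_le_iff]
    simp only [relaxBound_iUnion, relaxBound_singleton, true_and, List.cons.injEq, Nat.cast_inj,
      Fin.val_inj, and_true, zero_sub]
    have e : ∀ (i j : Fin n) (l : ℕ), l ≤ n ^ 2 → ∀ z : ℤ, -((n ^ 2 : ℕ) : ℤ) ≤ z →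
        z ≤ ((n ^ 2 : ℕ) : ℤ) → h 18 [(i.val : ℤ), (l : ℤ), (j.val : ℤ), z] = walkMax N.wt i l j z :=
      fun i j l hl z hz hz' => (hF i j l hl z (by omega) (by omega)).1 (by omega)
    constructor
    · intro h3 l l' hl hll z
      by_cases hz : -((n ^ 2 : ℕ) : ℤ) ≤ z ∧ z ≤ ((n ^ 2 : ℕ) : ℤ)
      · have := h3 i j ⟨l, by omega, by omega⟩ ⟨l', by omega, by simp only; omega⟩ ⟨z, hz⟩ ⟨rfl, rfl⟩
        rwa [e i j l (by omega) z hz.1 hz.2, e j i l' (by omega) (-z) (by omega) (by omega)] at this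
      · rw [walkMax_eq_bot N.regular_wt (by omega)]
        simp
    · rintro h3 i' j' ⟨l, hl, hl'⟩ ⟨l', hl0, hll⟩ ⟨z, hz, hz'⟩ ⟨rfl, rfl⟩
      simp only at hll ⊢
      obtain ⟨l, rfl⟩ : ∃ q : ℕ, l = q := ⟨l.toNat, by omega⟩
      obtain ⟨l', rfl⟩ : ∃ q : ℕ, l' = q := ⟨l'.toNat, by omega⟩
      rw [e i' j' l (by omega) z hz hz', e j' i' l' (by omega) (-z) (by omega) (by omega)]
      exact h3 l l' (by omega) (by omega) z

/-! ### The Diophantine test on the sets S_i and the matrix R. -/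

namespace PTEG

variable {Place : Type*} {n : ℕ} (N : PTEG Place n)

theorem loopMax_eq_coe_iff (i : Fin n) (t : ℤ) (w : ℝ) :
    N.loopMax i t = w ↔ (t, w) ∈ N.setS i := by
  refine ⟨fun h => ?_, N.loopMax_eq_of_mem⟩
  obtain ⟨v, hv, hS⟩ := N.loopMax_isGreatest (h.trans_ne (EReal.coe_ne_bot w))
  rwa [EReal.coe_eq_coe_iff.1 (h.symm.trans hv)]

theorem dioBound_loopMax_iff : DioBound N.loopMax N.matR ↔ N.WeaklyConsistent := by
  have hmem : ∀ i t, N.loopMax i t ≠ ⊥ → ∃ p w, p ≠ [] ∧ p.length ≤ n ∧ SWalk N.wt i p i t w := by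
    intro i t h
    obtain ⟨w, -, hS⟩ := N.loopMax_isGreatest h
    obtain ⟨p, hp, hpn, hs⟩ := ((N.mem_setS_iff i t w).1 hS).1
    exact ⟨p, w, hp, hpn, hs⟩
  rw [dioBound_iff, N.weaklyConsistent_equivalences.2.1]
  · simp only [ShiftAccepts, loopMax_eq_coe_iff, AlgorithmAccepts, Prod.forall]
  · intro i t
    by_cases h : N.loopMax i t = ⊥
    · simp [h]
    · obtain ⟨w, hw, -⟩ := N.loopMax_isGreatest h
      simp [hw]
  · intro i t h
    obtain ⟨p, w, -, hpn, hs⟩ := hmem i t h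
    have := hs.abs_shift_le N.regular_wt
    omega
  · intro i h
    -- A closed walk of shift zero and length at most `n` is itself one of the circuits counted by
    -- `R i i`.
    obtain ⟨p, w, hp, hpn, hs⟩ := hmem i 0 h
    exact (N.matR_ne_bot_iff i i).2
      ⟨p, w, hpn.trans (Nat.le_self_pow (by decide) n), hs, hs.end_mem hp⟩

end PTEG

/-- Computation of the tables and the test, with the auxiliary integers at hand. -/
def walkMain : Program :=
  .seq weightTable (.seq walkTable (.seq loopTable (.seq circuitTable
    (.seq (.realBot (16, [])) (dioTest 4 5)))))

/-- The arrays with the input and the zero cell. -/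
def IsInput {Place : Type*} {n : ℕ} (N : PTEG Place n) (h : Heap) : Prop :=
  h 0 = matrixArray (N.matA 0) ∧ h 1 = matrixArray (N.matA 1) ∧
  h 2 = matrixArray (N.matB 0) ∧ h 3 = matrixArray (N.matB 1) ∧ h 8 [] = 0

theorem spec_walkMain {Place : Type*} {n : ℕ} (N : PTEG Place n) :
    Spec (walkEnv n) n walkMain 10000 8 fun h h' => IsInput N h →
      IsShiftTable N.loopMax (h' 4) ∧ IsMatrix N.matR (h' 5) ∧ h' 8 [] = 0 ∧
      (h' 16 [] ≤ 0 ↔ N.WeaklyConsistent) := by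
  unfold walkMain
  refine Spec.mono (Spec.seq (spec_weightTable N _ _ _ _).frame (Spec.seq
    (spec_walkTable N.regular_wt).frame (Spec.seq (spec_loopTable N).frame (Spec.seq
    (spec_circuitTable N).frame (Spec.seq (Spec.fill (va := []) rfl)
    (spec_dioTest _ _ _ _ (by decide) (by decide) (by decide) (by decide) (by decide)
      N.loopMax N.matR).frame))))) ?_
  rintro h h6 ⟨h1, ⟨f1, k1⟩, h2, ⟨f2, k2⟩, h3, ⟨f3, k3⟩, h4, ⟨f4, k4⟩, h5, k5, f6, k6⟩
    ⟨i0, i1, i2, i3, i8⟩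
  have f5 : ∀ a, a ≠ 16 → h5 a = h4 a := fun a ha => by
    funext l
    exact (k5 a l).2 (by simp [ha])
  have e1 := k1 i0 i1 i2 i3 i8
  have z1 : h1 8 [] = 0 := by rw [f1 8 (by decide), i8]
  have z2 : h2 8 [] = 0 := by rw [f2 8 (by decide), z1]
  have e2 := k2 z1 e1
  have e3 := k3 z2 e2
  have e4 := k4 (by rwa [f3 18 (by decide)])
  have z5 : h5 8 [] = 0 := by
    rw [f5 8 (by decide), f4 8 (by decide), f3 8 (by decide), z2]
  have s5 : IsShiftTable N.loopMax (h5 4) := by rwa [f5 4 (by decide), f4 4 (by decide)]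
  have r5 : IsMatrix N.matR (h5 5) := by rwa [f5 5 (by decide)]
  refine ⟨by rwa [f6 4 (by decide)], by rwa [f6 5 (by decide)], by rwa [f6 8 (by decide)], ?_⟩
  rw [k6 z5 s5 r5, (k5 16 []).1 rfl, N.dioBound_loopMax_iff]
  simp

/-! ### Preparation of the registers and output of the answer -/

theorem Spec.letNeg {env : List ℤ} {n : ℕ} {c : Program} {C D d z : ℕ} {R : Heap → Heap → Prop}
    {v : ℤ} (hd : env.length = d) (h1 : env[1]? = some 0) (hz : env[z]? = some v)
    (h : Spec (env ++ [-v]) n c C D R) : Spec env n (.seq (.intSub d 1 z) c) (1 + C) D R :=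
  Spec.letSub hd h1 hz (by rwa [zero_sub])

/-- Prepare the registers `2, 3, 4, 5`. -/
def withConstants (c : Program) : Program :=
  .seq (.intConst 2 1) (.seq (.intConst 3 (-1)) (.seq (.intSub 4 0 2) (.seq (.intSub 5 1 0) c)))

theorem Spec.withConstants {n : ℕ} {c : Program} {C D : ℕ} {R : Heap → Heap → Prop}
    (h : Spec [n, 0, 1, -1, (n : ℤ) - 1, -n] n c C D R) :
    Spec [n, 0] n (WeakConsistency.withConstants c) (1 + (1 + (1 + (1 + C)))) D R :=
  Spec.letConst rfl (Spec.letConst rfl (Spec.letSub (u := n) (v := 1) rfl rfl rfl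
    (Spec.letNeg (v := n) rfl rfl rfl h)))

/-- Run `c` and write the truth value of the final test into register `1`. -/
def answer (c : Program) : Program :=
  .seq c (.ite (.realLe (16, []) (8, [])) (.intConst 1 1) .skip)

theorem PTEG.isInput {Place : Type*} {n : ℕ} (N : PTEG Place n) : IsInput N N.input.real :=
  ⟨rfl, rfl, rfl, rfl, rfl⟩

/-- Converts the bounds in powers of `n + 1` into the form of the theorem; the summand one covers `n
= 0`. -/
theorem succ_pow_le {n D E : ℕ} (h : D ≤ E) : (n + 1) ^ D ≤ 2 ^ E * (n ^ E + 1) := by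
  refine (Nat.pow_le_pow_right (by omega) h).trans ?_
  rcases Nat.eq_zero_or_pos n with rfl | hn
  · simpa using Nat.one_le_two_pow.trans (Nat.le_mul_of_pos_right (2 ^ E) (Nat.succ_pos (0 ^ E)))
  · calc (n + 1) ^ E ≤ (2 * n) ^ E := Nat.pow_le_pow_left (by omega) E
      _ = 2 ^ E * n ^ E := mul_pow ..
      _ ≤ _ := Nat.mul_le_mul_left _ (by omega)

theorem Spec.exists_run {Place : Type*} {n : ℕ} (N : PTEG Place n) {c : Program} {C D E : ℕ}
    {Q : Heap → Prop} (hDE : D ≤ E)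
    (h : Spec [n, 0] n c C D fun h h' => IsInput N h →
      Q h' ∧ h' 8 [] = 0 ∧ (h' 16 [] ≤ 0 ↔ N.WeaklyConsistent)) :
    ∃ T τ, Runs (answer c) N.input T τ ∧ T ≤ (C + 2) * 2 ^ E * (n ^ E + 1) ∧
      N.AnswerCorrect τ ∧ Q τ.real := by
  have hm : Matches [(n : ℤ), 0] N.input.int := by
    intro i v hi
    rcases i with _ | _ | i
    · simpa [PTEG.input] using hi
    · simpa [PTEG.input] using hi
    · simp at hi
  obtain ⟨t, τ, hr, ht, hm', hR⟩ := h N.input hm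
  obtain ⟨hQ, h8, hW⟩ := hR N.isInput
  have hT : t + (1 + 1) ≤ (C + 2) * 2 ^ E * (n ^ E + 1) := by
    have h1 : 1 ≤ (n + 1) ^ D := Nat.one_le_pow _ _ (by omega)
    calc t + (1 + 1) ≤ (C + 2) * (n + 1) ^ D := by rw [add_mul]; omega
      _ ≤ (C + 2) * (2 ^ E * (n ^ E + 1)) := Nat.mul_le_mul_left _ (succ_pow_le hDE)
      _ = _ := (mul_assoc ..).symm
  have hiff : Test.Holds τ (.realLe (16, []) (8, [])) ↔ N.WeaklyConsistent := by
    rw [← hW, ← h8]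
    rfl
  by_cases hwc : N.WeaklyConsistent
  · refine ⟨_, _, .seq hr (.iteTrue (hiff.2 hwc) (.intConst _ _ _)), hT,
      ⟨fun _ => ?_, fun h => absurd hwc h⟩, hQ⟩
    simp [Memory.setInt]
  -- Register `1` still holds the constant zero, which is the negative answer.
  · exact ⟨_, _, .seq hr (.iteFalse (fun h => hwc (hiff.1 h)) (.skip _)), hT,
      ⟨fun h => absurd h hwc, fun _ => hm' 1 0 rfl⟩, hQ⟩

/-- The program that computes the sets `S_i` and the matrix `R` and decides weak consistency. -/
def walkProgram : Program :=
  answer (withConstants (.seq (square 6) (.seq (.intAdd 7 6 2) (.seq (.intSub 8 1 7)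
    (.seq (.intSub 9 1 6) walkMain)))))

theorem exists_runs_walkProgram {Place : Type*} {n : ℕ} (N : PTEG Place n) :
    ∃ T τ, Runs walkProgram N.input T τ ∧ T ≤ 20000 * 2 ^ 10 * (n ^ 10 + 1) ∧
      N.AnswerCorrect τ ∧ N.HoldsSR τ := by
  have key : Spec [n, 0] n (withConstants (.seq (square 6) (.seq (.intAdd 7 6 2)
      (.seq (.intSub 8 1 7) (.seq (.intSub 9 1 6) walkMain))))) 19998 8 fun h h' =>
      IsInput N h → (IsShiftTable N.loopMax (h' 4) ∧ IsMatrix N.matR (h' 5)) ∧ h' 8 [] = 0 ∧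
        (h' 16 [] ≤ 0 ↔ N.WeaklyConsistent) := by
    refine Spec.mono (Spec.withConstants (Spec.letSquare rfl rfl rfl rfl
      (Spec.letAdd (u := ((n ^ 2 : ℕ) : ℤ)) (v := 1) rfl rfl rfl
      (Spec.letNeg (v := ((n ^ 2 : ℕ) : ℤ) + 1) rfl rfl rfl
      (Spec.letNeg (v := ((n ^ 2 : ℕ) : ℤ)) rfl rfl rfl (spec_walkMain N)))))) ?_
    intro h h' hR hI
    obtain ⟨h1, h2, h3⟩ := hR hI
    exact ⟨⟨h1, h2⟩, h3⟩
  obtain ⟨T, τ, hr, hT, hA, hS, hR⟩ := Spec.exists_run (E := 10) N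
    (Q := fun h => IsShiftTable N.loopMax (h 4) ∧ IsMatrix N.matR (h 5)) (by decide) key
  refine ⟨T, τ, hr, hT, hA, fun i t ht ht' => ⟨fun w hw => ?_, fun hw => ?_⟩, hR⟩
  · rw [hS i t ht ht']
    exact N.loopMax_eq_of_mem hw
  · rw [hS i t ht ht']
    by_contra hne
    obtain ⟨w, -, hmem⟩ := N.loopMax_isGreatest hne
    exact hw ⟨w, hmem⟩

/-! ### The Floyd–Warshall algorithm for the matrices `M_K` -/

/-- The array holds the block matrix. -/
def IsBlockMatrix {n K : ℕ} (M : Matrix (Fin (K + 1) × Fin n) (Fin (K + 1) × Fin n) EReal)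
    (A : List ℤ → EReal) : Prop :=
  ∀ (k l : Fin (K + 1)) (i j : Fin n),
    A [(k.val : ℤ), (i.val : ℤ), (l.val : ℤ), (j.val : ℤ)] = M (k, i) (l, j)

/-- The registers during the computation of the star of `M_K`. -/
abbrev starEnv (n : ℕ) (a b c d : ℤ) (K : ℕ) : List ℤ := baseEnv n a b c d ++ [(K : ℤ)]

/-- The bound on `K` covers both `2 * n` and `2 * (n ^ 2 / 2)`; a loop over the columns counts as
two powers of `n`. -/
theorem Spec.fillCols {env : List ℤ} {n d K : ℕ} {c : Program} {C D : ℕ}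
    {I : Fin (K + 1) → Set Loc} (hK : K + 1 ≤ 2 * (n + 1) ^ 2)
    (hd : env.length = d) (h1 : env[1]? = some 0) (h2 : env[2]? = some 1)
    (h0 : env[10]? = some (K : ℤ))
    (hc : ∀ t : Fin (K + 1), Spec (env ++ [(t.val : ℤ)]) n c C D (FillRel (I t))) :
    Spec env n (WeakConsistency.forLoop d 1 10 c) (2 * (C + 2) + 2) (2 + D) (FillRel (⋃ t, I t)) :=
  Spec.fillFor (LoopRange.finSucc K) hd h1 h2 h1 h0 (by rw [sub_zero]; exact_mod_cast hK) hc

theorem Spec.relaxCols {env : List ℤ} {n d K : ℕ} {c : Program} {C D : ℕ} {T : Set Loc}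
    {E : Fin (K + 1) → Set Relaxation} (hK : K + 1 ≤ 2 * (n + 1) ^ 2)
    (hd : env.length = d) (h1 : env[1]? = some 0) (h2 : env[2]? = some 1)
    (h0 : env[10]? = some (K : ℤ))
    (hc : ∀ t : Fin (K + 1), Spec (env ++ [(t.val : ℤ)]) n c C D (RelaxRel T (E t))) :
    Spec env n (WeakConsistency.forLoop d 1 10 c) (2 * (C + 2) + 2) (2 + D)
      (RelaxRel T (⋃ t, E t)) :=
  Spec.relaxFor (LoopRange.finSucc K) hd h1 h2 h1 h0 (by rw [sub_zero]; exact_mod_cast hK) hc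

/-- The array `a` becomes the matrix `M_K`. -/
def blockTable (a : ℕ) : Program :=
  .seq
    (forLoop 11 1 10 (forLoop 12 1 4 (forLoop 13 1 10 (forLoop 14 1 4
      (.realBot (a, [11, 12, 13, 14]))))))
    (forLoop 11 1 10 (forLoop 12 1 4 (forLoop 13 1 4 (forLoop 14 3 2 (.seq (.intSub 15 11 14)
      (relaxAdd (a, [11, 12, 15, 13]) (12, [12, 13, 14]) (8, [])))))))

theorem spec_blockTable {Place : Type*} {n K : ℕ} (N : PTEG Place n) (x y z u : ℤ) {a : ℕ}
    (hK : K + 1 ≤ 2 * (n + 1) ^ 2) (h8 : a ≠ 8) (h9 : a ≠ 9) (h12 : a ≠ 12) :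
    Spec (starEnv n x y z u K) n (blockTable a) 200 6 fun h h' => AgreeOff (arr a) h h' ∧
      (h 8 [] = 0 → IsWeights N.wt (h 12) → IsBlockMatrix (N.matM K) (h' a)) := by
  unfold blockTable
  refine Spec.mono (Spec.table (T := arr a) ?_
    (Spec.fillCols hK rfl rfl rfl rfl fun k => Spec.fillRows rfl rfl rfl rfl fun i =>
      Spec.fillCols hK rfl rfl rfl rfl fun l => Spec.fillRows rfl rfl rfl rfl fun j =>
      Spec.fill (va := [k, i, l, j]) rfl)
    (Spec.relaxCols hK rfl rfl rfl rfl fun k => Spec.relaxRows rfl rfl rfl rfl fun i =>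
      Spec.relaxRows rfl rfl rfl rfl fun j =>
      Spec.relaxFor (κ := 3) (e := 0) (LoopRange.icc (a := -1) (b := 1) (by norm_num))
        rfl rfl rfl rfl rfl (by norm_num) fun d =>
      Spec.letSub (u := k) (v := d) rfl rfl rfl
      (Spec.relaxAdd (va := [k, i, k - d, j]) (vb := [i, j, d]) (vc := []) rfl rfl rfl rfl
        (by simp [arr, h12.symm]) (by simp [arr, h8.symm]) h9))) ?_
  · intro c hc
    simp only [Set.mem_iUnion, Set.mem_singleton_iff] at hc
    obtain ⟨k, i, l, j, rfl⟩ := hc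
    rfl
  · rintro h h' ⟨hag, hT⟩
    refine ⟨hag, fun e8 hW k l i j => eq_of_forall_ge_iff fun w => ?_⟩
    rw [hT a _ (by
      simp only [Set.mem_iUnion, Set.mem_singleton_iff]
      exact ⟨k, i, l, j, rfl⟩) h9, N.matM_apply]
    simp only [relaxBound_iUnion, relaxBound_singleton, true_and, List.cons.injEq, Nat.cast_inj,
      Fin.val_inj, and_true, e8, add_zero]
    constructor
    · intro h3
      by_cases hd : -1 ≤ (k.val : ℤ) - l.val ∧ (k.val : ℤ) - l.val ≤ 1
      · have := h3 k i j ⟨(k.val : ℤ) - l.val, hd⟩ ⟨rfl, rfl, by simp, rfl⟩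
        rwa [hW i j _ hd.1 hd.2] at this
      · have : N.wt i j ((k.val : ℤ) - l.val) = ⊥ := by
          by_contra hne
          exact hd (N.regular_wt.shift _ _ _ hne)
        simp [this]
    · rintro h3 k' i' j' ⟨d, hd, hd'⟩ ⟨rfl, rfl, h4, rfl⟩
      rw [hW i' j' d hd hd']
      rwa [show (k'.val : ℤ) - l.val = d by simp only at h4; omega] at h3

/-- The step of the Floyd–Warshall algorithm for the pivot in the registers `11` and `12`. -/
def pivotStep (a : ℕ) : Program :=
  .seq (.seq
    (forLoop 13 1 10 (forLoop 14 1 4 (forLoop 15 1 10 (forLoop 16 1 4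
      (.realBot (17, [13, 14, 15, 16]))))))
    (forLoop 13 1 10 (forLoop 14 1 4 (forLoop 15 1 10 (forLoop 16 1 4
      (relaxAdd (17, [13, 14, 15, 16]) (a, [13, 14, 11, 12]) (a, [11, 12, 15, 16])))))))
    (forLoop 13 1 10 (forLoop 14 1 4 (forLoop 15 1 10 (forLoop 16 1 4
      (relaxAdd (a, [13, 14, 15, 16]) (17, [13, 14, 15, 16]) (8, []))))))

/-- The sums through the pivot are first collected in array `17`: relaxing array `a` with sums of
its own entries would not be admissible. -/
theorem spec_pivotStep {n K : ℕ} (x y z u : ℤ) {a : ℕ} (hK : K + 1 ≤ 2 * (n + 1) ^ 2)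
    (h8 : a ≠ 8) (h9 : a ≠ 9) (h17 : a ≠ 17) (k : Fin (K + 1)) (i : Fin n) :
    Spec (starEnv n x y z u K ++ [(k.val : ℤ)] ++ [(i.val : ℤ)]) n (pivotStep a) 200 6
      fun h h' => AgreeOff (arr a ∪ arr 17) h h' ∧ (h 8 [] = 0 →
        ∀ D : Matrix (Fin (K + 1) × Fin n) (Fin (K + 1) × Fin n) EReal,
          IsBlockMatrix D (h a) → IsBlockMatrix (fwStep D (k, i)) (h' a)) := by
  unfold pivotStep
  refine Spec.mono (Spec.seq (Spec.table (T := arr 17) ?_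
    (Spec.fillCols hK rfl rfl rfl rfl fun p => Spec.fillRows rfl rfl rfl rfl fun q =>
      Spec.fillCols hK rfl rfl rfl rfl fun r => Spec.fillRows rfl rfl rfl rfl fun s =>
      Spec.fill (va := [p, q, r, s]) rfl)
    (Spec.relaxCols hK rfl rfl rfl rfl fun p => Spec.relaxRows rfl rfl rfl rfl fun q =>
      Spec.relaxCols hK rfl rfl rfl rfl fun r => Spec.relaxRows rfl rfl rfl rfl fun s =>
      Spec.relaxAdd (va := [p, q, r, s]) (vb := [p, q, k, i]) (vc := [k, i, r, s])
        rfl rfl rfl rfl (by simp [arr, h17]) (by simp [arr, h17]) (by decide) h9 h9))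
    (Spec.relaxCols hK rfl rfl rfl rfl fun p => Spec.relaxRows rfl rfl rfl rfl fun q =>
      Spec.relaxCols hK rfl rfl rfl rfl fun r => Spec.relaxRows rfl rfl rfl rfl fun s =>
      Spec.relaxAdd (T := arr a) (va := [p, q, r, s]) (vb := [p, q, r, s]) (vc := [])
        rfl rfl rfl rfl (by simp [arr, h17.symm]) (by simp [arr, h8.symm]) h9)) ?_
  · intro c hc
    simp only [Set.mem_iUnion, Set.mem_singleton_iff] at hc
    obtain ⟨p, q, r, s, rfl⟩ := hc
    rfl
  · rintro h h'' ⟨h', ⟨hag, hT⟩, hR⟩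
    refine ⟨fun b l hb hb9 => ?_, fun e8 D hD p r q s => eq_of_forall_ge_iff fun w => ?_⟩
    · simp only [arr, Set.mem_union, Set.mem_ofPred_eq, not_or] at hb
      rw [hag b l hb.2 hb9, hR.agree b l hb.1 hb9]
    · have ea : ∀ l, h' a l = h a l := fun l => (hag a l (by simp [arr, h17]) h9).symm
      have e8' : h' 8 [] = 0 := by rw [← hag 8 [] (by simp [arr]) (by decide), e8]
      have e17 : ∀ (p r : Fin (K + 1)) (q s : Fin n),
          h' 17 [(p.val : ℤ), (q.val : ℤ), (r.val : ℤ), (s.val : ℤ)] =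
            D (p, q) (k, i) + D (k, i) (r, s) := by
        intro p r q s
        refine eq_of_forall_ge_iff fun w => ?_
        rw [hT 17 _ (by
          simp only [Set.mem_iUnion, Set.mem_singleton_iff]
          exact ⟨p, q, r, s, rfl⟩) (by decide)]
        simp only [relaxBound_iUnion, relaxBound_singleton, true_and, List.cons.injEq,
          Nat.cast_inj, Fin.val_inj, and_true, hD _ _ _ _]
        constructor
        · intro h3
          exact h3 p q r s ⟨rfl, rfl, rfl, rfl⟩
        · rintro h3 p q r s ⟨rfl, rfl, rfl, rfl⟩
          exact h3
      rw [hR.le_iff_bound rfl h9, ea, hD, fwStep, max_le_iff]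
      refine and_congr_right fun _ => ?_
      simp only [relaxBound_iUnion, relaxBound_singleton, true_and, List.cons.injEq,
        Nat.cast_inj, Fin.val_inj, and_true, e17, e8', add_zero]
      constructor
      · intro h3
        exact h3 p q r s ⟨rfl, rfl, rfl, rfl⟩
      · rintro h3 p q r s ⟨rfl, rfl, rfl, rfl⟩
        exact h3

/-- All steps of the Floyd–Warshall algorithm. -/
def pivotLoop (a : ℕ) : Program := forLoop 11 1 10 (forLoop 12 1 4 (pivotStep a))

/-- The pivots before column `k` and those in column `k` before row `m`. -/
def pivotsBefore {n K : ℕ} (k m : ℤ) : Set (Fin (K + 1) × Fin n) :=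
  {v | (v.1.val : ℤ) < k ∨ (v.1.val : ℤ) = k ∧ (v.2.val : ℤ) < m}

/-- The array holds the result of the Floyd–Warshall algorithm after the pivots in `S`. -/
def PivotInv {n K : ℕ} (M : Matrix (Fin (K + 1) × Fin n) (Fin (K + 1) × Fin n) EReal) (a : ℕ)
    (S : Set (Fin (K + 1) × Fin n)) (h : Heap) : Prop :=
  h 8 [] = 0 ∧ ∃ D, FWInv M S D ∧ IsBlockMatrix D (h a)

/-- The pivots are taken in lexicographic order. A matrix of order O(n³) has O(n³) pivots, each of
cost O(n⁶), which gives the exponent 9. -/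
theorem spec_pivotLoop {n K : ℕ} (x y z u : ℤ) {a : ℕ} (hK : K + 1 ≤ 2 * (n + 1) ^ 2)
    (h8 : a ≠ 8) (h9 : a ≠ 9) (h17 : a ≠ 17)
    (M : Matrix (Fin (K + 1) × Fin n) (Fin (K + 1) × Fin n) EReal) :
    Spec (starEnv n x y z u K) n (pivotLoop a) 1000 9 fun h h' =>
      PivotInv M a ∅ h → PivotInv M a Set.univ h' := by
  unfold pivotLoop
  refine Spec.mono (Spec.forInv (κ := 2) (e := 2) (C := 300) (D := 7)
    (J := fun k => PivotInv M a (pivotsBefore k 0))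
    (LoopRange.finSucc K) rfl rfl rfl rfl rfl (by rw [sub_zero]; exact_mod_cast hK) fun k =>
    Spec.mono (Spec.forInv (κ := 1) (e := 1) (C := 200) (D := 6)
      (J := fun m => PivotInv M a (pivotsBefore k.val m)) (LoopRange.fin n) rfl rfl rfl rfl rfl
      (by simp) fun i => Spec.mono (spec_pivotStep x y z u hK h8 h9 h17 k i) ?step) ?_) ?_
  case step =>
    rintro h h' ⟨hag, hD⟩ ⟨e8, D, hF, hB⟩
    refine ⟨by rw [← hag 8 [] (by simp [arr, h8.symm]) (by decide), e8], _, ?_, hD e8 D hB⟩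
    have := hF.step (k, i)
    convert this using 1
    ext v
    simp only [pivotsBefore, Set.mem_ofPred_eq, Set.mem_insert_iff, Prod.ext_iff, Fin.ext_iff]
    omega
  · intro h h' hR
    have e : (pivotsBefore (k.val : ℤ) ((n : ℤ) - 1 + 1) : Set (Fin (K + 1) × Fin n)) =
        pivotsBefore ((k.val : ℤ) + 1) 0 := by
      ext v
      have := v.2.isLt
      simp only [pivotsBefore, Set.mem_ofPred_eq]
      omega
    rwa [e] at hR
  · intro h h' hR
    have e : (pivotsBefore 0 0 : Set (Fin (K + 1) × Fin n)) = ∅ := by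
      ext v
      simp only [pivotsBefore, Set.mem_ofPred_eq, Set.mem_empty_iff_false, iff_false]
      omega
    have e' : (pivotsBefore ((K : ℤ) + 1) 0 : Set (Fin (K + 1) × Fin n)) = Set.univ := by
      ext v
      have := v.1.isLt
      simp only [pivotsBefore, Set.mem_ofPred_eq, Set.mem_univ, iff_true]
      omega
    rwa [e, e'] at hR

/-- The location `16` is relaxed with the diagonal of the array `a`. -/
def diagonalBound (a : ℕ) : Program :=
  forLoop 11 1 10 (forLoop 12 1 4 (relaxAdd (16, []) (a, [11, 12, 11, 12]) (8, [])))

/-- The diagonal of the array `a` is relaxed with zero. -/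
def diagonalZero (a : ℕ) : Program :=
  forLoop 11 1 10 (forLoop 12 1 4 (relaxAdd (a, [11, 12, 11, 12]) (8, []) (8, [])))

/-- The array `a` becomes the Kleene star of `M_K`, and the location `16` is relaxed with a
positive number if the star does not exist. -/
def starTable (a : ℕ) : Program :=
  .seq (blockTable a) (.seq (pivotLoop a) (.seq (diagonalBound a) (diagonalZero a)))

theorem spec_diagonalBound {n K : ℕ} (x y z u : ℤ) {a : ℕ} (hK : K + 1 ≤ 2 * (n + 1) ^ 2)
    (h9 : a ≠ 9) (h16 : a ≠ 16) :
    Spec (starEnv n x y z u K) n (diagonalBound a) 100 3 fun h h' => AgreeOff (arr 16) h h' ∧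
      (h 8 [] = 0 → ∀ D : Matrix (Fin (K + 1) × Fin n) (Fin (K + 1) × Fin n) EReal,
        IsBlockMatrix D (h a) → (h' 16 [] ≤ 0 ↔ h 16 [] ≤ 0 ∧ ∀ v, D v v ≤ 0)) := by
  unfold diagonalBound
  refine Spec.mono (Spec.relaxCols hK rfl rfl rfl rfl fun k =>
    Spec.relaxRows rfl rfl rfl rfl fun i =>
    Spec.relaxAdd (T := arr 16) (va := []) (vb := [k, i, k, i]) (vc := []) rfl rfl rfl rfl
      (by simp [arr, h16]) (by simp [arr]) (hb9 := h9)) ?_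
  rintro h h' hR
  refine ⟨hR.agree, fun e8 D hD => ?_⟩
  rw [hR.le_iff_bound rfl (by decide)]
  simp only [relaxBound_iUnion, relaxBound_singleton, true_and, forall_const, hD _ _ _ _, e8,
    add_zero, Prod.forall]

theorem spec_diagonalZero {n K : ℕ} (x y z u : ℤ) {a : ℕ} (hK : K + 1 ≤ 2 * (n + 1) ^ 2)
    (h8 : a ≠ 8) (h9 : a ≠ 9) :
    Spec (starEnv n x y z u K) n (diagonalZero a) 100 3 fun h h' => AgreeOff (arr a) h h' ∧
      (h 8 [] = 0 → ∀ D : Matrix (Fin (K + 1) × Fin n) (Fin (K + 1) × Fin n) EReal,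
        IsBlockMatrix D (h a) → IsBlockMatrix (fun v w => max (D v w) (mpOne _ v w)) (h' a)) := by
  unfold diagonalZero
  refine Spec.mono (Spec.relaxCols hK rfl rfl rfl rfl fun k =>
    Spec.relaxRows rfl rfl rfl rfl fun i =>
    Spec.relaxAdd (T := arr a) (va := [k, i, k, i]) (vb := []) (vc := []) rfl rfl rfl rfl
      (by simp [arr, h8.symm]) (by simp [arr, h8.symm]) h9) ?_
  rintro h h' hR
  refine ⟨hR.agree, fun e8 D hD k l i j => eq_of_forall_ge_iff fun w => ?_⟩
  rw [hR.le_iff_bound rfl h9, hD, max_le_iff]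
  refine and_congr_right fun _ => ?_
  simp only [relaxBound_iUnion, relaxBound_singleton, true_and, List.cons.injEq, Nat.cast_inj,
    Fin.val_inj, and_true, e8, add_zero]
  by_cases hc : k = l ∧ i = j
  · obtain ⟨rfl, rfl⟩ := hc
    simp [mpOne]
  · simp only [mpOne, Prod.mk.injEq, hc, if_false, bot_le, iff_true]
    rintro k' i' ⟨rfl, rfl, rfl, rfl⟩
    exact absurd ⟨rfl, rfl⟩ hc

/-- The diagonal after all pivots is nonpositive exactly if there is no positive circuit; cell `16`
records this. In that case, only the empty walks are missing from the star. -/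
theorem spec_starTable {Place : Type*} {n K : ℕ} (N : PTEG Place n) (x y z u : ℤ) {a : ℕ}
    (hK : K + 1 ≤ 2 * (n + 1) ^ 2) (h8 : a ≠ 8) (h9 : a ≠ 9) (h12 : a ≠ 12) (h16 : a ≠ 16)
    (h17 : a ≠ 17) :
    Spec (starEnv n x y z u K) n (starTable a) 2000 9 fun h h' =>
      h 8 [] = 0 → IsWeights N.wt (h 12) →
      (h' 16 [] ≤ 0 ↔ h 16 [] ≤ 0 ∧ NoPosCircuitMatrix (N.matM K)) ∧
      (NoPosCircuitMatrix (N.matM K) → IsBlockMatrix (kleeneStar (N.matM K)) (h' a)) := by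
  unfold starTable
  refine Spec.mono (Spec.seq (spec_blockTable N x y z u hK h8 h9 h12)
    (Spec.seq (spec_pivotLoop x y z u hK h8 h9 h17 (N.matM K)).frame
    (Spec.seq (spec_diagonalBound x y z u hK h9 h16) (spec_diagonalZero x y z u hK h8 h9)))) ?_
  rintro h h4 ⟨h1, ⟨g1, k1⟩, h2, ⟨f2, k2⟩, h3, ⟨g3, k3⟩, g4, k4⟩ e8 hW
  have z1 : h1 8 [] = 0 := by rw [← g1 8 [] (by simp [arr, h8.symm]) (by decide), e8]
  obtain ⟨z2, D, hF, hD⟩ := k2 ⟨z1, _, .init (N.matM_ne_top K), k1 e8 hW⟩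
  have hw : (16 : ℕ) ∉ (pivotLoop a).writes := by
    simp [pivotLoop, pivotStep, forLoop, relaxAdd, relaxWith, Program.writes, h16.symm]
  have e16 : h2 16 [] = h 16 [] := by
    rw [f2 16 hw, ← g1 16 [] (by simp [arr, h16.symm]) (by decide)]
  have z3 : h3 8 [] = 0 := by rw [← g3 8 [] (by simp [arr]) (by decide), z2]
  have hD3 : IsBlockMatrix D (h3 a) := fun k l i j => by
    rw [← g3 a _ (by simp [arr, h16]) h9]
    exact hD k l i j
  refine ⟨?_, fun hM => ?_⟩
  · rw [← g4 16 [] (by simp [arr, h16.symm]) (by decide), k3 z2 D hD, e16, hF.noPosCircuit_iff]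
  · have := k4 z3 D hD3
    intro k l i j
    rw [this, hF.kleeneStar_eq hM]

/-! ### The program that computes the Kleene stars -/

theorem Runs.deterministic {c : Program} {σ τ τ' : Memory} {t t' : ℕ} (h : Runs c σ t τ)
    (h' : Runs c σ t' τ') : τ = τ' := by
  induction h generalizing t' τ' with
  | skip | intConst | intAdd | intSub | realZero | realBot | realAdd | realNeg =>
    cases h'; rfl
  | seq _ _ h1 h2 =>
    cases h' with
    | seq g1 g2 =>
      obtain rfl := h1 g1
      exact h2 g2
  | iteTrue hb _ h1 =>
    cases h' with
    | iteTrue _ g => exact h1 g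
    | iteFalse hb' _ => exact absurd hb hb'
  | iteFalse hb _ h1 =>
    cases h' with
    | iteTrue hb' _ => exact absurd hb' hb
    | iteFalse _ g => exact h1 g
  | loopDone hb =>
    cases h' with
    | loopDone _ => rfl
    | loopStep hb' _ _ => exact absurd hb' hb
  | loopStep hb _ _ h1 h2 =>
    cases h' with
    | loopDone hb' => exact absurd hb hb'
    | loopStep _ g1 g2 =>
      obtain rfl := h1 g1
      exact h2 g2

/-- By determinism, runs that witness different specifications are the same run. The parameter can
thus be chosen after the run has been inspected. -/
theorem Spec.all {ι : Type*} [Nonempty ι] {env : List ℤ} {n : ℕ} {c : Program} {C D : ℕ}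
    {R : ι → Heap → Heap → Prop} (h : ∀ x, Spec env n c C D (R x)) :
    Spec env n c C D fun h h' => ∀ x, R x h h' := by
  intro σ hσ
  obtain ⟨t, τ, hr, ht, hm, -⟩ := h (Classical.arbitrary ι) σ hσ
  refine ⟨t, τ, hr, ht, hm, fun x => ?_⟩
  obtain ⟨t', τ', hr', -, -, hR⟩ := h x σ hσ
  rwa [hr.deterministic hr']

/-! ### The Diophantine test on the Kleene stars. -/

namespace PTEG

variable {Place : Type*} {n : ℕ} (N : PTEG Place n)

/-- The analogue of `S_i` read off the Kleene star of `M_{2n}`, as a function. -/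
noncomputable def starShift (i : Fin n) (t : ℤ) : EReal :=
  if h : 0 ≤ n + t ∧ n + t ≤ 2 * n then
    kleeneStar (N.matM (2 * n)) (⟨(n + t).toNat, by omega⟩, i) (⟨n, by omega⟩, i)
  else ⊥

theorem starShift_eq_coe_iff (i : Fin n) (t : ℤ) (w : ℝ) :
    N.starShift i t = w ↔ (t, w) ∈ N.starS i := by
  unfold starShift starS
  split_ifs with h
  · refine ⟨fun hw => ⟨⟨(n + t).toNat, by omega⟩, Int.toNat_of_nonneg h.1, hw⟩, ?_⟩
    rintro ⟨a, ha, hw⟩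
    have e : ⟨(n + t).toNat, by omega⟩ = a := by
      ext
      simp only at ha ⊢
      omega
    rw [e]
    exact hw
  · refine ⟨fun hw => absurd hw.symm (EReal.coe_ne_bot w), ?_⟩
    rintro ⟨a, ha, -⟩
    have := a.isLt
    simp only at ha
    omega

/-- The empty walk at the middle column contributes zero. This is the diagonal hypothesis of
`dioBound_iff`. -/
theorem starR_self_ne_bot (i : Fin n) : N.starR i i ≠ ⊥ := by
  have h := le_iSup (fun l : Fin (2 * (n ^ 2 / 2) + 1) =>
    kleeneStar (N.matM (2 * (n ^ 2 / 2))) (l, i) (⟨n ^ 2 / 2, by omega⟩, i) +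
    kleeneStar (N.matM (2 * (n ^ 2 / 2))) (⟨n ^ 2 / 2, by omega⟩, i) (l, i)) ⟨n ^ 2 / 2, by omega⟩
  have h0 : 0 ≤ kleeneStar (N.matM (2 * (n ^ 2 / 2))) (⟨n ^ 2 / 2, by omega⟩, i)
      (⟨n ^ 2 / 2, by omega⟩, i) :=
    le_trans (by simp [mpPow, mpOne]) (le_iSup (fun r => mpPow (N.matM (2 * (n ^ 2 / 2))) r
      (⟨n ^ 2 / 2, by omega⟩, i) (⟨n ^ 2 / 2, by omega⟩, i)) 0)
  exact ne_bot_of_le_ne_bot (by simp) ((add_nonneg h0 h0).trans h)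

theorem weaklyConsistent_iff_star : N.WeaklyConsistent ↔ NoPosCircuitMatrix (N.matM (2 * n)) ∧
    NoPosCircuitMatrix (N.matM (2 * (n ^ 2 / 2))) ∧ ShiftAccepts N.starShift N.starR := by
  rw [N.weaklyConsistent_equivalences.2.2]
  simp only [ShiftAccepts, starShift_eq_coe_iff, StarTestAccepts, Prod.forall]

theorem dioBound_star_iff (h : NoPosCircuitMatrix (N.matM (2 * n))) :
    DioBound N.starShift N.starR ↔ ShiftAccepts N.starShift N.starR := by
  refine dioBound_iff (fun i t => ?_) (fun i t ht => ?_) fun i _ => N.starR_self_ne_bot i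
  · unfold starShift
    split_ifs
    · obtain ⟨D, hD⟩ := exists_fwInv (N.matM_ne_top (2 * n))
      exact hD.kleeneStar_ne_top h _ _
    · simp
  · unfold starShift at ht
    split_ifs at ht with hc
    · omega
    · exact absurd rfl ht

end PTEG

/-- The registers of the second program. -/
abbrev starBase (n : ℕ) : List ℤ :=
  baseEnv n ((n ^ 2 : ℕ) : ℤ) ((2 * n : ℕ) : ℤ) ((n ^ 2 / 2 : ℕ) : ℤ) ((2 * (n ^ 2 / 2) : ℕ) : ℤ)

/-- Array `19` becomes the table of the shifts read off the star in array `4`. -/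
def starShiftTable : Program :=
  .seq (forLoop 10 1 4 (forLoop 11 5 0 (.realBot (19, [10, 11]))))
    (forLoop 10 1 4 (forLoop 11 5 0 (.seq (.intAdd 12 0 11)
      (relaxAdd (19, [10, 11]) (4, [12, 10, 0, 10]) (8, [])))))

/-- Array `20` becomes the matrix read off the star in array `5`. -/
def starCircuitTable : Program :=
  .seq (forLoop 10 1 4 (forLoop 11 1 4 (.realBot (20, [10, 11]))))
    (forLoop 10 1 4 (forLoop 11 1 4 (forLoop 12 1 9
      (relaxAdd (20, [10, 11]) (5, [12, 11, 8, 10]) (5, [8, 10, 12, 11])))))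

theorem spec_starShiftTable {Place : Type*} {n : ℕ} (N : PTEG Place n) :
    Spec (starBase n) n starShiftTable 100 2 fun h h' => h 8 [] = 0 →
      IsBlockMatrix (kleeneStar (N.matM (2 * n))) (h 4) → IsShiftTable N.starShift (h' 19) := by
  unfold starShiftTable
  refine Spec.mono (Spec.table (T := arr 19) ?_
    (Spec.fillRows rfl rfl rfl rfl fun i => Spec.fillSym rfl rfl rfl rfl rfl fun t =>
      Spec.fill (va := [i, t]) rfl)
    (Spec.relaxRows rfl rfl rfl rfl fun i => Spec.relaxSym rfl rfl rfl rfl rfl fun t =>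
      Spec.letAdd (u := n) (v := t) rfl rfl rfl
      (Spec.relaxAdd (va := [i, t]) (vb := [n + t, i, n, i]) (vc := []) rfl rfl rfl rfl
        (by simp [arr]) (by simp [arr])))) ?_
  · intro c hc
    simp only [Set.mem_iUnion, Set.mem_singleton_iff] at hc
    obtain ⟨i, t, rfl⟩ := hc
    rfl
  · rintro h h' ⟨-, hT⟩ h8 hM i t ht ht'
    refine eq_of_forall_ge_iff fun w => ?_
    rw [hT 19 _ (by
      simp only [Set.mem_iUnion, Set.mem_singleton_iff]
      exact ⟨i, ⟨t, ht, ht'⟩, rfl⟩) (by decide)]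
    simp only [relaxBound_iUnion, relaxBound_singleton, true_and, List.cons.injEq, Nat.cast_inj,
      Fin.val_inj, and_true, h8, add_zero]
    have e : h 4 [n + t, (i.val : ℤ), (n : ℤ), (i.val : ℤ)] = N.starShift i t := by
      have := hM ⟨(n + t).toNat, by omega⟩ ⟨n, by omega⟩ i i
      rw [PTEG.starShift, dif_pos (by omega), ← this]
      simp only [Int.toNat_of_nonneg (show 0 ≤ (n : ℤ) + t by omega)]
    constructor
    · intro h3
      have := h3 i ⟨t, ht, ht'⟩ ⟨rfl, rfl⟩
      rwa [e] at this
    · rintro h3 i' t' ⟨rfl, rfl⟩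
      rwa [e]

theorem spec_starCircuitTable {Place : Type*} {n : ℕ} (N : PTEG Place n) :
    Spec (starBase n) n starCircuitTable 100 4 fun h h' =>
      IsBlockMatrix (kleeneStar (N.matM (2 * (n ^ 2 / 2)))) (h 5) →
      IsMatrix N.starR (h' 20) := by
  unfold starCircuitTable
  refine Spec.mono (Spec.table (T := arr 20) ?_
    (Spec.fillRows rfl rfl rfl rfl fun i => Spec.fillRows rfl rfl rfl rfl fun j =>
      Spec.fill (va := [i, j]) rfl)
    (Spec.relaxRows rfl rfl rfl rfl fun i => Spec.relaxRows rfl rfl rfl rfl fun j =>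
      Spec.relaxFor (κ := 1) (e := 2) (LoopRange.finSucc (2 * (n ^ 2 / 2))) rfl rfl rfl rfl rfl
        (by
          have h1 : 2 * (n ^ 2 / 2) ≤ n ^ 2 := Nat.mul_div_le _ _
          have h2 : ((2 * (n ^ 2 / 2) : ℕ) : ℤ) ≤ (n : ℤ) ^ 2 := by exact_mod_cast h1
          rw [Nat.cast_one]
          nlinarith [Int.natCast_nonneg n]) fun l =>
      Spec.relaxAdd (va := [i, j]) (vb := [l, j, (n ^ 2 / 2 : ℕ), i])
        (vc := [(n ^ 2 / 2 : ℕ), i, l, j]) rfl rfl rfl rfl (by simp [arr]) (by simp [arr]))) ?_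
  · intro c hc
    simp only [Set.mem_iUnion, Set.mem_singleton_iff] at hc
    obtain ⟨i, j, rfl⟩ := hc
    rfl
  · rintro h h' ⟨-, hT⟩ hM i j
    refine eq_of_forall_ge_iff fun w => ?_
    rw [hT 20 _ (by
      simp only [Set.mem_iUnion, Set.mem_singleton_iff]
      exact ⟨i, j, rfl⟩) (by decide)]
    simp only [relaxBound_iUnion, relaxBound_singleton, true_and, List.cons.injEq, Nat.cast_inj,
      Fin.val_inj, and_true, PTEG.starR, iSup_le_iff]
    have e1 := fun (l : Fin (2 * (n ^ 2 / 2) + 1)) (i j : Fin n) =>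
      hM l ⟨n ^ 2 / 2, by omega⟩ j i
    have e2 := fun (l : Fin (2 * (n ^ 2 / 2) + 1)) (i j : Fin n) =>
      hM ⟨n ^ 2 / 2, by omega⟩ l i j
    simp only at e1 e2
    simp only [e1, e2]
    constructor
    · intro h3 l
      exact h3 i j l ⟨rfl, rfl⟩
    · rintro h3 i' j' l ⟨rfl, rfl⟩
      exact h3 l

/-- Computation of the stars and the test, with the auxiliary integers at hand. -/
def starMain : Program :=
  .seq (.realBot (16, [])) (.seq weightTable (.seq (.seq (.intAdd 10 7 1) (starTable 4))
    (.seq (.seq (.intAdd 10 9 1) (starTable 5)) (.seq starShiftTable (.seq starCircuitTable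
      (dioTest 19 20))))))

theorem spec_starMain {Place : Type*} {n : ℕ} (N : PTEG Place n) :
    Spec (starBase n) n starMain 10000 9 fun h h' => IsInput N h →
      (N.HoldsStar (2 * n) 4 ⟨fun _ => 0, h'⟩ ∧ N.HoldsStar (2 * (n ^ 2 / 2)) 5 ⟨fun _ => 0, h'⟩) ∧
      h' 8 [] = 0 ∧ (h' 16 [] ≤ 0 ↔ N.WeaklyConsistent) := by
  have hK1 : 2 * n + 1 ≤ 2 * (n + 1) ^ 2 := by nlinarith
  have hK2 : 2 * (n ^ 2 / 2) + 1 ≤ 2 * (n + 1) ^ 2 := by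
    have h1 : 2 * (n ^ 2 / 2) ≤ n ^ 2 := Nat.mul_div_le _ _
    nlinarith
  have e : ∀ v : ℤ, v + 0 = v := add_zero
  unfold starMain
  refine Spec.mono (Spec.seq (Spec.fill (va := []) rfl) (Spec.seq
    (spec_weightTable N _ _ _ _).frame (Spec.seq
    (Spec.letAdd (d := 10) (u := ((2 * n : ℕ) : ℤ)) (v := 0) rfl rfl rfl
      (by
        rw [e]
        exact spec_starTable N _ _ _ _ hK1 (by decide) (by decide) (by decide) (by decide)
          (by decide))).frame
    (Spec.seq (Spec.letAdd (d := 10) (u := ((2 * (n ^ 2 / 2) : ℕ) : ℤ)) (v := 0) rfl rfl rfl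
      (by
        rw [e]
        exact spec_starTable N _ _ _ _ hK2 (by decide) (by decide) (by decide) (by decide)
          (by decide))).frame
    (Spec.seq (spec_starShiftTable N).frame (Spec.seq (spec_starCircuitTable N).frame
    (Spec.all fun SR : (Fin n → ℤ → EReal) × Matrix (Fin n) (Fin n) EReal =>
      spec_dioTest _ _ _ _ (by decide) (by decide) (by decide) (by decide) (by decide)
        SR.1 SR.2).frame)))))) ?_
  rintro h h7 ⟨h1, k1, h2, ⟨f2, k2⟩, h3, ⟨f3, k3⟩, h4, ⟨f4, k4⟩, h5, ⟨f5, k5⟩, h6, ⟨f6, k6⟩, f7, k7⟩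
    ⟨i0, i1, i2, i3, i8⟩
  have f1 : ∀ a, a ≠ 16 → h1 a = h a := fun a ha => by
    funext l
    exact (k1 a l).2 (by simp [ha])
  have z1 : h1 8 [] = 0 := by rw [f1 8 (by decide), i8]
  have e2 := k2 (by rw [f1 0 (by decide), i0]) (by rw [f1 1 (by decide), i1])
    (by rw [f1 2 (by decide), i2]) (by rw [f1 3 (by decide), i3]) z1
  have z2 : h2 8 [] = 0 := by rw [f2 8 (by decide), z1]
  obtain ⟨v3, s3⟩ := k3 z2 e2
  have z3 : h3 8 [] = 0 := by rw [f3 8 (by decide), z2]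
  obtain ⟨v4, s4⟩ := k4 z3 (by rwa [f3 12 (by decide)])
  have z4 : h4 8 [] = 0 := by rw [f4 8 (by decide), z3]
  have z6 : h6 8 [] = 0 := by rw [f6 8 (by decide), f5 8 (by decide), z4]
  -- Cell `16` was set to `-∞` at the start and has since collected the diagonals of both matrices.
  have v6 : h6 16 [] ≤ 0 ↔ NoPosCircuitMatrix (N.matM (2 * n)) ∧
      NoPosCircuitMatrix (N.matM (2 * (n ^ 2 / 2))) := by
    rw [f6 16 (by decide), f5 16 (by decide), v4, v3, f2 16 (by decide), (k1 16 []).1 rfl]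
    simp
  refine ⟨⟨fun hM k l i j => ?_, fun hM k l i j => ?_⟩, by rwa [f7 8 (by decide)], ?_⟩
  · simp only [f7 4 (by decide), f6 4 (by decide), f5 4 (by decide), f4 4 (by decide)]
    exact s3 hM k l i j
  · simp only [f7 5 (by decide), f6 5 (by decide), f5 5 (by decide)]
    exact s4 hM k l i j
  -- If a star does not exist, the tables read off the arrays are meaningless. The specification of
  -- the test is then applied to whatever they hold: cell `16` is already positive and relaxation
  -- cannot lower it.
  · by_cases hM : NoPosCircuitMatrix (N.matM (2 * n)) ∧
      NoPosCircuitMatrix (N.matM (2 * (n ^ 2 / 2)))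
    · have e5 := k5 z4 (by rw [f4 4 (by decide)]; exact s3 hM.1)
      have e6 := k6 (by rw [f5 5 (by decide)]; exact s4 hM.2)
      rw [k7 (N.starShift, N.starR) z6 (by rwa [f6 19 (by decide)]) e6, v6,
        N.dioBound_star_iff hM.1, N.weaklyConsistent_iff_star, and_assoc]
    · rw [k7 (fun i t => h6 19 [(i.val : ℤ), t], fun i j => h6 20 [(i.val : ℤ), (j.val : ℤ)]) z6
        (fun _ _ _ _ => rfl) fun _ _ => rfl, v6, N.weaklyConsistent_iff_star, ← and_assoc]
      simp only [hM, false_and]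

/-- The program that computes the Kleene stars and decides weak consistency. -/
def starProgram : Program :=
  answer (withConstants (.seq (square 6) (.seq (.intAdd 7 0 0) (.seq (half 8 6)
    (.seq (.intAdd 9 8 8) starMain)))))

theorem exists_runs_starProgram {Place : Type*} {n : ℕ} (N : PTEG Place n) :
    ∃ T τ, Runs starProgram N.input T τ ∧ T ≤ 20000 * 2 ^ 9 * (n ^ 9 + 1) ∧
      N.AnswerCorrect τ ∧ N.HoldsStar (2 * n) 4 τ ∧ N.HoldsStar (2 * (n ^ 2 / 2)) 5 τ := by
  have key : Spec [n, 0] n (withConstants (.seq (square 6) (.seq (.intAdd 7 0 0)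
      (.seq (half 8 6) (.seq (.intAdd 9 8 8) starMain))))) 19998 9 fun h h' =>
      IsInput N h → (N.HoldsStar (2 * n) 4 ⟨fun _ => 0, h'⟩ ∧
        N.HoldsStar (2 * (n ^ 2 / 2)) 5 ⟨fun _ => 0, h'⟩) ∧ h' 8 [] = 0 ∧
        (h' 16 [] ≤ 0 ↔ N.WeaklyConsistent) := by
    have e1 : (n : ℤ) + n = ((2 * n : ℕ) : ℤ) := by push_cast; ring
    have e2 : ((n ^ 2 / 2 : ℕ) : ℤ) + ((n ^ 2 / 2 : ℕ) : ℤ) = ((2 * (n ^ 2 / 2) : ℕ) : ℤ) := by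
      omega
    refine Spec.mono (Spec.withConstants (Spec.letSquare rfl rfl rfl rfl
      (Spec.letAdd (u := (n : ℤ)) (v := (n : ℤ)) rfl rfl rfl
      (Spec.letHalf (N := n ^ 2) rfl rfl rfl (Nat.pow_le_pow_left (by omega) 2)
      (Spec.letAdd (u := ((n ^ 2 / 2 : ℕ) : ℤ)) (v := ((n ^ 2 / 2 : ℕ) : ℤ)) rfl rfl rfl
        (by rw [e1, e2]; exact spec_starMain N)))))) fun _ _ h => h
  exact Spec.exists_run (E := 9) N (Q := fun h => N.HoldsStar (2 * n) 4 ⟨fun _ => 0, h⟩ ∧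
    N.HoldsStar (2 * (n ^ 2 / 2)) 5 ⟨fun _ => 0, h⟩) (by decide) key

end WeakConsistency

theorem mainTheorem2 :
    (∀ (n : ℕ) (Place : Type u) [Finite Place] (N : PTEG Place n),
      (N.WeaklyConsistent ↔ ¬ N.HasPosCircuit) ∧
      (N.WeaklyConsistent ↔ N.AlgorithmAccepts) ∧
      (N.WeaklyConsistent ↔ N.StarTestAccepts)) ∧
    (∃ (prog : Program) (c : ℕ),
      ∀ (n : ℕ) (Place : Type u) [Finite Place] (N : PTEG Place n),
        ∃ (T : ℕ) (τ : Memory), Runs prog N.input T τ ∧ T ≤ c * (n ^ 10 + 1) ∧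
          N.AnswerCorrect τ ∧ N.HoldsSR τ) ∧
    (∃ (prog : Program) (c : ℕ),
      ∀ (n : ℕ) (Place : Type u) [Finite Place] (N : PTEG Place n),
        ∃ (T : ℕ) (τ : Memory), Runs prog N.input T τ ∧ T ≤ c * (n ^ 9 + 1) ∧
          N.AnswerCorrect τ ∧ N.HoldsStar (2 * n) 4 τ ∧ N.HoldsStar (2 * (n ^ 2 / 2)) 5 τ) :=
  ⟨fun _ _ _ N => N.weaklyConsistent_equivalences,
    ⟨walkProgram, _, fun _ _ _ N => exists_runs_walkProgram N⟩,
    ⟨starProgram, _, fun _ _ _ N => exists_runs_starProgram N⟩⟩
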